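/- **Proposition A.1 (Santaló's formula with an external force).** Let $n\ge 2$ and let $\Omega\subset\mathbb R^n$ be a bounded open set (a domain, convex or not) with smooth boundary $\partial\Omega$, unit outer normal $n(x)$ and surface measure $d\mu$. Let $\varphi$ be a smooth real function and $Y$ a smooth field of real $n\times n$ matrices, both on a neighbourhood of $\overline\Omega$, with $Y$ skew-symmetric on $\overline\Omega$, and let $\tau\in\mathbb R$ satisfy $\varphi<\tau$ on $\overline\Omega$. Put $$P(x)=2(\tau-\varphi(x)),\qquad S^\tau_x=\{\theta\in\mathbb R^n:\ |\theta|^2=P(x)\},\qquad S^\tau\Omega=\{(x,\theta):\ x\in\Omega,\ \theta\in S^\tau_x\},$$ $$\partial_+S^\tau\Omega=\{(x,\theta):\ x\in\partial\Omega,\ \theta\in S^\tau_x,\ \langle\theta,n(x)\rangle>0\},$$ and let $d\theta$ be the surface measure of the sphere $S^\tau_x$ (so $S^\tau_x\Omega=S^\tau_x$ for $x\in\Omega$). Let $\gamma_{x,\theta}$ be the solution in $\overline\Omega$ of $$\ddot\gamma=-\nabla\varphi(\gamma)+Y(\gamma)\dot\gamma,\qquad \gamma(0)=x,\quad \dot\gamma(0)=\theta,$$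 and let $\ell_-(x,\theta)\le 0\le\ell_+(x,\theta)$ be its backward and forward exit times: $(\ell_-,0)$ and $(0,\ell_+)$ are the longest intervals of this form on which $\gamma_{x,\theta}$ lies in $\Omega$ (empty when the exit time is $0$). Assume that the flow is non-trapping, that is, $\ell_\pm(x,\theta)$ are finite for all $x\in\overline\Omega$, $\theta\in S^\tau_x$. Then for every (real or complex) $f\in L^1(S^\tau\Omega,d\theta\,dx)$, $$\int_\Omega\int_{S^\tau_x\Omega} f(x,\theta)\,d\theta\,dx=\int_{\partial_+S^\tau\Omega}\left(\int_{\ell_-(x,\theta)}^0 P(\gamma_{x,\theta}(s))^{1/2}\,f(\gamma_{x,\theta}(s),\dot\gamma_{x,\theta}(s))\,ds\right)P(x)^{-1/2}\,d\xi(x,\theta),$$ where $d\xi(x,\theta)=\langle\theta,n(x)\rangle\,d\theta\,d\mu(x)$; moreover all these integrals converge absolutely, the inner ones for almost every $x$, respectively for $\xi$-almost every $(x,\theta)$. -/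

import Mathlib

open MeasureTheory Set
open scoped ContDiff Gradient

noncomputable section

namespace Santalo

/-- Euclidean space `ℝⁿ`. -/
abbrev Sp (n : ℕ) := EuclideanSpace ℝ (Fin n)

variable {n : ℕ}

/-! ### Domains with smooth boundary -/

/-- `ρ` is a smooth local defining function of `Ω` at the boundary point `x`, on the open
neighbourhood `V` of `x`: near `x` the set `Ω` is `{ρ < 0}`, `ρ x = 0` and `∇ρ(x) ≠ 0`. -/
structure IsLocalDefiningFunction (Ω : Set (Sp n)) (x : Sp n) (V : Set (Sp n))
    (ρ : Sp n → ℝ) : Prop where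
  isOpen : IsOpen V
  mem : x ∈ V
  smooth : ContDiffOn ℝ ∞ ρ V
  eq_zero : ρ x = 0
  gradient_ne_zero : ∇ ρ x ≠ 0
  mem_iff : ∀ y ∈ V, (y ∈ Ω ↔ ρ y < 0)

/-- `Ω` has a smooth boundary: it lies locally on one side of a smooth hypersurface. -/
def HasSmoothBoundary (Ω : Set (Sp n)) : Prop :=
  ∀ x ∈ frontier Ω, ∃ V ρ, IsLocalDefiningFunction Ω x V ρ

/-- `ν` is the unit outer normal to `∂Ω` at `x`. -/
def IsOuterUnitNormal (Ω : Set (Sp n)) (x ν : Sp n) : Prop :=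
  ∃ V ρ, IsLocalDefiningFunction Ω x V ρ ∧ ν = ‖∇ ρ x‖⁻¹ • ∇ ρ x

open Classical in
/-- The unit outer normal `n(x)` at `x ∈ ∂Ω` (and `0` at points that are not smooth boundary
points). -/
def outerNormal (Ω : Set (Sp n)) (x : Sp n) : Sp n :=
  if h : ∃ ν, IsOuterUnitNormal Ω x ν then h.choose else 0

/-- The surface (Lebesgue) measure `μ` of `∂Ω`: the `(n-1)`-dimensional Hausdorff measure,
normalized as `(n-1)`-dimensional Lebesgue measure, on `∂Ω`. -/
def surfaceMeasure (Ω : Set (Sp n)) : Measure (Sp n) :=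
  (Measure.euclideanHausdorffMeasure (n - 1)).restrict (frontier Ω)

/-! ### The energy shell -/

/-- `P(x) = 2 (τ - φ(x))`. -/
def P (φ : Sp n → ℝ) (τ : ℝ) (x : Sp n) : ℝ := 2 * (τ - φ x)

/-- The speed `p(x) = √(2 (τ - φ(x)))` at energy `τ`. -/
def speed (φ : Sp n → ℝ) (τ : ℝ) (x : Sp n) : ℝ := √(P φ τ x)

/-- The energy `H(x, θ) = |θ|² / 2 + φ(x)`. -/
def energy (φ : Sp n → ℝ) (q : Sp n × Sp n) : ℝ := ‖q.2‖ ^ 2 / 2 + φ q.1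

/-- The sphere bundle `S^τ A` over a set `A`. -/
def shell (φ : Sp n → ℝ) (τ : ℝ) (A : Set (Sp n)) : Set (Sp n × Sp n) :=
  {q | q.1 ∈ A ∧ q.2 ≠ 0 ∧ energy φ q = τ}

/-- The outgoing boundary `∂₊S^τΩ`. -/
def outgoing (φ : Sp n → ℝ) (τ : ℝ) (Ω : Set (Sp n)) : Set (Sp n × Sp n) :=
  {q | q ∈ shell φ τ (frontier Ω) ∧ 0 < inner ℝ q.2 (outerNormal Ω q.1)}

/-- The measure `dθ` on the fiber `S^τ_x`, the sphere of radius `p(x)`: with `θ = p(x) v` and `dv`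
the surface measure of the unit sphere, `dθ = p(x)^(n-1) dv`. -/
def fiberMeasure (φ : Sp n → ℝ) (τ : ℝ) (x : Sp n) : Measure (Sp n) :=
  Measure.map (fun v : Metric.sphere (0 : Sp n) 1 ↦ speed φ τ x • (v : Sp n))
    (ENNReal.ofReal (speed φ τ x ^ (n - 1)) • (volume : Measure (Sp n)).toSphere)

/-- The measure `dθ dm(x)` on the sphere bundle, for a measure `m` on the base. -/
def bundleMeasure (φ : Sp n → ℝ) (τ : ℝ) (m : Measure (Sp n)) : Measure (Sp n × Sp n) :=
  Measure.map (fun r : Sp n × Metric.sphere (0 : Sp n) 1 ↦ (r.1, speed φ τ r.1 • (r.2 : Sp n)))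
    ((m.prod (volume : Measure (Sp n)).toSphere).withDensity
      fun r ↦ ENNReal.ofReal (speed φ τ r.1 ^ (n - 1)))

/-- The measure `dθ dx` on `S^τΩ`. -/
def phaseMeasure (φ : Sp n → ℝ) (τ : ℝ) (Ω : Set (Sp n)) : Measure (Sp n × Sp n) :=
  bundleMeasure φ τ (volume.restrict Ω)

/-- The measure `dξ(x, θ) = ⟨θ, n(x)⟩ dθ dμ(x)` on `∂₊S^τΩ`. -/
def xiMeasure (φ : Sp n → ℝ) (τ : ℝ) (Ω : Set (Sp n)) : Measure (Sp n × Sp n) :=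
  ((bundleMeasure φ τ (surfaceMeasure Ω)).restrict (outgoing φ τ Ω)).withDensity
    fun q ↦ ENNReal.ofReal (inner ℝ q.2 (outerNormal Ω q.1))

/-! ### The flow -/

/-- The external force `F(x, θ) = -∇φ(x) + Y(x) θ`. -/
def force (φ : Sp n → ℝ) (Y : Sp n → Matrix (Fin n) (Fin n) ℝ) (x θ : Sp n) : Sp n :=
  -∇ φ x + Matrix.toEuclideanLin (Y x) θ

/-- The generator `(x, θ) ↦ (θ, F(x, θ))` of the flow. -/
def vectorField (φ : Sp n → ℝ) (Y : Sp n → Matrix (Fin n) (Fin n) ℝ) (q : Sp n × Sp n) :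
    Sp n × Sp n :=
  (q.2, force φ Y q.1 q.2)

/-- Between the times `0` and `t`, the curve `c = (X, Θ)` solves `Ẋ = Θ`, `Θ̇ = F(X, Θ)` with
`c(0) = q`, and `X` stays in `closure Ω`. -/
def IsTrajectory (φ : Sp n → ℝ) (Y : Sp n → Matrix (Fin n) (Fin n) ℝ) (Ω : Set (Sp n))
    (q : Sp n × Sp n) (t : ℝ) (c : ℝ → Sp n × Sp n) : Prop :=
  c 0 = q ∧ IsIntegralCurveOn c (fun _ ↦ vectorField φ Y) (uIcc 0 t) ∧
    ∀ s ∈ uIcc 0 t, (c s).1 ∈ closure Ω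

open Classical in
/-- The flow `(γ_{x,θ}(t), γ̇_{x,θ}(t))` in `closure Ω`, for `q = (x, θ)`, at every time `t` up to
which the solution exists in `closure Ω` (and `q` itself at other times). -/
def flow (φ : Sp n → ℝ) (Y : Sp n → Matrix (Fin n) (Fin n) ℝ) (Ω : Set (Sp n))
    (q : Sp n × Sp n) (t : ℝ) : Sp n × Sp n :=
  if h : ∃ c, IsTrajectory φ Y Ω q t c then h.choose t else q

/-- The times `t ≥ 0` such that the trajectory of `q` stays in `Ω` on `(0, t)`. -/
def forwardTimes (φ : Sp n → ℝ) (Y : Sp n → Matrix (Fin n) (Fin n) ℝ) (Ω : Set (Sp n))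
    (q : Sp n × Sp n) : Set ℝ :=
  {t | 0 ≤ t ∧ ∃ c, IsTrajectory φ Y Ω q t c ∧ ∀ s ∈ Ioo 0 t, (c s).1 ∈ Ω}

/-- The times `t ≤ 0` such that the trajectory of `q` stays in `Ω` on `(t, 0)`. -/
def backwardTimes (φ : Sp n → ℝ) (Y : Sp n → Matrix (Fin n) (Fin n) ℝ) (Ω : Set (Sp n))
    (q : Sp n × Sp n) : Set ℝ :=
  {t | t ≤ 0 ∧ ∃ c, IsTrajectory φ Y Ω q t c ∧ ∀ s ∈ Ioo t 0, (c s).1 ∈ Ω}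

/-- The backward exit time `ℓ₋(x, θ) ≤ 0`. -/
def ellMinus (φ : Sp n → ℝ) (Y : Sp n → Matrix (Fin n) (Fin n) ℝ) (Ω : Set (Sp n))
    (q : Sp n × Sp n) : ℝ :=
  sInf (backwardTimes φ Y Ω q)

/-- The flow at energy `τ` is non-trapping: every trajectory leaves `Ω` in finite time, forward
and backward, that is `ℓ₊` and `ℓ₋` are finite on `S^τ(closure Ω)`. -/
def NonTrapping (φ : Sp n → ℝ) (Y : Sp n → Matrix (Fin n) (Fin n) ℝ) (τ : ℝ)
    (Ω : Set (Sp n)) : Prop :=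
  ∀ q ∈ shell φ τ (closure Ω),
    BddAbove (forwardTimes φ Y Ω q) ∧ BddBelow (backwardTimes φ Y Ω q)

end Santalo

end

/-! Write `W = (θ, F)` for the generator, `H` for the energy and `p` for the speed. Three facts
carry the formula. `W` is divergence free in `(x, θ)`, because `∇φ(x)` does not involve `θ` and `Y`
has zero diagonal. `H` is constant along trajectories in the closure of `Ω`, because `Y` is skew.
Almost every trajectory that starts in `Ω` leaves it transversally.

Near a point whose trajectory leaves transversally, all trajectories of some fixed length `T` meet
`∂Ω` at most once and end outside (`IsCutoffFlow.exists_tube`). For `f` supported there, `u(q) = ∫₀ᵀ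
f(Φ₋ₛ q) ds` satisfies `Wu = f` almost everywhere on `Ω`, and at outgoing boundary points it is the
integral of `f` over the backward trajectory. The divergence theorem then gives `∫ f dx dθ = ∫∫ u
⟨θ, n⟩ dμ dθ` (`IsTube.integral_eq`). Replace `f` by `f · w_ε(H)`, where `w_ε` tends to the Dirac
mass at `τ`. By conservation of energy the weight comes out of `u`, and in the limit Lebesgue
measure in `θ` becomes `p⁻¹ dθ` on the sphere, on both sides (`tendsto_integral_thin_shell`,
`IsTube.integral_shell_eq`).

So `p⁻¹ dθ dx` and the image of `p⁻¹ dξ ds` under `(q, s) ↦ Φₛ q` agree near every such point. The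
second measure lives on these points by construction. For the first one, the exceptional orbits pass
through vectors tangent to `∂Ω`; they depend on `n - 1` parameters of position, `n - 2` of direction
and one of time, one less than the dimension `2n - 1` of the shell, hence form a null set
(`IsCutoffFlow.phaseMeasure_glancingOrbits`). The two measures are therefore equal
(`phaseTime_eq_orbitMeasure`). Integrating `p f` and applying Fubini's theorem gives the formula
together with all integrability claims.

Only Lipschitz dependence of the flow on the initial point is used. Accordingly `u` is merely
Lipschitz, the divergence theorem is proved for Lipschitz functions by translating the indicator of
`Ω`, and the null set is found through Hausdorff dimension. Beforehand `φ` and `Y` are extended to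
the whole space with `P` between positive constants, and `W` is cut off outside a ball containing
the shell, which makes the flow complete. -/

noncomputable section

namespace Santalo

variable {n : ℕ}

/-! ### Global flows of bounded Lipschitz fields -/

section GlobalFlow

variable {E : Type*} [NormedAddCommGroup E] [NormedSpace ℝ E]

/-- A bounded Lipschitz vector field has an integral curve through every point, defined for all
times. -/
theorem exists_global_integralCurve [CompleteSpace E] {Z : E → E} {K : NNReal}
    (hZ : LipschitzWith K Z) {M : NNReal} (hM : ∀ q, ‖Z q‖ ≤ M) (q : E) :
    ∃ c : ℝ → E, c 0 = q ∧ ∀ t, HasDerivAt c (Z (c t)) t := by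
  -- At speed at most `M`, a curve cannot leave the ball of radius `M (N + 1)` within time `N + 1`,
  -- so Picard–Lindelöf applies on intervals of any length.
  have key : ∀ N : ℕ, ∃ c : ℝ → E, c 0 = q ∧
      ∀ t ∈ Icc (-((N : ℝ) + 1)) (N + 1),
        HasDerivWithinAt c (Z (c t)) (Icc (-((N : ℝ) + 1)) (N + 1)) t := by
    intro N
    have h0 : (0 : ℝ) ∈ Icc (-((N : ℝ) + 1)) (N + 1) := by
      constructor <;> linarith [(Nat.cast_nonneg N : (0 : ℝ) ≤ N)]
    have hpl : IsPicardLindelof (fun _ : ℝ ↦ Z) (⟨0, h0⟩ : Icc (-((N : ℝ) + 1)) (N + 1)) q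
        (M * (N + 1)) 0 M K := by
      refine IsPicardLindelof.of_time_independent (fun x _ ↦ hM x) (hZ.lipschitzOnWith) ?_
      simp
    obtain ⟨c, hc0, hc⟩ := hpl.exists_eq_forall_mem_Icc_hasDerivWithinAt₀
    exact ⟨c, hc0, hc⟩
  choose c hc0 hc using key
  have hd : ∀ N : ℕ, ∀ t ∈ Ioo (-((N : ℝ) + 1)) (N + 1), HasDerivAt (c N) (Z (c N t)) t :=
    fun N t ht ↦ (hc N t (Ioo_subset_Icc_self ht)).hasDerivAt (Icc_mem_nhds ht.1 ht.2)
  have heq : ∀ N N' : ℕ, N ≤ N' → EqOn (c N) (c N') (Ioo (-((N : ℝ) + 1)) (N + 1)) := by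
    intro N N' hN
    have hN' : (N : ℝ) ≤ N' := by exact_mod_cast hN
    refine ODE_solution_unique_of_mem_Ioo (v := fun _ ↦ Z) (s := fun _ ↦ univ) (t₀ := 0)
      (fun t _ ↦ hZ.lipschitzOnWith) ?_ (fun t ht ↦ ⟨hd N t ht, mem_univ _⟩)
      (fun t ht ↦ ⟨hd N' t ⟨by linarith [ht.1], by linarith [ht.2]⟩, mem_univ _⟩) ?_
    · constructor <;> linarith [(Nat.cast_nonneg N : (0 : ℝ) ≤ N)]
    · rw [hc0, hc0]
  refine ⟨fun t ↦ c ⌈|t|⌉₊ t, by simpa using hc0 _, fun t ↦ ?_⟩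
  set N := ⌈|t|⌉₊ with hN
  have ht : |t| < (N : ℝ) + 1 := lt_of_le_of_lt (Nat.le_ceil _) (by simp [hN])
  -- The index `⌈|s|⌉₊` jumps at integers, but near `t` it is at most `N + 1`, and all these curves
  -- agree there with `c (N + 1)`.
  have hev : (fun s : ℝ ↦ c ⌈|s|⌉₊ s) =ᶠ[nhds t] c (N + 1) := by
    have : ∀ᶠ s in nhds t, |s| < (N : ℝ) + 1 := continuous_abs.continuousAt.eventually_lt_const ht
    filter_upwards [this] with s hs
    refine heq _ _ (Nat.ceil_le.2 (by push_cast; exact hs.le)) ?_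
    have : |s| < ⌈|s|⌉₊ + 1 := lt_of_le_of_lt (Nat.le_ceil _) (by simp)
    exact abs_lt.1 this
  have h2 := hd (N + 1) t (abs_lt.1 (by push_cast; linarith))
  have h3 : c N t = c (N + 1) t := hev.self_of_nhds
  show HasDerivAt _ (Z (c N t)) t
  rw [h3]
  exact h2.congr_of_eventuallyEq hev

/-- `Φ` is the global flow of the vector field `Z`. -/
structure IsGlobalFlow (Z : E → E) (Φ : ℝ → E → E) : Prop where
  zero : ∀ q, Φ 0 q = q
  hasDerivAt : ∀ q t, HasDerivAt (fun s ↦ Φ s q) (Z (Φ t q)) t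

theorem exists_isGlobalFlow [CompleteSpace E] {Z : E → E} {K : NNReal}
    (hZ : LipschitzWith K Z) {M : NNReal} (hM : ∀ q, ‖Z q‖ ≤ M) :
    ∃ Φ : ℝ → E → E, IsGlobalFlow Z Φ := by
  choose c hc0 hc using exists_global_integralCurve hZ hM
  exact ⟨fun t q ↦ c q t, hc0, hc⟩

namespace IsGlobalFlow

variable {Z : E → E} {Φ : ℝ → E → E} {K M : NNReal}

theorem continuous_time (h : IsGlobalFlow Z Φ) (q : E) : Continuous fun t ↦ Φ t q :=
  continuous_iff_continuousAt.2 fun t ↦ (h.hasDerivAt q t).continuousAt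

theorem add (h : IsGlobalFlow Z Φ) (hZ : LipschitzWith K Z) (s t : ℝ) (q : E) :
    Φ (s + t) q = Φ s (Φ t q) := by
  have := ODE_solution_unique_univ (v := fun _ ↦ Z) (s := fun _ ↦ univ) (t₀ := 0)
    (f := fun s ↦ Φ (s + t) q) (g := fun s ↦ Φ s (Φ t q)) (fun t ↦ hZ.lipschitzOnWith)
    (fun s ↦ ⟨(h.hasDerivAt q (s + t)).comp_add_const s t, mem_univ _⟩)
    (fun s ↦ ⟨h.hasDerivAt _ s, mem_univ _⟩) (by simp [h.zero])
  exact congrFun this s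

theorem neg_self (h : IsGlobalFlow Z Φ) (hZ : LipschitzWith K Z) (t : ℝ) (q : E) :
    Φ (-t) (Φ t q) = q := by
  rw [← h.add hZ, neg_add_cancel, h.zero]

theorem self_neg (h : IsGlobalFlow Z Φ) (hZ : LipschitzWith K Z) (t : ℝ) (q : E) :
    Φ t (Φ (-t) q) = q := by
  rw [← h.add hZ, add_neg_cancel, h.zero]

theorem dist_le_of_nonneg (h : IsGlobalFlow Z Φ) (hZ : LipschitzWith K Z) {t : ℝ} (ht : 0 ≤ t)
    (q q' : E) : dist (Φ t q) (Φ t q') ≤ dist q q' * Real.exp (K * t) := by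
  have := dist_le_of_trajectories_ODE (v := fun _ ↦ Z) (K := K) (a := 0) (b := t)
    (f := fun t ↦ Φ t q) (g := fun t ↦ Φ t q') (δ := dist q q') (fun t ↦ hZ)
    (h.continuous_time q).continuousOn (fun s _ ↦ (h.hasDerivAt q s).hasDerivWithinAt)
    (h.continuous_time q').continuousOn (fun s _ ↦ (h.hasDerivAt q' s).hasDerivWithinAt)
    (by simp [h.zero]) t ⟨ht, le_rfl⟩
  simpa using this

theorem neg (h : IsGlobalFlow Z Φ) : IsGlobalFlow (fun q ↦ -Z q) (fun t ↦ Φ (-t)) where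
  zero q := by simp [h.zero]
  hasDerivAt q t := by
    simpa [Function.comp_def] using (h.hasDerivAt q (-t)).scomp t (hasDerivAt_neg t)

theorem dist_le (h : IsGlobalFlow Z Φ) (hZ : LipschitzWith K Z) (t : ℝ)
    (q q' : E) : dist (Φ t q) (Φ t q') ≤ dist q q' * Real.exp (K * |t|) := by
  rcases le_total 0 t with ht | ht
  · rw [abs_of_nonneg ht]; exact h.dist_le_of_nonneg hZ ht q q'
  · have := h.neg.dist_le_of_nonneg (K := K) (hZ.neg) (neg_nonneg.2 ht) q q'
    rw [abs_of_nonpos ht]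
    simpa using this

theorem dist_time_le (h : IsGlobalFlow Z Φ) (hM : ∀ q, ‖Z q‖ ≤ M) (s t : ℝ) (q : E) :
    dist (Φ s q) (Φ t q) ≤ M * dist s t := by
  have : LipschitzWith M fun t ↦ Φ t q :=
    lipschitzWith_of_nnnorm_deriv_le (fun t ↦ (h.hasDerivAt q t).differentiableAt)
      fun t ↦ by rw [(h.hasDerivAt q t).deriv]; exact hM _
  exact this.dist_le_mul s t

/-- Grönwall's bound controls the change of initial point, uniformly for bounded times; continuity
of the single curve through `q` controls the change of time. -/
theorem continuous (h : IsGlobalFlow Z Φ) (hZ : LipschitzWith K Z) :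
    Continuous fun p : ℝ × E ↦ Φ p.1 p.2 := by
  rw [continuous_iff_continuousAt]
  rintro ⟨t, q⟩
  have h1 : ContinuousAt (fun p : ℝ × E ↦ dist p.2 q * Real.exp (K * |p.1|)
      + dist (Φ p.1 q) (Φ t q)) (t, q) := by
    have := h.continuous_time q
    have h2 : Continuous fun p : ℝ × E ↦ Φ p.1 q := this.comp continuous_fst
    fun_prop
  rw [ContinuousAt, tendsto_iff_dist_tendsto_zero]
  have h3 : Filter.Tendsto (fun p : ℝ × E ↦ dist p.2 q * Real.exp (K * |p.1|)
      + dist (Φ p.1 q) (Φ t q)) (nhds (t, q)) (nhds 0) := by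
    have := h1.tendsto
    simpa using this
  refine squeeze_zero (fun _ ↦ dist_nonneg) (fun p ↦ ?_) h3
  exact (dist_triangle _ (Φ p.1 q) _).trans (by gcongr; exact h.dist_le hZ _ _ _)

/-- Any integral curve of `Z` between the times `0` and `t` is given by the global flow. -/
theorem eqOn_uIcc (h : IsGlobalFlow Z Φ) (hZ : LipschitzWith K Z) {c : ℝ → E} {t : ℝ}
    (hc : ∀ s ∈ uIcc 0 t, HasDerivWithinAt c (Z (c s)) (uIcc 0 t) s) :
    EqOn c (fun s ↦ Φ s (c 0)) (uIcc 0 t) := by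
  rcases le_total 0 t with ht | ht
  · rw [uIcc_of_le ht] at hc ⊢
    refine ODE_solution_unique_of_mem_Icc_right (v := fun _ ↦ Z) (s := fun _ ↦ univ) (K := K)
      (fun _ _ ↦ hZ.lipschitzOnWith) (fun s hs ↦ (hc s hs).continuousWithinAt)
      (fun s hs ↦ ?_) (fun _ _ ↦ mem_univ _) (h.continuous_time _).continuousOn
      (fun s _ ↦ (h.hasDerivAt _ s).hasDerivWithinAt) (fun _ _ ↦ mem_univ _) (by simp [h.zero])
    exact (hc s (Ico_subset_Icc_self hs)).mono_of_mem_nhdsWithin (Icc_mem_nhdsGE_of_mem hs)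
  · rw [uIcc_of_ge ht] at hc ⊢
    refine ODE_solution_unique_of_mem_Icc_left (v := fun _ ↦ Z) (s := fun _ ↦ univ) (K := K)
      (fun _ _ ↦ hZ.lipschitzOnWith) (fun s hs ↦ (hc s hs).continuousWithinAt)
      (fun s hs ↦ ?_) (fun _ _ ↦ mem_univ _) (h.continuous_time _).continuousOn
      (fun s _ ↦ (h.hasDerivAt _ s).hasDerivWithinAt) (fun _ _ ↦ mem_univ _) (by simp [h.zero])
    exact (hc s (Ioc_subset_Icc_self hs)).mono_of_mem_nhdsWithin (Icc_mem_nhdsLE_of_mem hs)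

end IsGlobalFlow

end GlobalFlow

/-! ### The area formula for Hausdorff measure -/

section AreaFormula

variable {X : Type*} [TopologicalSpace X] [SecondCountableTopology X] [MeasurableSpace X]
  [OpensMeasurableSpace X]

/-- A measure which is locally, up to any factor larger than one, bounded by another one is bounded
by it. -/
theorem measure_le_of_locally_le_mul {μ ν : Measure X} {s : Set X} 
    (h : ∀ c : NNReal, 1 < c → ∀ x ∈ s, ∃ V : Set X, IsOpen V ∧ x ∈ V ∧
      ∀ A ⊆ V ∩ s, MeasurableSet A → μ A ≤ c * ν A) {A : Set X} (hA : MeasurableSet A)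
    (hAs : A ⊆ s) : μ A ≤ ν A := by
  have key : ∀ c : NNReal, 1 < c → μ A ≤ c * ν A := by
    intro c hc
    choose! V hVo hxV hV using h c hc
    -- By the Lindelöf property countably many of the neighbourhoods suffice; making them disjoint
    -- lets the local bounds be added.
    obtain ⟨T, hTs, hTc, hTU⟩ := TopologicalSpace.countable_cover_nhdsWithin (s := s) (f := V)
      (fun x hx ↦ mem_nhdsWithin_of_mem_nhds ((hVo x hx).mem_nhds (hxV x hx)))
    rcases T.eq_empty_or_nonempty with rfl | hTn
    · have : A = ∅ := by
        have := hAs.trans hTU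
        simpa using this
      simp [this]
    obtain ⟨f, hf⟩ := hTc.exists_eq_range hTn
    have hfs : ∀ k, f k ∈ s := fun k ↦ hTs (hf ▸ mem_range_self k)
    set B : ℕ → Set X := disjointed fun k ↦ V (f k) with hB
    have hBm : ∀ k, MeasurableSet (B k) :=
      fun k ↦ MeasurableSet.disjointed (fun k ↦ (hVo _ (hfs k)).measurableSet) k
    have hAB : A = ⋃ k, A ∩ B k := by
      rw [← inter_iUnion, hB, iUnion_disjointed, eq_comm, inter_eq_left]
      refine hAs.trans (hTU.trans ?_)
      rw [hf]; simp
    have hd : Pairwise (Function.onFun Disjoint fun k ↦ A ∩ B k) := fun i j hij ↦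
      ((disjoint_disjointed fun k ↦ V (f k)) hij).mono inter_subset_right inter_subset_right
    rw [hAB, measure_iUnion hd fun k ↦ hA.inter (hBm k),
      measure_iUnion hd fun k ↦ hA.inter (hBm k), ← ENNReal.tsum_mul_left]
    refine ENNReal.tsum_le_tsum fun k ↦ ?_
    refine hV _ (hfs k) _ (fun x hx ↦ ⟨?_, hAs hx.1⟩) (hA.inter (hBm k))
    exact disjointed_subset (fun k ↦ V (f k)) _ hx.2
  have hlim : Filter.Tendsto (fun c : NNReal ↦ (c : ENNReal) * ν A) (nhdsWithin 1 (Ioi 1))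
      (nhds ((1 : NNReal) * ν A)) := by
    refine ENNReal.Tendsto.mul_const ?_ (Or.inl (by simp))
    exact (ENNReal.continuous_coe.tendsto 1).mono_left nhdsWithin_le_nhds
  have := ge_of_tendsto hlim (Filter.eventually_of_mem self_mem_nhdsWithin key)
  simpa using this

variable {H F : Type*} [NormedAddCommGroup H] [InnerProductSpace ℝ H] [FiniteDimensional ℝ H]
  [MeasurableSpace H] [BorelSpace H] [NormedAddCommGroup F] [InnerProductSpace ℝ F]
  [MeasurableSpace F] [BorelSpace F]

theorem euclideanHausdorffMeasure_image_le {X Y : Type*} [EMetricSpace X] [MeasurableSpace X]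
    [BorelSpace X] [EMetricSpace Y] [MeasurableSpace Y] [BorelSpace Y] {K : NNReal} {f : X → Y}
    {s : Set X} (h : LipschitzOnWith K f s) (d : ℕ) :
    Measure.euclideanHausdorffMeasure d (f '' s)
      ≤ (K : ENNReal) ^ d * Measure.euclideanHausdorffMeasure d s := by
  simp_rw [Measure.euclideanHausdorffMeasure_def, Measure.smul_apply, ENNReal.smul_def,
    smul_eq_mul]
  rw [mul_left_comm]
  gcongr
  simpa using h.hausdorffMeasure_image_le (d := d) (by positivity)

/-- The hypothesis makes `g` a well-defined Lipschitz function of `f` on `s`, even where `f` is not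
injective. It serves to compare a map with its linearization, in both directions. -/
theorem euclideanHausdorffMeasure_image_le_image {X Y : Type*} [EMetricSpace X] [MeasurableSpace X]
    [BorelSpace X] [EMetricSpace Y] [MeasurableSpace Y] [BorelSpace Y] {α : Type*} {K : NNReal}
    {f : α → X} {g : α → Y} {s : Set α}
    (h : ∀ a ∈ s, ∀ b ∈ s, edist (g a) (g b) ≤ K * edist (f a) (f b)) (d : ℕ) :
    Measure.euclideanHausdorffMeasure d (g '' s)
      ≤ (K : ENNReal) ^ d * Measure.euclideanHausdorffMeasure d (f '' s) := by
  rcases s.eq_empty_or_nonempty with rfl | ⟨a₀, ha₀⟩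
  · simp
  have : Nonempty α := ⟨a₀⟩
  have hinv : ∀ x ∈ f '' s, Function.invFunOn f s x ∈ s ∧ f (Function.invFunOn f s x) = x :=
    fun x hx ↦ ⟨Function.invFunOn_mem hx, Function.invFunOn_eq hx⟩
  have himg : g '' s = (fun x ↦ g (Function.invFunOn f s x)) '' (f '' s) := by
    rw [image_image]
    refine image_congr fun a ha ↦ ?_
    obtain ⟨h1, h2⟩ := hinv (f a) (mem_image_of_mem f ha)
    have := h a ha _ h1
    rw [h2, edist_self, mul_zero] at this
    exact edist_le_zero.1 this
  rw [himg]
  refine euclideanHausdorffMeasure_image_le (fun x hx y hy ↦ ?_) d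
  have := h _ (hinv x hx).1 _ (hinv y hy).1
  rwa [(hinv x hx).2, (hinv y hy).2] at this

/-- The area formula for an injective `C¹` map `G` which does not contract distances to first order:
the `d`-dimensional measure of the image is the integral of the norm determinant `J` of the
derivative. -/
theorem euclideanHausdorffMeasure_image_eq_lintegral {G : H → F} {B : Set H} (hB : IsOpen B)
    (hG : ContDiffOn ℝ 1 G B) (hGi : InjOn G B)
    (hGa : ∀ y ∈ B, ∀ v, ‖v‖ ≤ ‖fderiv ℝ G y v‖) {J : H → ℝ} (hJ : ContinuousOn J B)
    (hJ0 : ∀ y ∈ B, 0 < J y)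
    (hJG : ∀ y ∈ B, LinearMap.normDet (fderiv ℝ G y : H →ₗ[ℝ] F) = J y)
    {A : Set H} (hA : MeasurableSet A) (hAB : A ⊆ B) :
    Measure.euclideanHausdorffMeasure (Module.finrank ℝ H) (G '' A) =
      ∫⁻ y in A, ENNReal.ofReal (J y) := by
  set d := Module.finrank ℝ H with hd
  have hemb : MeasurableEmbedding (B.domRestrict G) :=
    hG.continuousOn.measurableEmbedding hB.measurableSet hGi
  -- Hausdorff measure of the image, pulled back to the parameter domain, so that both sides of the
  -- formula are measures on the same space.
  set ν : Measure H := ((Measure.euclideanHausdorffMeasure d : Measure F).comap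
    (B.domRestrict G)).map Subtype.val with hν
  have hνA : ∀ A : Set H, MeasurableSet A → A ⊆ B →
      ν A = Measure.euclideanHausdorffMeasure d (G '' A) := by
    intro A hA hAB
    rw [hν, Measure.map_apply measurable_subtype_coe hA, hemb.comap_apply]
    congr 1
    ext z
    constructor
    · rintro ⟨⟨y, hy⟩, hyA, rfl⟩; exact ⟨y, hyA, rfl⟩
    · rintro ⟨y, hyA, rfl⟩; exact ⟨⟨y, hAB hyA⟩, hyA, rfl⟩
  set κ : Measure H := (volume : Measure H).withDensity fun y ↦ ENNReal.ofReal (J y) with hκ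
  -- Near `y` the map distorts distances relative to its derivative by a factor close to `1`, and
  -- the derivative scales volume exactly by `J y`.
  have local_est : ∀ c : NNReal, 1 < c → ∀ y ∈ B, ∃ V : Set H, IsOpen V ∧ y ∈ V ∧
      ∀ A ⊆ V ∩ B, MeasurableSet A → ν A ≤ c * κ A ∧ κ A ≤ c * ν A := by
    intro c hc y hy
    -- The exponent `d + 1` counts `d` factors from the comparison of distances and one from the
    -- oscillation of `J`.
    obtain ⟨c₁, hc₁, hc₁c⟩ : ∃ c₁ : NNReal, 1 < c₁ ∧ c₁ ^ (d + 1) ≤ c := by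
      have h1 : Filter.Tendsto (fun x : NNReal ↦ x ^ (d + 1)) (nhdsWithin 1 (Ioi 1))
          (nhds 1) := by
        have : Continuous fun x : NNReal ↦ x ^ (d + 1) := by fun_prop
        simpa using (this.tendsto 1).mono_left nhdsWithin_le_nhds
      obtain ⟨x, hx1, hx2⟩ := ((h1.eventually_lt_const hc).and self_mem_nhdsWithin).exists
      exact ⟨x, hx2, hx1.le⟩
    have hc₁' : (1 : ℝ) < c₁ := by exact_mod_cast hc₁
    -- This choice gives `1 - ε = c₁⁻¹` and `1 + ε ≤ c₁`, which serve the two directions of the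
    -- comparison.
    set ε : ℝ := 1 - (c₁ : ℝ)⁻¹ with hε
    have hinv1 : (c₁ : ℝ)⁻¹ < 1 := inv_lt_one_of_one_lt₀ hc₁'
    have hε0 : 0 < ε := by rw [hε]; linarith
    have hcinv : (c₁ : ℝ) * (c₁ : ℝ)⁻¹ = 1 := mul_inv_cancel₀ (by positivity)
    have hstrict := (hG.contDiffAt (hB.mem_nhds hy)).hasStrictFDerivAt (by norm_num)
    obtain ⟨V₁, hV₁, hGV⟩ : ∃ V₁ ∈ nhds y, ∀ a ∈ V₁, ∀ b ∈ V₁,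
        ‖G a - G b - fderiv ℝ G y (a - b)‖ ≤ ε * ‖a - b‖ := by
      have := hstrict.isLittleO.def hε0
      rw [nhds_prod_eq, Filter.eventually_prod_self_iff'] at this
      obtain ⟨V₁, hV₁, h⟩ := this
      exact ⟨V₁, hV₁, fun a ha b hb ↦ h a ha b hb⟩
    have hJy := hJ0 y hy
    have hJc : ContinuousAt J y := hJ.continuousAt (hB.mem_nhds hy)
    have hV₂ : ∀ᶠ z in nhds y, J z < c₁ * J y ∧ J y < c₁ * J z :=
      (hJc.eventually_lt_const (by nlinarith)).and
        ((continuousAt_const.mul hJc).eventually_const_lt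
          (show J y < c₁ * J y by nlinarith))
    obtain ⟨V, hVsub, hVo, hyV⟩ := mem_nhds_iff.1 (Filter.inter_mem hV₁ hV₂)
    refine ⟨V, hVo, hyV, fun A hAV hA ↦ ?_⟩
    have hAB : A ⊆ B := hAV.trans inter_subset_right
    have hAV : A ⊆ V := hAV.trans inter_subset_left
    have hLA : Measure.euclideanHausdorffMeasure d ((fderiv ℝ G y : H →ₗ[ℝ] F) '' A)
        = ENNReal.ofReal (J y) * volume A := by
      rw [hd, LinearMap.euclideanHausdorffMeasure_image_eq_normDet_mul_volume, hJG y hy]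
    have hcmp : ∀ a ∈ A, ∀ b ∈ A, ‖G a - G b‖ ≤ c₁ * ‖fderiv ℝ G y (a - b)‖ ∧
        ‖fderiv ℝ G y (a - b)‖ ≤ c₁ * ‖G a - G b‖ := by
      intro a ha b hb
      have h1 := hGV a (hVsub (hAV ha)).1 b (hVsub (hAV hb)).1
      have h2 := hGa y hy (a - b)
      have h3 : ‖G a - G b‖ ≤ ‖fderiv ℝ G y (a - b)‖ + ε * ‖a - b‖ :=
        (norm_le_norm_add_norm_sub' _ (fderiv ℝ G y (a - b))).trans (by gcongr)
      have h4 : ‖fderiv ℝ G y (a - b)‖ ≤ ‖G a - G b‖ + ε * ‖a - b‖ := by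
        refine (norm_le_norm_add_norm_sub' _ (G a - G b)).trans ?_
        rw [norm_sub_rev (fderiv ℝ G y (a - b))]; gcongr
      have h5 : ε * ‖a - b‖ ≤ ε * ‖fderiv ℝ G y (a - b)‖ := by gcongr
      have h6 := norm_nonneg (fderiv ℝ G y (a - b))
      constructor
      · refine h3.trans ((add_le_add_right h5 _).trans ?_)
        have : 1 + ε ≤ c₁ := by
          rw [hε]; nlinarith [mul_pos (sub_pos.2 hc₁') (sub_pos.2 hinv1)]
        nlinarith
      · have h7 : ‖fderiv ℝ G y (a - b)‖ * (c₁ : ℝ)⁻¹ ≤ ‖G a - G b‖ := by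
          rw [hε] at h5 h4; nlinarith
        calc ‖fderiv ℝ G y (a - b)‖ = c₁ * (‖fderiv ℝ G y (a - b)‖ * (c₁ : ℝ)⁻¹) := by
              rw [mul_left_comm, hcinv, mul_one]
          _ ≤ _ := by gcongr
    have he : ∀ x z w u : F, ‖x - z‖ ≤ c₁ * ‖w - u‖ → edist x z ≤ c₁ * edist w u := by
      intro x z w u h
      rw [edist_dist, edist_dist, dist_eq_norm, dist_eq_norm, ← ENNReal.ofReal_coe_nnreal,
        ← ENNReal.ofReal_mul (NNReal.coe_nonneg c₁)]
      exact ENNReal.ofReal_le_ofReal h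
    have hup : Measure.euclideanHausdorffMeasure d (G '' A) ≤
        (c₁ : ENNReal) ^ d * (ENNReal.ofReal (J y) * volume A) := by
      rw [← hLA]
      refine euclideanHausdorffMeasure_image_le_image (fun a ha b hb ↦ he _ _ _ _ ?_) d
      simpa using (hcmp a ha b hb).1
    have hlo : ENNReal.ofReal (J y) * volume A ≤ (c₁ : ENNReal) ^ d *
        Measure.euclideanHausdorffMeasure d (G '' A) := by
      rw [← hLA]
      refine euclideanHausdorffMeasure_image_le_image (fun a ha b hb ↦ he _ _ _ _ ?_) d
      simpa using (hcmp a ha b hb).2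
    have hκA : κ A = ∫⁻ z in A, ENNReal.ofReal (J z) := withDensity_apply _ hA
    have hκ1 : κ A ≤ c₁ * (ENNReal.ofReal (J y) * volume A) := by
      rw [hκA, ← mul_assoc, ← setLIntegral_const]
      refine setLIntegral_mono measurable_const fun z hz ↦ ?_
      rw [← ENNReal.ofReal_coe_nnreal, ← ENNReal.ofReal_mul (NNReal.coe_nonneg c₁)]
      exact ENNReal.ofReal_le_ofReal (hVsub (hAV hz)).2.1.le
    have hκ2 : ENNReal.ofReal (J y) * volume A ≤ c₁ * κ A := by
      rw [hκA, ← lintegral_const_mul' _ _ ENNReal.coe_ne_top, ← setLIntegral_const]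
      refine setLIntegral_mono_ae' hA (Filter.Eventually.of_forall fun z hz ↦ ?_)
      rw [← ENNReal.ofReal_coe_nnreal, ← ENNReal.ofReal_mul (NNReal.coe_nonneg c₁)]
      exact ENNReal.ofReal_le_ofReal (hVsub (hAV hz)).2.2.le
    have hcc : (c₁ : ENNReal) ^ d * c₁ ≤ c := by
      rw [← pow_succ]; exact_mod_cast hc₁c
    rw [hνA A hA hAB]
    constructor
    · calc _ ≤ (c₁ : ENNReal) ^ d * (ENNReal.ofReal (J y) * volume A) := hup
        _ ≤ (c₁ : ENNReal) ^ d * (c₁ * κ A) := by gcongr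
        _ ≤ c * κ A := by rw [← mul_assoc]; gcongr
    · calc _ ≤ c₁ * (ENNReal.ofReal (J y) * volume A) := hκ1
        _ ≤ c₁ * ((c₁ : ENNReal) ^ d * Measure.euclideanHausdorffMeasure d (G '' A)) := by gcongr
        _ = (c₁ : ENNReal) ^ d * c₁ * Measure.euclideanHausdorffMeasure d (G '' A) := by ring
        _ ≤ _ := by gcongr
  refine (hνA A hA hAB).symm.trans ((le_antisymm ?_ ?_).trans (withDensity_apply _ hA))
  · exact measure_le_of_locally_le_mul (s := B) (fun c hc y hy ↦ by
      obtain ⟨V, h1, h2, h3⟩ := local_est c hc y hy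
      exact ⟨V, h1, h2, fun A hA hAm ↦ (h3 A hA hAm).1⟩) hA hAB
  · exact measure_le_of_locally_le_mul (s := B) (fun c hc y hy ↦ by
      obtain ⟨V, h1, h2, h3⟩ := local_est c hc y hy
      exact ⟨V, h1, h2, fun A hA hAm ↦ (h3 A hA hAm).2⟩) hA hAB

end AreaFormula

/-! ### Defining functions and the outer normal -/

section Normals

open Filter Topology

namespace IsLocalDefiningFunction

variable {Ω : Set (Sp n)} {x : Sp n} {V V' : Set (Sp n)} {ρ ρ' : Sp n → ℝ}

theorem contDiffAt (h : IsLocalDefiningFunction Ω x V ρ) {y : Sp n} (hy : y ∈ V) :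
    ContDiffAt ℝ ∞ ρ y := h.smooth.contDiffAt (h.isOpen.mem_nhds hy)

theorem differentiableAt (h : IsLocalDefiningFunction Ω x V ρ) {y : Sp n} (hy : y ∈ V) :
    DifferentiableAt ℝ ρ y := (h.contDiffAt hy).differentiableAt (by simp)

theorem continuousAt (h : IsLocalDefiningFunction Ω x V ρ) {y : Sp n} (hy : y ∈ V) :
    ContinuousAt ρ y := (h.differentiableAt hy).continuousAt

theorem continuousAt_gradient (h : IsLocalDefiningFunction Ω x V ρ) {y : Sp n} (hy : y ∈ V) :
    ContinuousAt (∇ ρ) y := by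
  have := (h.contDiffAt hy).continuousAt_fderiv (by simp)
  exact ((InnerProductSpace.toDual ℝ (Sp n)).symm.continuous.continuousAt).comp this

theorem hasDerivAt_line (h : IsLocalDefiningFunction Ω x V ρ) {y : Sp n} (hy : y ∈ V) (v : Sp n) :
    HasDerivAt (fun t : ℝ ↦ ρ (y + t • v)) (inner ℝ (∇ ρ y) v) 0 := by
  have h1 := (h.differentiableAt hy).hasFDerivAt.hasLineDerivAt v
  rw [HasLineDerivAt] at h1
  rwa [inner_gradient_left]

theorem eventually_pos (h : IsLocalDefiningFunction Ω x V ρ) {y : Sp n} (hy : y ∈ V)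
    (hρ : ρ y = 0) {v : Sp n} (hv : 0 < inner ℝ (∇ ρ y) v) :
    ∀ᶠ t in 𝓝[>] (0 : ℝ), 0 < ρ (y + t • v) := by
  have := (h.hasDerivAt_line hy v).tendsto_slope_zero_right.eventually_const_lt hv
  filter_upwards [this, self_mem_nhdsWithin] with t ht ht0
  simp only [zero_add, zero_smul, add_zero, hρ, sub_zero, smul_eq_mul] at ht
  exact (pos_iff_pos_of_mul_pos ht).1 (inv_pos.2 ht0)

theorem eventually_neg (h : IsLocalDefiningFunction Ω x V ρ) {y : Sp n} (hy : y ∈ V)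
    (hρ : ρ y = 0) {v : Sp n} (hv : inner ℝ (∇ ρ y) v < 0) :
    ∀ᶠ t in 𝓝[>] (0 : ℝ), ρ (y + t • v) < 0 := by
  have := (h.hasDerivAt_line hy v).tendsto_slope_zero_right.eventually_lt_const hv
  filter_upwards [this, self_mem_nhdsWithin] with t ht ht0
  simp only [zero_add, zero_smul, add_zero, hρ, sub_zero, smul_eq_mul] at ht
  exact (pos_iff_neg_of_mul_neg ht).1 (inv_pos.2 ht0)

theorem eventually_mem (h : IsLocalDefiningFunction Ω x V ρ) {y : Sp n} (hy : y ∈ V) (v : Sp n) :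
    ∀ᶠ t in 𝓝[>] (0 : ℝ), y + t • v ∈ V := by
  have : ContinuousAt (fun t : ℝ ↦ y + t • v) 0 := by fun_prop
  have h2 := this.eventually_mem (h.isOpen.mem_nhds (by simpa using hy))
  exact h2.filter_mono nhdsWithin_le_nhds

/-- If the unit gradients `m` and `m'` differed, then a small step from `x` along `m - m'` would
make `ρ` positive and `ρ'` negative, so the point reached would lie both outside and inside `Ω`.
Hence the normal does not depend on the defining function. -/
theorem normalized_gradient_eq (h : IsLocalDefiningFunction Ω x V ρ)
    (h' : IsLocalDefiningFunction Ω x V' ρ') :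
    ‖∇ ρ x‖⁻¹ • ∇ ρ x = ‖∇ ρ' x‖⁻¹ • ∇ ρ' x := by
  by_contra hne
  set m := ‖∇ ρ x‖⁻¹ • ∇ ρ x with hm
  set m' := ‖∇ ρ' x‖⁻¹ • ∇ ρ' x with hm'
  have hpos : 0 < ‖∇ ρ x‖ := norm_pos_iff.2 h.gradient_ne_zero
  have hpos' : 0 < ‖∇ ρ' x‖ := norm_pos_iff.2 h'.gradient_ne_zero
  have n1 : ‖m‖ = 1 := norm_smul_inv_norm h.gradient_ne_zero
  have n1' : ‖m'‖ = 1 := norm_smul_inv_norm h'.gradient_ne_zero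
  have hlt : inner ℝ m m' < 1 := (inner_lt_one_iff_real_of_norm_eq_one n1 n1').2 hne
  have e1 : ∇ ρ x = ‖∇ ρ x‖ • m := by rw [hm, smul_inv_smul₀ hpos.ne']
  have e2 : ∇ ρ' x = ‖∇ ρ' x‖ • m' := by rw [hm', smul_inv_smul₀ hpos'.ne']
  have a1 : 0 < inner ℝ (∇ ρ x) (m - m') := by
    rw [e1, real_inner_smul_left, inner_sub_right, real_inner_self_eq_norm_sq, n1]
    exact mul_pos hpos (by linarith)
  have a2 : inner ℝ (∇ ρ' x) (m - m') < 0 := by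
    rw [e2, real_inner_smul_left, inner_sub_right, real_inner_self_eq_norm_sq, n1',
      real_inner_comm]
    exact mul_neg_of_pos_of_neg hpos' (by linarith)
  obtain ⟨t, ht⟩ := ((h.eventually_pos h.mem h.eq_zero a1).and
    ((h'.eventually_neg h'.mem h'.eq_zero a2).and
      ((h.eventually_mem h.mem (m - m')).and (h'.eventually_mem h'.mem (m - m'))))).exists
  have : x + t • (m - m') ∈ Ω := (h'.mem_iff _ ht.2.2.2).2 ht.2.1
  exact absurd ((h.mem_iff _ ht.2.2.1).1 this) (not_lt.2 ht.1.le)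

theorem outerNormal_eq (h : IsLocalDefiningFunction Ω x V ρ) :
    outerNormal Ω x = ‖∇ ρ x‖⁻¹ • ∇ ρ x := by
  have hex : ∃ ν, IsOuterUnitNormal Ω x ν := ⟨_, V, ρ, h, rfl⟩
  rw [outerNormal, dif_pos hex]
  obtain ⟨V', ρ', h', hν⟩ := hex.choose_spec
  rw [hν]
  exact h'.normalized_gradient_eq h

theorem mem_frontier (h : IsLocalDefiningFunction Ω x V ρ) : x ∈ frontier Ω := by
  have hx : x ∉ Ω := fun hx ↦ by
    have := (h.mem_iff x h.mem).1 hx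
    rw [h.eq_zero] at this
    exact lt_irrefl _ this
  refine ⟨?_, fun hi ↦ hx (interior_subset hi)⟩
  have hv : inner ℝ (∇ ρ x) (-∇ ρ x) < 0 := by
    rw [inner_neg_right, neg_lt_zero]
    exact real_inner_self_pos.2 h.gradient_ne_zero
  have hc : Tendsto (fun t : ℝ ↦ x + t • (-∇ ρ x)) (𝓝[>] 0) (𝓝 x) := by
    have : Continuous fun t : ℝ ↦ x + t • (-∇ ρ x) := by fun_prop
    simpa using (this.tendsto 0).mono_left (nhdsWithin_le_nhds (s := Ioi 0))
  refine mem_closure_of_tendsto hc ?_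
  filter_upwards [h.eventually_neg h.mem h.eq_zero hv, h.eventually_mem h.mem (-∇ ρ x)]
    with t ht htV
  exact (h.mem_iff _ htV).2 ht

theorem eq_zero_of_mem_frontier (hΩ : IsOpen Ω) (h : IsLocalDefiningFunction Ω x V ρ) {y : Sp n}
    (hy : y ∈ V) (hyf : y ∈ frontier Ω) : ρ y = 0 := by
  refine le_antisymm ?_ ?_
  · by_contra! hlt
    have h1 : ∀ᶠ z in 𝓝 y, 0 < ρ z ∧ z ∈ V :=
      ((h.continuousAt hy).eventually_const_lt hlt).and (h.isOpen.mem_nhds hy)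
    obtain ⟨z, hz, hzΩ⟩ := mem_closure_iff_nhds.1 hyf.1 _ h1
    exact absurd ((h.mem_iff z hz.2).1 hzΩ) (not_lt.2 hz.1.le)
  · by_contra! hlt
    exact hyf.2 (hΩ.interior_eq.symm ▸ (h.mem_iff y hy).2 hlt)

theorem of_eq_zero (h : IsLocalDefiningFunction Ω x V ρ) {y : Sp n} (hy : y ∈ V)
    (h0 : ρ y = 0) (hg : ∇ ρ y ≠ 0) : IsLocalDefiningFunction Ω y V ρ :=
  ⟨h.isOpen, hy, h.smooth, h0, hg, h.mem_iff⟩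

end IsLocalDefiningFunction

end Normals

/-! ### Graph charts of the boundary -/

section Charts

/-- The hyperplane orthogonal to `e`. -/
def Hyp (e : Sp n) : Type := ↥(Submodule.span ℝ {e})ᗮ

instance (e : Sp n) : NormedAddCommGroup (Hyp e) :=
  inferInstanceAs (NormedAddCommGroup ↥(Submodule.span ℝ {e})ᗮ)

instance (e : Sp n) : InnerProductSpace ℝ (Hyp e) :=
  inferInstanceAs (InnerProductSpace ℝ ↥(Submodule.span ℝ {e})ᗮ)

instance (e : Sp n) : FiniteDimensional ℝ (Hyp e) :=
  inferInstanceAs (FiniteDimensional ℝ ↥(Submodule.span ℝ {e})ᗮ)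

instance (e : Sp n) : MeasurableSpace (Hyp e) := borel _

instance (e : Sp n) : BorelSpace (Hyp e) := ⟨rfl⟩

/-- The inclusion of the hyperplane orthogonal to `e`. -/
def Hyp.incl (e : Sp n) : Hyp e →ₗᵢ[ℝ] Sp n := (Submodule.span ℝ {e})ᗮ.subtypeₗᵢ

/-- The point with coordinates `y` and `t` along the hyperplane orthogonal to `e` and along `e`. -/
def pt (e : Sp n) (y : Hyp e) (t : ℝ) : Sp n := Hyp.incl e y + t • e

/-- In the coordinates given by `e`, the set `Ω` is the subgraph of `h` over `B`, within the times
between `a` and `b`. -/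
structure IsGraphChart (Ω : Set (Sp n)) (e : Sp n) (B : Set (Hyp e)) (a b : ℝ)
    (h : Hyp e → ℝ) : Prop where
  norm_eq_one : ‖e‖ = 1
  isOpen : IsOpen B
  contDiffOn : ContDiffOn ℝ 2 h B
  lipschitz : ∃ C, LipschitzOnWith C h B
  mem_Ioo : ∀ y ∈ B, h y ∈ Ioo a b
  mem_iff : ∀ y ∈ B, ∀ t ∈ Ioo a b, (pt e y t ∈ Ω ↔ t < h y)
  normal : ∀ y ∈ B, ∀ w : Hyp e, ∀ t : ℝ,
    √(1 + ‖fderiv ℝ h y‖ ^ 2) * inner ℝ (pt e w t) (outerNormal Ω (pt e y (h y)))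
      = t - fderiv ℝ h y w

/-- The box on which a graph chart describes the set. -/
def box (e : Sp n) (B : Set (Hyp e)) (a b : ℝ) : Set (Sp n) :=
  {x | ∃ y ∈ B, ∃ t ∈ Ioo a b, pt e y t = x}

theorem inner_hyp (e : Sp n) (y : Hyp e) : inner ℝ e (Hyp.incl e y) = 0 :=
  Submodule.mem_orthogonal_singleton_iff_inner_right.1 (Subtype.property y)

theorem inner_pt {e : Sp n} (he : ‖e‖ = 1) (y : Hyp e) (t : ℝ) : inner ℝ e (pt e y t) = t := by
  rw [pt, inner_add_right, inner_hyp, real_inner_smul_right, real_inner_self_eq_norm_sq, he]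
  simp

theorem norm_pt_sq {e : Sp n} (he : ‖e‖ = 1) (y : Hyp e) (t : ℝ) :
    ‖pt e y t‖ ^ 2 = ‖y‖ ^ 2 + t ^ 2 := by
  rw [pt, norm_add_sq_real, real_inner_smul_right, real_inner_comm, inner_hyp, norm_smul, he]
  simp

/-- The coordinates along the hyperplane orthogonal to the unit vector `e` and along `e`. -/
def splitEquiv {e : Sp n} (he : ‖e‖ = 1) : (Hyp e × ℝ) ≃L[ℝ] Sp n :=
  LinearEquiv.toContinuousLinearEquiv
  { toFun := fun p ↦ pt e p.1 p.2
    map_add' := fun p q ↦ by simp [pt, add_smul]; abel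
    map_smul' := fun c p ↦ by simp [pt, smul_smul]
    invFun := fun x ↦ (⟨x - inner ℝ e x • e, by
      rw [Submodule.mem_orthogonal_singleton_iff_inner_right, inner_sub_right,
        real_inner_smul_right, real_inner_self_eq_norm_sq, he]; simp⟩, inner ℝ e x)
    left_inv := fun p ↦ by
      refine Prod.ext ((Hyp.incl e).injective ?_) (inner_pt he _ _)
      change pt e p.1 p.2 - inner ℝ e (pt e p.1 p.2) • e = Hyp.incl e p.1
      rw [inner_pt he, pt, add_sub_cancel_right]
    right_inv := fun x ↦ sub_add_cancel x (inner ℝ e x • e) }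

@[simp] theorem splitEquiv_apply {e : Sp n} (he : ‖e‖ = 1) (p : Hyp e × ℝ) :
    splitEquiv he p = pt e p.1 p.2 := rfl

/-- By Pythagoras the map is a linear isometry for the Euclidean norm on the product, and that norm
induces the product volume. -/
theorem measurePreserving_splitEquiv {e : Sp n} (he : ‖e‖ = 1) :
    MeasurePreserving (splitEquiv he) := by
  let f : WithLp 2 (Hyp e × ℝ) ≃ₗᵢ[ℝ] Sp n :=
    { (WithLp.linearEquiv 2 ℝ (Hyp e × ℝ)).trans (splitEquiv he).toLinearEquiv with
      norm_map' := fun x ↦ by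
        rw [← sq_eq_sq₀ (norm_nonneg _) (norm_nonneg _), WithLp.prod_norm_sq_eq_of_L2]
        refine (norm_pt_sq he _ _).trans ?_
        simp }
  exact f.measurePreserving.comp (WithLp.volume_preserving_toLp _ _)

theorem isOpen_box {e : Sp n} (he : ‖e‖ = 1) {B : Set (Hyp e)} (hB : IsOpen B) (a b : ℝ) :
    IsOpen (box e B a b) := by
  have : box e B a b = splitEquiv he '' (B ×ˢ Ioo a b) := by
    ext x
    constructor
    · rintro ⟨y, hy, t, ht, rfl⟩; exact ⟨(y, t), ⟨hy, ht⟩, rfl⟩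
    · rintro ⟨⟨y, t⟩, ⟨hy, ht⟩, rfl⟩; exact ⟨y, hy, t, ht, rfl⟩
  rw [this]
  exact (splitEquiv he).toHomeomorph.isOpenMap _ (hB.prod isOpen_Ioo)

end Charts

section ChartExistence

open Filter Topology

/-- The implicit function theorem in the direction `e` of the gradient writes `{ρ = 0}` as a graph.
On a box where `∂ρ/∂e > 0` the function `ρ` increases along `e`, so `{ρ < 0}` is the part below the
graph. -/
theorem IsLocalDefiningFunction.exists_isGraphChart {Ω : Set (Sp n)} {x₀ : Sp n} {V : Set (Sp n)}
    {ρ : Sp n → ℝ} (hρ : IsLocalDefiningFunction Ω x₀ V ρ) :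
    ∃ (e : Sp n) (B : Set (Hyp e)) (a b : ℝ) (h : Hyp e → ℝ),
      IsGraphChart Ω e B a b h ∧ x₀ ∈ box e B a b := by
  set e : Sp n := ‖∇ ρ x₀‖⁻¹ • ∇ ρ x₀ with he
  have hpos : 0 < ‖∇ ρ x₀‖ := norm_pos_iff.2 hρ.gradient_ne_zero
  have he1 : ‖e‖ = 1 := norm_smul_inv_norm hρ.gradient_ne_zero
  have hge : 0 < inner ℝ (∇ ρ x₀) e := by
    rw [he, real_inner_smul_right, real_inner_self_eq_norm_sq]; positivity
  set S := splitEquiv he1 with hS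
  set u := S.symm x₀ with hu
  have hSu : S u = x₀ := S.apply_symm_apply x₀
  have hptu : pt e u.1 u.2 = x₀ := hSu
  set f : Hyp e × ℝ → ℝ := fun p ↦ ρ (S p) with hf
  have hfd : ∀ p, S p ∈ V → HasFDerivAt f ((fderiv ℝ ρ (S p)).comp (S : Hyp e × ℝ →L[ℝ] Sp n)) p :=
    fun p hp ↦ (hρ.differentiableAt hp).hasFDerivAt.comp p S.hasFDerivAt
  have cdf : ContDiffAt ℝ 2 f u := by
    have h1 : ContDiffAt ℝ 2 ρ (S u) := by
      rw [hSu]; exact (hρ.contDiffAt hρ.mem).of_le (WithTop.coe_le_coe.2 (le_top : (2 : ℕ∞) ≤ ⊤))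
    exact h1.comp u S.contDiff.contDiffAt
  have hfu : f u = 0 := by rw [hf]; simp only [hSu, hρ.eq_zero]
  have if₂ : (fderiv ℝ f u ∘L .inr ℝ (Hyp e) ℝ).IsInvertible := by
    have hc : ∀ t : ℝ, (fderiv ℝ f u ∘L .inr ℝ (Hyp e) ℝ) t = t * inner ℝ (∇ ρ x₀) e := by
      intro t
      rw [(hfd u (hSu ▸ hρ.mem)).fderiv, hSu]
      simp [hS, pt]
    refine ContinuousLinearMap.IsInvertible.of_inverse
      (g := (ContinuousLinearMap.id ℝ ℝ).smulRight (inner ℝ (∇ ρ x₀) e)⁻¹) ?_ ?_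
    · ext; simp only [ContinuousLinearMap.comp_apply]
      rw [← ContinuousLinearMap.comp_apply, hc]; simp [hge.ne', -inner_gradient_left]
    · ext; simp only [ContinuousLinearMap.comp_apply]
      rw [← ContinuousLinearMap.comp_apply (fderiv ℝ f u), hc]
      simp [hge.ne', -inner_gradient_left]
  set h := cdf.implicitFunction two_ne_zero if₂ with hh
  have hu2 : h u.1 = u.2 := cdf.implicitFunction_apply_self two_ne_zero if₂
  have hcd : ContDiffAt ℝ 2 h u.1 := cdf.contDiffAt_implicitFunction two_ne_zero if₂
  have hev0 : ∀ᶠ y in 𝓝 u.1, f (y, h y) = 0 := by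
    simpa [hfu] using cdf.eventually_apply_implicitFunction two_ne_zero if₂
  obtain ⟨C, s, hs, hlip⟩ := (hcd.of_le one_le_two).exists_lipschitzOnWith
  have hev1 : ∀ᶠ y in 𝓝 u.1, ContDiffAt ℝ 2 h y := hcd.eventually (by simp)
  have hW : ∀ᶠ p in 𝓝 u, S p ∈ V ∧ 0 < inner ℝ (∇ ρ (S p)) e := by
    have c1 : ContinuousAt S u := S.continuous.continuousAt
    have hV : V ∈ 𝓝 (S u) := hSu ▸ hρ.isOpen.mem_nhds hρ.mem
    refine (c1.eventually_mem hV).and ?_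
    have c2 : ContinuousAt (∇ ρ) (S u) := hρ.continuousAt_gradient (hSu ▸ hρ.mem)
    have c3 : ContinuousAt (fun p ↦ inner ℝ (∇ ρ (S p)) e) u :=
      (c2.comp (f := S) c1).inner continuousAt_const
    exact c3.eventually_const_lt (by simpa only [hSu] using hge)
  obtain ⟨r, hr, hrW⟩ := Metric.eventually_nhds_iff_ball.1 hW
  -- The radius `r` fixes the range of heights; the base is then shrunk until `h` takes its values
  -- in that range.
  have hev2 : ∀ᶠ y in 𝓝 u.1, h y ∈ Ioo (u.2 - r) (u.2 + r) :=
    hcd.continuousAt.eventually_mem (by rw [hu2]; exact Ioo_mem_nhds (by linarith) (by linarith))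
  obtain ⟨r', hr', hr'B⟩ := Metric.eventually_nhds_iff_ball.1
    (((hev0.and hev1).and hev2).and (eventually_mem_set.2 hs))
  set B := Metric.ball u.1 (min r r') with hB
  have hBW : ∀ y ∈ B, ∀ t ∈ Ioo (u.2 - r) (u.2 + r),
      pt e y t ∈ V ∧ 0 < inner ℝ (∇ ρ (pt e y t)) e := by
    intro y hy t ht
    refine hrW (y, t) ?_
    rw [← ball_prod_same, mem_prod, Real.ball_eq_Ioo]
    exact ⟨Metric.ball_subset_ball (min_le_left _ _) hy, ht⟩
  have hBr : ∀ y ∈ B, _ := fun y hy ↦ hr'B y (Metric.ball_subset_ball (min_le_right _ _) hy)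
  have h0 : ∀ y ∈ B, ρ (pt e y (h y)) = 0 := fun y hy ↦ (hBr y hy).1.1.1
  have hIoo : ∀ y ∈ B, h y ∈ Ioo (u.2 - r) (u.2 + r) := fun y hy ↦ (hBr y hy).1.2
  have hline : ∀ y ∈ B, ∀ t ∈ Ioo (u.2 - r) (u.2 + r),
      HasDerivAt (fun t ↦ ρ (pt e y t)) (inner ℝ (∇ ρ (pt e y t)) e) t := by
    intro y hy t ht
    have d1 := (hρ.differentiableAt (hBW y hy t ht).1).hasFDerivAt
    have d2 : HasDerivAt (fun t ↦ pt e y t) e t := by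
      simpa [pt] using ((hasDerivAt_id t).smul_const e).const_add (Hyp.incl e y)
    rw [inner_gradient_left]
    exact d1.comp_hasDerivAt t d2
  refine ⟨e, B, u.2 - r, u.2 + r, h, ⟨he1, Metric.isOpen_ball, ?_, ⟨C, ?_⟩, hIoo, ?_, ?_⟩, ?_⟩
  · exact fun y hy ↦ (hBr y hy).1.1.2.contDiffWithinAt
  · exact hlip.mono fun y hy ↦ (hBr y hy).2
  · intro y hy t ht
    have hmono : StrictMonoOn (fun t ↦ ρ (pt e y t)) (Ioo (u.2 - r) (u.2 + r)) := by
      refine strictMonoOn_of_deriv_pos (convex_Ioo _ _)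
        (fun t ht ↦ (hline y hy t ht).continuousAt.continuousWithinAt) fun t ht ↦ ?_
      rw [interior_Ioo] at ht
      rw [(hline y hy t ht).deriv]
      exact (hBW y hy t ht).2
    rw [hρ.mem_iff _ (hBW y hy t ht).1, ← h0 y hy]
    exact hmono.lt_iff_lt ht (hIoo y hy)
  · intro y hy w t
    obtain ⟨hGV, hGe⟩ := hBW y hy _ (hIoo y hy)
    set N := ∇ ρ (pt e y (h y)) with hN
    set c := inner ℝ N e with hc
    have hN0 : N ≠ 0 := fun h0 ↦ by rw [h0, inner_zero_left] at hc; exact hGe.ne' hc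
    have hloc := hρ.of_eq_zero hGV (h0 y hy) hN0
    have hdh : HasFDerivAt h (fderiv ℝ h y) y :=
      ((hBr y hy).1.1.2.differentiableAt two_ne_zero).hasFDerivAt
    -- Differentiating `ρ (y, h y) = 0` shows that `N` is orthogonal to the tangent vectors `(v, Dh
    -- v)`. So `N` is `c` times the vector with coordinates `(-∇h, 1)`, whose length is `√(1 +
    -- |∇h|²)`.
    have htan : ∀ v : Hyp e, inner ℝ N (pt e v (fderiv ℝ h y v)) = 0 := by
      intro v
      have d1 := hfd (y, h y) hGV
      have d2 := d1.comp y ((hasFDerivAt_id y).prodMk hdh)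
      have d3 : HasFDerivAt (fun y ↦ f (y, h y)) (0 : Hyp e →L[ℝ] ℝ) y := by
        refine (hasFDerivAt_const (0 : ℝ) y).congr_of_eventuallyEq ?_
        filter_upwards [Metric.isOpen_ball.mem_nhds hy] with z hz using h0 z hz
      have := congrArg (fun l ↦ l v) (d2.unique d3)
      rw [hN, inner_gradient_left]
      simpa [hS] using this
    have hall : ∀ (v : Hyp e) (t : ℝ), inner ℝ N (pt e v t) = c * (t - fderiv ℝ h y v) := by
      intro v t
      have h1 : pt e v t = pt e v (fderiv ℝ h y v) + (t - fderiv ℝ h y v) • e := by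
        simp only [pt, sub_smul]; abel
      rw [h1, inner_add_right, htan, real_inner_smul_right, zero_add, mul_comm]
    set g := (InnerProductSpace.toDual ℝ (Hyp e)).symm (fderiv ℝ h y) with hg
    have hgn : ‖g‖ = ‖fderiv ℝ h y‖ := LinearIsometryEquiv.norm_map _ _
    have hNeq : N = c • pt e (-g) 1 := by
      refine ext_inner_right ℝ fun x ↦ ?_
      obtain ⟨p, rfl⟩ := S.surjective x
      have h2 : inner ℝ (Hyp.incl e g) (Hyp.incl e p.1) = fderiv ℝ h y p.1 := by
        rw [LinearIsometry.inner_map_map, hg, InnerProductSpace.toDual_symm_apply]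
      have h3 : inner ℝ (Hyp.incl e p.1) e = 0 := by rw [real_inner_comm]; exact inner_hyp e p.1
      have h4 : inner ℝ (Hyp.incl e g) e = 0 := by rw [real_inner_comm]; exact inner_hyp e g
      rw [hS, splitEquiv_apply, hall, real_inner_smul_left]
      simp only [pt, inner_add_left, inner_add_right, real_inner_smul_left, real_inner_smul_right,
        inner_neg_left, map_neg, inner_hyp, real_inner_self_eq_norm_sq, he1, h2, h4]
      ring
    have hNn : ‖N‖ = c * √(1 + ‖fderiv ℝ h y‖ ^ 2) := by
      rw [hNeq, norm_smul, Real.norm_of_nonneg hGe.le]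
      congr 1
      rw [eq_comm, Real.sqrt_eq_iff_mul_self_eq (by positivity) (norm_nonneg _), ← sq,
        norm_pt_sq he1, norm_neg, hgn]
      ring
    have hJ : 0 < √(1 + ‖fderiv ℝ h y‖ ^ 2) := by positivity
    rw [hloc.outerNormal_eq, real_inner_smul_right, real_inner_comm, ← hN, hall, hNn]
    field_simp
  · exact ⟨u.1, Metric.mem_ball_self (lt_min hr hr'), u.2, ⟨by linarith, by linarith⟩, hptu⟩

theorem exists_isGraphChart {Ω : Set (Sp n)} (hΩs : HasSmoothBoundary Ω) {x₀ : Sp n}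
    (hx₀ : x₀ ∈ frontier Ω) :
    ∃ (e : Sp n) (B : Set (Hyp e)) (a b : ℝ) (h : Hyp e → ℝ),
      IsGraphChart Ω e B a b h ∧ x₀ ∈ box e B a b := by
  obtain ⟨V, ρ, hρ⟩ := hΩs x₀ hx₀
  exact hρ.exists_isGraphChart

end ChartExistence

/-! ### Surface measure in a chart -/

section ChartArea

open Filter Topology

theorem measurableSet_inter_preimage {X Y : Type*} [TopologicalSpace X] [MeasurableSpace X]
    [OpensMeasurableSpace X] [TopologicalSpace Y] [MeasurableSpace Y] [BorelSpace Y] {f : X → Y}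
    {B : Set X} (hf : ContinuousOn f B) (hB : MeasurableSet B) {s : Set Y} (hs : MeasurableSet s) :
    MeasurableSet (B ∩ f ⁻¹' s) := by
  have h1 : Measurable (B.domRestrict f) := (continuousOn_iff_continuous_domRestrict.1 hf).measurable
  have h2 := hB.subtype_image (h1 hs)
  convert h2 using 1
  ext x
  simp [and_comm]

theorem finrank_hyp {e : Sp n} (he : ‖e‖ = 1) : Module.finrank ℝ (Hyp e) = n - 1 := by
  have he0 : e ≠ 0 := fun h ↦ by simp [h] at he
  have h1 := (Submodule.span ℝ {e}).finrank_add_finrank_orthogonal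
  rw [finrank_span_singleton he0, finrank_euclideanSpace_fin] at h1
  have h2 : Module.finrank ℝ (Hyp e) = Module.finrank ℝ (Submodule.span ℝ {e})ᗮ := rfl
  omega

/-- The linear map whose graph has slope `l`. -/
def tiltMap {e : Sp n} (he : ‖e‖ = 1) (l : Hyp e →L[ℝ] ℝ) : Hyp e →L[ℝ] Sp n :=
  (splitEquiv he : Hyp e × ℝ →L[ℝ] Sp n).comp ((ContinuousLinearMap.id ℝ (Hyp e)).prod l)

@[simp] theorem tiltMap_apply {e : Sp n} (he : ‖e‖ = 1) (l : Hyp e →L[ℝ] ℝ) (v : Hyp e) :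
    tiltMap he l v = pt e v (l v) := rfl

theorem inner_pt_pt {e : Sp n} (he : ‖e‖ = 1) (y w : Hyp e) (s t : ℝ) :
    inner ℝ (pt e y s) (pt e w t) = inner ℝ y w + s * t := by
  have h3 : inner ℝ (Hyp.incl e y) e = 0 := by rw [real_inner_comm]; exact inner_hyp e y
  simp only [pt, inner_add_left, inner_add_right, real_inner_smul_left, real_inner_smul_right,
    inner_hyp, real_inner_self_eq_norm_sq, he, h3, LinearIsometry.inner_map_map]
  ring

/-- With `g` representing `l`, the Gram map `T*T` is `v ↦ v + l(v) g`, a transvection, and its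
determinant is `1 + l(g) = 1 + ‖l‖²`. -/
theorem normDet_tiltMap {e : Sp n} (he : ‖e‖ = 1) (l : Hyp e →L[ℝ] ℝ) :
    LinearMap.normDet (tiltMap he l : Hyp e →ₗ[ℝ] Sp n) = √(1 + ‖l‖ ^ 2) := by
  set g := (InnerProductSpace.toDual ℝ (Hyp e)).symm l with hg
  have hgn : ‖g‖ = ‖l‖ := LinearIsometryEquiv.norm_map _ _
  have hgl : ∀ w, inner ℝ g w = l w := fun w ↦ InnerProductSpace.toDual_symm_apply
  have h1 := LinearMap.normDet_sq (tiltMap he l : Hyp e →ₗ[ℝ] Sp n)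
  have h2 : LinearMap.adjoint (tiltMap he l : Hyp e →ₗ[ℝ] Sp n) ∘ₗ
      (tiltMap he l : Hyp e →ₗ[ℝ] Sp n) = LinearMap.transvection (l : Hyp e →ₗ[ℝ] ℝ) g := by
    refine LinearMap.ext fun v ↦ ext_inner_right ℝ fun w ↦ ?_
    rw [LinearMap.comp_apply, LinearMap.adjoint_inner_left]
    simp only [ContinuousLinearMap.coe_coe, tiltMap_apply, inner_pt_pt he,
      LinearMap.transvection.apply, inner_add_left, real_inner_smul_left, hgl]
  rw [h2, LinearMap.transvection.det] at h1
  have h3 : l g = ‖l‖ ^ 2 := by rw [← hgl, real_inner_self_eq_norm_sq, hgn]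
  rw [eq_comm, Real.sqrt_eq_iff_mul_self_eq (by positivity) (LinearMap.normDet_nonneg _), ← sq]
  simpa [h3] using h1.symm

namespace IsGraphChart

variable {Ω : Set (Sp n)} {e : Sp n} {B : Set (Hyp e)} {a b : ℝ} {h : Hyp e → ℝ}

theorem differentiableAt (hc : IsGraphChart Ω e B a b h) {y : Hyp e} (hy : y ∈ B) :
    DifferentiableAt ℝ h y :=
  (hc.contDiffOn.contDiffAt (hc.isOpen.mem_nhds hy)).differentiableAt two_ne_zero

theorem continuousOn (hc : IsGraphChart Ω e B a b h) : ContinuousOn h B := hc.contDiffOn.continuousOn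

theorem continuousOn_fderiv (hc : IsGraphChart Ω e B a b h) :
    ContinuousOn (fderiv ℝ h) B :=
  hc.contDiffOn.continuousOn_fderiv_of_isOpen hc.isOpen one_le_two

theorem continuousOn_density (hc : IsGraphChart Ω e B a b h) :
    ContinuousOn (fun y ↦ √(1 + ‖fderiv ℝ h y‖ ^ 2)) B := by
  have h1 : Continuous fun l : Hyp e →L[ℝ] ℝ ↦ √(1 + ‖l‖ ^ 2) := by fun_prop
  exact h1.comp_continuousOn hc.continuousOn_fderiv

theorem hasFDerivAt_graph (hc : IsGraphChart Ω e B a b h) {y : Hyp e} (hy : y ∈ B) :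
    HasFDerivAt (fun y ↦ pt e y (h y)) (tiltMap hc.norm_eq_one (fderiv ℝ h y)) y :=
  (splitEquiv hc.norm_eq_one).hasFDerivAt.comp y
    ((hasFDerivAt_id y).prodMk (hc.differentiableAt hy).hasFDerivAt)

theorem contDiffOn_graph (hc : IsGraphChart Ω e B a b h) :
    ContDiffOn ℝ 2 (fun y ↦ pt e y (h y)) B :=
  (splitEquiv hc.norm_eq_one).contDiff.comp_contDiffOn (contDiffOn_id.prodMk hc.contDiffOn)

theorem injective_graph (he : ‖e‖ = 1) (h : Hyp e → ℝ) :
    Function.Injective fun y ↦ pt e y (h y) := by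
  intro y z hyz
  have := (splitEquiv he).injective (a₁ := (y, h y)) (a₂ := (z, h z)) hyz
  exact congrArg Prod.fst this

theorem graph_mem_box (hc : IsGraphChart Ω e B a b h) {y : Hyp e} (hy : y ∈ B) :
    pt e y (h y) ∈ box e B a b := ⟨y, hy, h y, hc.mem_Ioo y hy, rfl⟩

theorem euclideanHausdorffMeasure_graph (hc : IsGraphChart Ω e B a b h) {A : Set (Hyp e)}
    (hA : MeasurableSet A) (hAB : A ⊆ B) :
    Measure.euclideanHausdorffMeasure (n - 1) ((fun y ↦ pt e y (h y)) '' A) =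
      ∫⁻ y in A, ENNReal.ofReal √(1 + ‖fderiv ℝ h y‖ ^ 2) := by
  have key := euclideanHausdorffMeasure_image_eq_lintegral (G := fun y ↦ pt e y (h y))
    (J := fun y ↦ √(1 + ‖fderiv ℝ h y‖ ^ 2)) hc.isOpen
    (hc.contDiffOn_graph.of_le one_le_two) (injective_graph hc.norm_eq_one h).injOn
    (fun y hy v ↦ ?_) ?_ (fun y _ ↦ by positivity) (fun y hy ↦ ?_) hA hAB
  · rwa [finrank_hyp hc.norm_eq_one] at key
  · rw [(hc.hasFDerivAt_graph hy).fderiv, tiltMap_apply,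
      ← sq_le_sq₀ (norm_nonneg _) (norm_nonneg _), norm_pt_sq hc.norm_eq_one]
    nlinarith [sq_nonneg (fderiv ℝ h y v)]
  · exact hc.continuousOn_density
  · rw [(hc.hasFDerivAt_graph hy).fderiv, normDet_tiltMap]

theorem mem_frontier_iff (hΩ : IsOpen Ω) (hc : IsGraphChart Ω e B a b h) {y : Hyp e} (hy : y ∈ B)
    {t : ℝ} (ht : t ∈ Ioo a b) : pt e y t ∈ frontier Ω ↔ t = h y := by
  have hcont : Continuous fun t ↦ pt e y t := by unfold pt; fun_prop
  constructor
  · intro hf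
    refine le_antisymm ?_ ?_
    · by_contra! hlt
      have hS := (splitEquiv hc.norm_eq_one).symm.continuous
      set u : Hyp e × ℝ := (y, t) with hu
      have h1 : ∀ᶠ p : Hyp e × ℝ in 𝓝 u, p.1 ∈ B ∧ p.2 ∈ Ioo a b ∧ h p.1 < p.2 := by
        refine (continuousAt_fst.eventually_mem (hc.isOpen.mem_nhds hy)).and
          ((continuousAt_snd.eventually_mem (isOpen_Ioo.mem_nhds ht)).and ?_)
        have c1 : ContinuousAt (fun p : Hyp e × ℝ ↦ h p.1) u :=
          ContinuousAt.comp (f := Prod.fst) (hc.continuousOn.continuousAt (hc.isOpen.mem_nhds hy))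
            continuousAt_fst
        exact c1.eventually_lt continuousAt_snd hlt
      have h2 : ∀ᶠ x in 𝓝 (pt e y t), x ∉ Ω := by
        have : Tendsto (splitEquiv hc.norm_eq_one).symm (𝓝 (pt e y t)) (𝓝 u) := by
          have := hS.tendsto (splitEquiv hc.norm_eq_one u)
          rwa [ContinuousLinearEquiv.symm_apply_apply] at this
        filter_upwards [this.eventually h1] with x hx
        obtain ⟨p, rfl⟩ := (splitEquiv hc.norm_eq_one).surjective x
        rw [ContinuousLinearEquiv.symm_apply_apply] at hx
        rw [splitEquiv_apply, hc.mem_iff _ hx.1 _ hx.2.1, not_lt]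
        exact hx.2.2.le
      obtain ⟨x, hx, hxΩ⟩ := mem_closure_iff_nhds.1 hf.1 _ h2
      exact hx hxΩ
    · by_contra! hlt
      exact hf.2 (hΩ.interior_eq.symm ▸ (hc.mem_iff y hy t ht).2 hlt)
  · rintro rfl
    refine ⟨?_, fun hi ↦ lt_irrefl _ ((hc.mem_iff y hy _ ht).1 (interior_subset hi))⟩
    have h1 : Tendsto (fun t ↦ pt e y t) (𝓝[<] (h y)) (𝓝 (pt e y (h y))) :=
      (hcont.tendsto _).mono_left nhdsWithin_le_nhds
    refine mem_closure_of_tendsto h1 ?_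
    filter_upwards [self_mem_nhdsWithin,
      nhdsWithin_le_nhds (isOpen_Ioo.mem_nhds ht)] with t ht1 ht2
    exact (hc.mem_iff y hy t ht2).2 ht1

theorem box_inter_frontier (hΩ : IsOpen Ω) (hc : IsGraphChart Ω e B a b h) :
    box e B a b ∩ frontier Ω = (fun y ↦ pt e y (h y)) '' B := by
  ext x
  constructor
  · rintro ⟨⟨y, hy, t, ht, rfl⟩, hf⟩
    exact ⟨y, hy, by rw [(hc.mem_frontier_iff hΩ hy ht).1 hf]⟩
  · rintro ⟨y, hy, rfl⟩
    exact ⟨hc.graph_mem_box hy, (hc.mem_frontier_iff hΩ hy (hc.mem_Ioo y hy)).2 rfl⟩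

theorem surfaceMeasure_restrict_box (hΩ : IsOpen Ω) (hc : IsGraphChart Ω e B a b h) :
    (surfaceMeasure Ω).restrict (box e B a b) =
      (((volume : Measure (Hyp e)).restrict B).withDensity
        fun y ↦ ENNReal.ofReal √(1 + ‖fderiv ℝ h y‖ ^ 2)).map fun y ↦ pt e y (h y) := by
  have hae : AEMeasurable (fun y ↦ pt e y (h y)) (((volume : Measure (Hyp e)).restrict B).withDensity
        fun y ↦ ENNReal.ofReal √(1 + ‖fderiv ℝ h y‖ ^ 2)) :=
    (hc.contDiffOn_graph.continuousOn.aemeasurable hc.isOpen.measurableSet).mono_ac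
      (withDensity_absolutelyContinuous _ _)
  ext s hs
  have hbox := isOpen_box hc.norm_eq_one hc.isOpen a b
  have hpre : MeasurableSet (B ∩ (fun y ↦ pt e y (h y)) ⁻¹' s) :=
    measurableSet_inter_preimage hc.contDiffOn_graph.continuousOn hc.isOpen.measurableSet hs
  rw [Measure.restrict_apply hs, surfaceMeasure,
    Measure.restrict_apply (hs.inter hbox.measurableSet), inter_assoc, hc.box_inter_frontier hΩ,
    inter_comm s, ← image_inter_preimage, hc.euclideanHausdorffMeasure_graph hpre inter_subset_left,
    Measure.map_apply_of_aemeasurable hae hs, withDensity_apply',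
    Measure.restrict_restrict' hc.isOpen.measurableSet, inter_comm]

end IsGraphChart

end ChartArea

/-! ### Regularity of the normal field -/

section NormalMeasurable

open Filter Topology

theorem continuousOn_outerNormal {Ω : Set (Sp n)} (hΩ : IsOpen Ω) (hΩs : HasSmoothBoundary Ω) :
    ContinuousOn (outerNormal Ω) (frontier Ω) := by
  intro x hx
  obtain ⟨V, ρ, hρ⟩ := hΩs x hx
  have hg := hρ.continuousAt_gradient hρ.mem
  have hev : ∀ᶠ y in 𝓝 x, y ∈ V ∧ ∇ ρ y ≠ 0 :=
    Filter.Eventually.and (hρ.isOpen.mem_nhds hρ.mem) (hg.eventually_ne hρ.gradient_ne_zero)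
  have heq : outerNormal Ω =ᶠ[𝓝[frontier Ω] x] fun y ↦ ‖∇ ρ y‖⁻¹ • ∇ ρ y := by
    filter_upwards [self_mem_nhdsWithin, nhdsWithin_le_nhds hev] with y hyf hy
    exact (hρ.of_eq_zero hy.1 (hρ.eq_zero_of_mem_frontier hΩ hy.1 hyf) hy.2).outerNormal_eq
  refine ContinuousWithinAt.congr_of_eventuallyEq ?_ heq hρ.outerNormal_eq
  exact ((hg.norm.inv₀ (norm_ne_zero_iff.2 hρ.gradient_ne_zero)).smul hg).continuousWithinAt

theorem outerNormal_eq_zero {Ω : Set (Sp n)} {x : Sp n} (hx : x ∉ frontier Ω) :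
    outerNormal Ω x = 0 := by
  rw [outerNormal, dif_neg]
  rintro ⟨ν, V, ρ, hρ, -⟩
  exact hx hρ.mem_frontier

theorem measurable_outerNormal {Ω : Set (Sp n)} (hΩ : IsOpen Ω) (hΩs : HasSmoothBoundary Ω) :
    Measurable (outerNormal Ω) := by
  classical
  have h1 : outerNormal Ω = (frontier Ω).piecewise (outerNormal Ω) 0 := by
    ext1 x
    by_cases hx : x ∈ frontier Ω
    · rw [piecewise_eq_of_mem _ _ _ hx]
    · rw [piecewise_eq_of_notMem _ _ _ hx, outerNormal_eq_zero hx]; rfl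
  rw [h1]
  exact ContinuousOn.measurable_piecewise (continuousOn_outerNormal hΩ hΩs) continuousOn_const
    isClosed_frontier.measurableSet

theorem norm_outerNormal_le (Ω : Set (Sp n)) (x : Sp n) : ‖outerNormal Ω x‖ ≤ 1 := by
  by_cases hx : ∃ ν, IsOuterUnitNormal Ω x ν
  · obtain ⟨_, V, ρ, hρ, -⟩ := hx
    rw [hρ.outerNormal_eq, norm_smul, norm_inv, norm_norm,
      inv_mul_cancel₀ (norm_ne_zero_iff.2 hρ.gradient_ne_zero)]
  · rw [outerNormal, dif_neg hx, norm_zero]; exact zero_le_one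

end NormalMeasurable

/-! ### The divergence theorem for Lipschitz functions -/

section LipschitzDivergence

open Filter Topology

variable {Ω : Set (Sp n)} {C : NNReal} {g : Sp n → ℝ}

/-- The integral of a directional derivative over `Ω` is the limit of integrals involving the
difference of the characteristic functions of a translate of `Ω` and of `Ω`. -/
theorem tendsto_integral_translate_sub (hΩ : IsOpen Ω) (hΩb : Bornology.IsBounded Ω)
    (hg : LipschitzWith C g) (hgc : HasCompactSupport g) (v : Sp n) :
    Tendsto (fun t : ℝ ↦ ∫ x, t⁻¹ * (g x * (Ω.indicator 1 (x - t • v) - Ω.indicator 1 x)))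
      (𝓝[>] 0) (𝓝 (∫ x in Ω, lineDeriv ℝ g x v)) := by
  have hi : Integrable (Ω.indicator (1 : Sp n → ℝ)) :=
    (integrable_indicator_iff hΩ.measurableSet).2
      (integrableOn_const (hΩb.measure_lt_top.ne))
  have h1 := hg.integral_inv_smul_sub_mul_tendsto_integral_lineDeriv_mul (μ := volume) hi v
  have h2 : ∫ x, lineDeriv ℝ g x v * Ω.indicator 1 x = ∫ x in Ω, lineDeriv ℝ g x v := by
    rw [← integral_indicator hΩ.measurableSet]
    congr 1; ext x
    by_cases hx : x ∈ Ω <;> simp [hx]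
  rw [h2] at h1
  refine h1.congr fun t ↦ ?_
  obtain ⟨M, hM⟩ := hgc.exists_bound_of_continuous hg.continuous
  have hgi : ∀ w : Sp n, Integrable fun x ↦ g (x + w) * Ω.indicator 1 x := fun w ↦
    hi.bdd_mul (c := M) ((hg.continuous.comp (continuous_add_const w)).aestronglyMeasurable)
      (Eventually.of_forall fun x ↦ hM _)
  have e1 : ∫ x, g (x + t • v) * Ω.indicator 1 x = ∫ x, g x * Ω.indicator 1 (x - t • v) := by
    rw [← integral_add_right_eq_self (fun x ↦ g x * Ω.indicator (1 : Sp n → ℝ) (x - t • v)) (t • v)]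
    simp
  have e2 : Integrable fun x ↦ g x * Ω.indicator 1 (x - t • v) := by
    have := (hgi (t • v)).comp_sub_right (t • v)
    simpa using this
  have e3 : Integrable fun x ↦ g x * Ω.indicator 1 x := by simpa using hgi 0
  simp only [smul_eq_mul, mul_assoc, integral_const_mul]
  congr 1
  simp only [sub_mul, mul_sub]
  rw [integral_sub (hgi _) e3, integral_sub e2 e3, e1]

theorem mem_iff_mem_of_isPreconnected {X : Type*} [TopologicalSpace X] {Ω s : Set X}
    (hΩ : IsOpen Ω) (hs : IsPreconnected s) (hd : Disjoint s (frontier Ω)) {x y : X} (hx : x ∈ s)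
    (hy : y ∈ s) : x ∈ Ω ↔ y ∈ Ω := by
  have hsub : s ⊆ Ω ∪ (closure Ω)ᶜ := fun z hz ↦ by
    by_cases hzΩ : z ∈ Ω
    · exact Or.inl hzΩ
    · refine Or.inr fun hzc ↦ disjoint_left.1 hd hz ?_
      rw [hΩ.frontier_eq]; exact ⟨hzc, hzΩ⟩
  have hdis : Disjoint Ω (closure Ω)ᶜ := disjoint_left.2 fun z hz h ↦ h (subset_closure hz)
  have key : ∀ a ∈ s, ∀ b ∈ s, a ∈ Ω → b ∈ Ω := fun a ha b hb haΩ ↦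
    hs.subset_left_of_subset_union hΩ isClosed_closure.isOpen_compl hdis hsub ⟨a, ha, haΩ⟩ hb
  exact ⟨key x hx y hy, key y hy x hx⟩

/-- A Lipschitz function whose support does not meet `∂Ω` has derivatives of zero mean on `Ω`. -/
theorem integral_lineDeriv_eq_zero (hΩ : IsOpen Ω) (hΩb : Bornology.IsBounded Ω)
    (hg : LipschitzWith C g) (hgc : HasCompactSupport g) (hgf : Disjoint (tsupport g) (frontier Ω))
    (v : Sp n) : ∫ x in Ω, lineDeriv ℝ g x v = 0 := by
  have h1 := tendsto_integral_translate_sub hΩ hΩb hg hgc v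
  refine tendsto_nhds_unique h1 ?_
  -- A ball of radius `δ` about a point of the support misses `∂Ω`, so a shorter translation cannot
  -- change membership in `Ω`, and the integrand vanishes identically.
  obtain ⟨δ, hδ, hδK⟩ := hgf.exists_thickenings hgc isClosed_frontier
  refine tendsto_const_nhds.congr' ?_
  have hev : ∀ᶠ t : ℝ in 𝓝[>] 0, ‖t • v‖ < δ := by
    have : Continuous fun t : ℝ ↦ ‖t • v‖ := by fun_prop
    have := (this.tendsto 0).eventually_lt_const (u := δ) (by simpa using hδ)
    exact nhdsWithin_le_nhds this
  filter_upwards [hev] with t ht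
  rw [eq_comm]
  refine integral_eq_zero_of_ae (Eventually.of_forall fun x ↦ ?_)
  by_cases hx : x ∈ tsupport g
  · have hball : Disjoint (Metric.ball x δ) (frontier Ω) :=
      hδK.mono (Metric.ball_subset_thickening hx δ) (Metric.self_subset_thickening hδ _)
    have hiff : x - t • v ∈ Ω ↔ x ∈ Ω := by
      have hx1 : x ∈ Metric.ball x δ := Metric.mem_ball_self hδ
      have hx2 : x - t • v ∈ Metric.ball x δ := by simpa [dist_eq_norm] using ht
      have hpre := (convex_ball x δ).isPreconnected
      exact mem_iff_mem_of_isPreconnected hΩ hpre hball hx2 hx1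
    by_cases h : x ∈ Ω
    · simp [h, hiff.2 h]
    · simp [h, mt hiff.1 h]
  · simp [image_eq_zero_of_notMem_tsupport hx]

/-- The orientation of the interval integral absorbs the two cases `h ≤ k` and `k ≤ h`. This
measures the layer between the graph and its translate along one vertical line. -/
theorem integral_mul_indicator_sub {G : ℝ → ℝ} (hG : Integrable G) (h k : ℝ) :
    ∫ s, G s * ((Iio k).indicator 1 s - (Iio h).indicator 1 s) = ∫ s in h..k, G s := by
  rw [← intervalIntegral.integral_Iic_sub_Iic hG.integrableOn hG.integrableOn,
    integral_Iic_eq_integral_Iio, integral_Iic_eq_integral_Iio,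
    ← integral_indicator measurableSet_Iio, ← integral_indicator measurableSet_Iio,
    ← integral_sub (hG.indicator measurableSet_Iio) (hG.indicator measurableSet_Iio)]
  congr 1; ext s
  by_cases h1 : s < k <;> by_cases h2 : s < h <;> simp [h1, h2]

end LipschitzDivergence

theorem exists_lipschitzWith_mul {X : Type*} [PseudoMetricSpace X] {f g : X → ℝ} {Cf Cg : NNReal}
    (hf : LipschitzWith Cf f) (hg : LipschitzWith Cg g) {Mf Mg : ℝ} (hMf : ∀ x, ‖f x‖ ≤ Mf)
    (hMg : ∀ x, ‖g x‖ ≤ Mg) : ∃ C, LipschitzWith C fun x ↦ f x * g x := by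
  refine ⟨Real.toNNReal (Mf * Cg + Mg * Cf), LipschitzWith.of_dist_le' fun x y ↦ ?_⟩
  have h1 := hf.dist_le_mul x y
  have h2 := hg.dist_le_mul x y
  rw [Real.dist_eq] at h1 h2 ⊢
  rw [show f x * g x - f y * g y = f x * (g x - g y) + g y * (f x - f y) by ring]
  have h3 : |f x| * |g x - g y| ≤ Mf * (Cg * dist x y) :=
    mul_le_mul (hMf x) h2 (abs_nonneg _) ((norm_nonneg _).trans (hMf x))
  have h4 : |g y| * |f x - f y| ≤ Mg * (Cf * dist x y) :=
    mul_le_mul (hMg y) h1 (abs_nonneg _) ((norm_nonneg _).trans (hMg y))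
  refine (abs_add_le _ _).trans ?_
  rw [abs_mul, abs_mul]
  linarith

open scoped Manifold Topology in
/-- A smooth cutoff function, equal to `1` near a compact set. -/
theorem exists_cutoff {E : Type*} [NormedAddCommGroup E] [NormedSpace ℝ E]
    [FiniteDimensional ℝ E] {K U : Set E} (hK : IsCompact K) (hU : IsOpen U) (hKU : K ⊆ U) :
    ∃ ζ : E → ℝ, ContDiff ℝ ∞ ζ ∧ HasCompactSupport ζ ∧ (∀ x, ζ x ∈ Icc 0 1) ∧
      (∀ᶠ x in 𝓝ˢ K, ζ x = 1) ∧ tsupport ζ ⊆ U := by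
  obtain ⟨L, hL, hKL, hLU⟩ := exists_compact_between hK hU hKU
  obtain ⟨ζ, h1, h0, h01⟩ := exists_contMDiffMap_one_nhds_of_subset_interior (n := ⊤) 𝓘(ℝ, E)
    hK.isClosed hKL
  have hsub : tsupport ζ ⊆ L := closure_minimal (fun x hx ↦ by_contra fun h ↦ hx (h0 x h))
    hL.isClosed
  exact ⟨ζ, ζ.contMDiff.contDiff, hL.of_isClosed_subset (isClosed_tsupport _) hsub, h01, h1,
    hsub.trans hLU⟩

section LipschitzDivergence

open Filter Topology

variable {Ω : Set (Sp n)} {C : NNReal} {g : Sp n → ℝ} {e : Sp n} {B : Set (Hyp e)} {a b : ℝ}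
  {h : Hyp e → ℝ}

namespace IsGraphChart

theorem integral_surfaceMeasure_eq (hΩ : IsOpen Ω) (hc : IsGraphChart Ω e B a b h)
    {F : Sp n → ℝ} (hF : Measurable F) (hF0 : ∀ x ∉ box e B a b, F x = 0) :
    ∫ x, F x ∂surfaceMeasure Ω =
      ∫ y in B, √(1 + ‖fderiv ℝ h y‖ ^ 2) * F (pt e y (h y)) := by
  rw [← setIntegral_eq_integral_of_forall_compl_eq_zero hF0, hc.surfaceMeasure_restrict_box hΩ,
    integral_map _ hF.aestronglyMeasurable]
  · rw [integral_withDensity_eq_integral_toReal_smul₀ _ (Eventually.of_forall fun _ ↦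
      ENNReal.ofReal_lt_top)]
    · simp only [ENNReal.toReal_ofReal (Real.sqrt_nonneg _), smul_eq_mul]
    · exact (hc.continuousOn_density.aemeasurable hc.isOpen.measurableSet).ennreal_ofReal
  · exact (hc.contDiffOn_graph.continuousOn.aemeasurable hc.isOpen.measurableSet).mono_ac
      (withDensity_absolutelyContinuous _ _)

/-- The divergence theorem in a graph chart. -/
theorem integral_lineDeriv_eq_of_subset (hΩ : IsOpen Ω) (hΩb : Bornology.IsBounded Ω)
    (hΩs : HasSmoothBoundary Ω) (hc : IsGraphChart Ω e B a b h)
    (hg : LipschitzWith C g) (hgc : HasCompactSupport g) (hgB : tsupport g ⊆ box e B a b)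
    (v : Sp n) :
    ∫ x in Ω, lineDeriv ℝ g x v = ∫ x, g x * inner ℝ v (outerNormal Ω x) ∂surfaceMeasure Ω := by
  have he := hc.norm_eq_one
  obtain ⟨⟨w, c⟩, rfl⟩ := (splitEquiv he).surjective v
  simp only [splitEquiv_apply]
  set v := pt e w c with hv
  have hpt_sub : ∀ (y : Hyp e) (s t : ℝ), pt e y s - t • v = pt e (y - t • w) (s - t * c) := by
    intro y s t
    have := map_sub (splitEquiv he) (y, s) (t • (w, c))
    rw [map_smul] at this
    exact this.symm
  have hptc : Continuous fun p : Hyp e × ℝ ↦ pt e p.1 p.2 := (splitEquiv he).continuous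
  obtain ⟨M, hM⟩ := hgc.exists_bound_of_continuous hg.continuous
  have hM0 : 0 ≤ M := (norm_nonneg _).trans (hM 0)
  obtain ⟨L, hL⟩ := hc.lipschitz
  -- the projection of the support
  set Q : Set (Hyp e) := (fun x ↦ ((splitEquiv he).symm x).1) '' tsupport g with hQ
  have hQc : IsCompact Q := hgc.isCompact.image (continuous_fst.comp (splitEquiv he).symm.continuous)
  have hmemQ : ∀ y s, pt e y s ∈ tsupport g → y ∈ Q := fun y s hys ↦
    ⟨_, hys, congrArg Prod.fst ((splitEquiv he).symm_apply_apply (y, s))⟩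
  have hmemB : ∀ y s, pt e y s ∈ tsupport g → y ∈ B ∧ s ∈ Ioo a b := by
    intro y s hys
    obtain ⟨y', hy', s', hs', heq⟩ := hgB hys
    have := (splitEquiv he).injective (a₁ := (y', s')) (a₂ := (y, s)) heq
    obtain ⟨rfl, rfl⟩ := Prod.ext_iff.1 this
    exact ⟨hy', hs'⟩
  have hQB : Q ⊆ B := by
    rintro _ ⟨x, hx, rfl⟩
    refine (hmemB _ ((splitEquiv he).symm x).2 ?_).1
    rw [← splitEquiv_apply he]
    exact ((splitEquiv he).apply_symm_apply x).symm ▸ hx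
  have hzero : ∀ y ∉ Q, ∀ s, g (pt e y s) = 0 := fun y hy s ↦
    image_eq_zero_of_notMem_tsupport fun hs ↦ hy (hmemQ y s hs)
  have hGc : ∀ y, Continuous fun s ↦ g (pt e y s) := fun y ↦
    hg.continuous.comp (hptc.comp (Continuous.prodMk_right y))
  have hGi : ∀ y, Integrable fun s ↦ g (pt e y s) := fun y ↦ by
    refine (hGc y).integrable_of_hasCompactSupport ?_
    refine HasCompactSupport.intro (K := Icc a b) isCompact_Icc fun s hs ↦ ?_
    exact image_eq_zero_of_notMem_tsupport fun hs' ↦ hs (Ioo_subset_Icc_self (hmemB y s hs').2)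
  -- small translations
  obtain ⟨δ, hδ, hδK⟩ := hgc.isCompact.exists_thickening_subset_open
    (isOpen_box he hc.isOpen a b) hgB
  have hev : ∀ᶠ t : ℝ in 𝓝[>] 0, ‖t • v‖ < δ := by
    have : Continuous fun t : ℝ ↦ ‖t • v‖ := by fun_prop
    have := (this.tendsto 0).eventually_lt_const (u := δ) (by simpa using hδ)
    exact nhdsWithin_le_nhds this
  have hsmall : ∀ t : ℝ, ‖t • v‖ < δ → ∀ y s, pt e y s ∈ tsupport g →
      y - t • w ∈ B ∧ s - t * c ∈ Ioo a b := by
    intro t ht y s hys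
    have : pt e y s - t • v ∈ box e B a b := hδK (Metric.mem_thickening_iff.2
      ⟨_, hys, by simpa [dist_eq_norm] using ht⟩)
    rw [hpt_sub] at this
    obtain ⟨y', hy', s', hs', heq⟩ := this
    have := (splitEquiv he).injective (a₁ := (y', s')) (a₂ := (_, _)) heq
    obtain ⟨rfl, rfl⟩ := Prod.ext_iff.1 this
    exact ⟨hy', hs'⟩
  -- The integral over the vertical line above `y`; integrating over `y` gives back the whole
  -- integral by Fubini's theorem.
  let F : ℝ → Hyp e → ℝ := fun t y ↦
    ∫ s, t⁻¹ * (g (pt e y s) * (Ω.indicator 1 (pt e y s - t • v) - Ω.indicator 1 (pt e y s)))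
  -- For small `t` both the point and its translate lie in the box. The two indicators then say `s <
  -- h (y - t w) + t c` and `s < h y`.
  have hFeq : ∀ t : ℝ, ‖t • v‖ < δ → ∀ y,
      F t y = t⁻¹ * ∫ s in h y..h (y - t • w) + t * c, g (pt e y s) := by
    intro t ht y
    simp only [F]
    rw [integral_const_mul, ← integral_mul_indicator_sub (hGi y)]
    congr 2; ext s
    by_cases hs : pt e y s ∈ tsupport g
    · congr 1
      have h1 := hmemB y s hs
      have h2 := hsmall t ht y s hs
      congr 1
      · rw [hpt_sub]
        refine indicator_eq_indicator ?_ rfl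
        rw [hc.mem_iff _ h2.1 _ h2.2, mem_Iio, sub_lt_iff_lt_add]
      · exact indicator_eq_indicator (hc.mem_iff _ h1.1 _ h1.2) rfl
    · simp [image_eq_zero_of_notMem_tsupport hs]
  have hint : ∀ t : ℝ, Integrable fun x ↦
      t⁻¹ * (g x * (Ω.indicator 1 (x - t • v) - Ω.indicator 1 x)) := by
    intro t
    have hi : Integrable (Ω.indicator (1 : Sp n → ℝ)) :=
      (integrable_indicator_iff hΩ.measurableSet).2 (integrableOn_const (hΩb.measure_lt_top.ne))
    exact (((hi.comp_sub_right (t • v)).sub hi).bdd_mul (c := M) hg.continuous.aestronglyMeasurable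
      (Eventually.of_forall hM)).const_mul _
  have hint' : ∀ t : ℝ, Integrable fun p : Hyp e × ℝ ↦ t⁻¹ * (g (pt e p.1 p.2) *
      (Ω.indicator 1 (pt e p.1 p.2 - t • v) - Ω.indicator 1 (pt e p.1 p.2))) := fun t ↦
    ((measurePreserving_splitEquiv he).integrable_comp_emb
      (splitEquiv he).toHomeomorph.measurableEmbedding).2 (hint t)
  have h1 := tendsto_integral_translate_sub hΩ hΩb hg hgc v
  have h2 : ∀ t : ℝ, ∫ x, t⁻¹ * (g x * (Ω.indicator 1 (x - t • v) - Ω.indicator 1 x)) =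
      ∫ y, F t y := by
    intro t
    rw [← (measurePreserving_splitEquiv he).integral_comp
      (splitEquiv he).toHomeomorph.measurableEmbedding]
    exact integral_prod _ (hint' t)
  simp only [h2] at h1
  -- The integral over a line is a difference quotient at `t = 0` of an integral with moving upper
  -- limit, whose velocity is `c - Dh(y) w`. The Lipschitz bound on `h` dominates it on the compact
  -- base `Q`.
  have hlim : Tendsto (fun t ↦ ∫ y, F t y) (𝓝[>] 0)
      (𝓝 (∫ y, (c - fderiv ℝ h y w) * g (pt e y (h y)))) := by
    refine tendsto_integral_filter_of_dominated_convergence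
      (Q.indicator fun _ ↦ (L * ‖w‖ + |c|) * M)
      (Eventually.of_forall fun t ↦ (hint' t).integral_prod_left.aestronglyMeasurable) ?_ ?_ ?_
    · filter_upwards [hev, self_mem_nhdsWithin] with t ht ht0
      have ht0 : 0 < t := ht0
      refine Eventually.of_forall fun y ↦ ?_
      rw [hFeq t ht]
      by_cases hy : y ∈ Q
      · rw [indicator_of_mem hy, norm_mul, norm_inv, Real.norm_of_nonneg ht0.le,
          inv_mul_le_iff₀ ht0]
        refine (intervalIntegral.norm_integral_le_of_norm_le_const (C := M)
          fun s _ ↦ hM _).trans ?_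
        obtain ⟨x, hx, hxy⟩ := hy
        have hxy' : pt e y ((splitEquiv he).symm x).2 ∈ tsupport g := by
          rw [← hxy, ← splitEquiv_apply he]
          exact ((splitEquiv he).apply_symm_apply x).symm ▸ hx
        have h3 := hL.dist_le_mul _ (hsmall t ht _ _ hxy').1 _ (hmemB _ _ hxy').1
        rw [Real.dist_eq, dist_eq_norm, sub_sub_cancel_left, norm_neg, norm_smul,
          Real.norm_of_nonneg ht0.le] at h3
        have h4 : |h (y - t • w) + t * c - h y| ≤ t * (L * ‖w‖ + |c|) := by
          rw [show h (y - t • w) + t * c - h y = (h (y - t • w) - h y) + t * c by ring]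
          refine (abs_add_le _ _).trans ?_
          rw [abs_mul, abs_of_pos ht0]
          linarith
        calc M * |h (y - t • w) + t * c - h y| ≤ M * (t * (L * ‖w‖ + |c|)) := by gcongr
          _ = _ := by ring
      · simp [hzero y hy, indicator_of_notMem hy]
    · exact (integrable_indicator_iff hQc.measurableSet).2
        (integrableOn_const hQc.measure_lt_top.ne)
    · refine Eventually.of_forall fun y ↦ ?_
      by_cases hy : y ∈ Q
      · have hyB := hQB hy
        have hk : HasDerivAt (fun t : ℝ ↦ h (y - t • w) + t * c) (c - fderiv ℝ h y w) 0 := by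
          have hd : HasDerivAt (fun t : ℝ ↦ y - t • w) (-w) 0 := by
            simpa using ((hasDerivAt_id (0 : ℝ)).smul_const w).const_sub y
          have hf : HasFDerivAt h (fderiv ℝ h y) (y - (0 : ℝ) • w) := by
            simpa using (hc.differentiableAt hyB).hasFDerivAt
          have := (hf.comp_hasDerivAt (0 : ℝ) hd).add ((hasDerivAt_id (0 : ℝ)).mul_const c)
          refine this.congr_deriv ?_
          rw [show fderiv ℝ h y (-w) = -fderiv ℝ h y w from map_neg _ _]; ring
        have hI : HasDerivAt (fun k ↦ ∫ s in h y..k, g (pt e y s)) (g (pt e y (h y)))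
            (h (y - (0 : ℝ) • w) + 0 * c) := by
          have := intervalIntegral.integral_hasDerivAt_right (f := fun s ↦ g (pt e y s))
            ((hGc y).intervalIntegrable (h y) (h y))
            ((hGc y).stronglyMeasurableAtFilter _ _) (hGc y).continuousAt
          simpa using this
        have := (HasDerivAt.comp (0 : ℝ) hI hk).tendsto_slope_zero_right
        rw [mul_comm]
        refine this.congr' ?_
        filter_upwards [hev] with t ht
        rw [hFeq t ht]
        simp
      · rw [hzero y hy, mul_zero]
        refine tendsto_const_nhds.congr' ?_
        filter_upwards [hev] with t ht
        rw [hFeq t ht]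
        simp [hzero y hy]
  rw [tendsto_nhds_unique h1 hlim, hc.integral_surfaceMeasure_eq hΩ]
  · rw [← setIntegral_eq_integral_of_forall_compl_eq_zero (s := B)]
    -- The factor `c - Dh(y) w` is the area density times `⟨v, n⟩`, which is what the description of
    -- the normal in the chart provides.
    · refine setIntegral_congr_fun hc.isOpen.measurableSet fun y hy ↦ ?_
      rw [← hc.normal y hy w c]; ring
    · intro y hy
      rw [hzero y fun h ↦ hy (hQB h), mul_zero]
  · exact hg.continuous.measurable.mul
      (measurable_const.inner (measurable_outerNormal hΩ hΩs))
  · intro x hx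
    rw [image_eq_zero_of_notMem_tsupport fun h ↦ hx (hgB h), zero_mul]

/-- The divergence theorem for Lipschitz functions whose support meets `∂Ω` inside one chart. -/
theorem integral_lineDeriv_eq (hΩ : IsOpen Ω) (hΩb : Bornology.IsBounded Ω)
    (hΩs : HasSmoothBoundary Ω) (hc : IsGraphChart Ω e B a b h)
    (hg : LipschitzWith C g) (hgc : HasCompactSupport g)
    (hgB : tsupport g ∩ frontier Ω ⊆ box e B a b) (v : Sp n) :
    ∫ x in Ω, lineDeriv ℝ g x v = ∫ x, g x * inner ℝ v (outerNormal Ω x) ∂surfaceMeasure Ω := by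
  -- Split `g = ζ g + (1 - ζ) g` with `ζ = 1` near the part of the support on `∂Ω`. The first term
  -- is supported in the box; the support of the second misses `∂Ω`, so its derivative integrates to
  -- zero.
  obtain ⟨ζ, hζs, hζc, hζ01, hζ1, hζB⟩ := exists_cutoff (hgc.isCompact.inter_right isClosed_frontier)
    (isOpen_box hc.norm_eq_one hc.isOpen a b) hgB
  obtain ⟨Cζ, hζL⟩ := hζs.lipschitzWith_of_hasCompactSupport hζc (by simp)
  obtain ⟨Mg, hMg⟩ := hgc.exists_bound_of_continuous hg.continuous
  obtain ⟨C1, hL1⟩ := exists_lipschitzWith_mul hζL hg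
    (fun x ↦ (Real.norm_of_nonneg (hζ01 x).1).trans_le (hζ01 x).2) hMg
  have hL2 : LipschitzWith (C + C1) fun x ↦ g x - ζ x * g x := hg.sub hL1
  have hc1 : HasCompactSupport fun x ↦ ζ x * g x := hgc.mul_left
  have hc2 : HasCompactSupport fun x ↦ g x - ζ x * g x := hgc.sub hc1
  have e1 := hc.integral_lineDeriv_eq_of_subset hΩ hΩb hΩs hL1 hc1
    ((tsupport_mul_subset_left).trans hζB) v
  have hd : Disjoint (tsupport fun x ↦ g x - ζ x * g x) (frontier Ω) := by
    refine disjoint_left.2 fun x hx hxf ↦ ?_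
    have hxg : x ∈ tsupport g := by
      refine closure_mono (fun y hy ↦ ?_) hx
      contrapose! hy
      simp only [Function.mem_support, not_not] at hy ⊢
      rw [hy, mul_zero, sub_zero]
    have h1 := (eventually_nhdsSet_iff_forall.1 hζ1) x ⟨hxg, hxf⟩
    refine (notMem_tsupport_iff_eventuallyEq.2 ?_) hx
    filter_upwards [h1] with y hy
    simp [hy]
  have e2 := integral_lineDeriv_eq_zero hΩ hΩb hL2 hc2 hd v
  have e3 : ∀ x ∈ frontier Ω, ζ x * g x = g x := by
    intro x hxf
    by_cases hxg : x ∈ tsupport g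
    · rw [(eventually_nhdsSet_iff_forall.1 hζ1 x ⟨hxg, hxf⟩).self_of_nhds, one_mul]
    · rw [image_eq_zero_of_notMem_tsupport hxg, mul_zero]
  have hI : ∀ {C'} {g' : Sp n → ℝ}, LipschitzWith C' g' → IntegrableOn (fun x ↦ lineDeriv ℝ g' x v) Ω := by
    intro C' g' hg'
    refine Measure.integrableOn_of_bounded (M := C' * ‖v‖) hΩb.measure_lt_top.ne
      (measurable_lineDeriv hg'.continuous).aestronglyMeasurable
      (Eventually.of_forall fun x ↦ norm_lineDeriv_le_of_lipschitz ℝ hg')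
  have e4 : ∫ x in Ω, lineDeriv ℝ g x v = (∫ x in Ω, lineDeriv ℝ (fun x ↦ ζ x * g x) x v) +
      ∫ x in Ω, lineDeriv ℝ (fun x ↦ g x - ζ x * g x) x v := by
    rw [← integral_add (hI hL1) (hI hL2)]
    refine integral_congr_ae (ae_restrict_of_ae ?_)
    filter_upwards [hL1.ae_lineDifferentiableAt v, hL2.ae_lineDifferentiableAt v] with x h1 h2
    have h3 : HasLineDerivAt ℝ g (lineDeriv ℝ (fun x ↦ ζ x * g x) x v +
        lineDeriv ℝ (fun x ↦ g x - ζ x * g x) x v) x v := by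
      refine HasDerivAt.congr_of_eventuallyEq (h1.hasLineDerivAt.add h2.hasLineDerivAt) ?_
      exact Eventually.of_forall fun t ↦ by simp
    exact h3.lineDeriv
  rw [e4, e1, e2, add_zero]
  refine setIntegral_congr_fun isClosed_frontier.measurableSet fun x hx ↦ ?_
  rw [e3 x hx]

end IsGraphChart

end LipschitzDivergence

/-! ### The generator is divergence free -/

section DivergenceFree

open Filter Topology

theorem integrable_of_compact {X : Type*} [TopologicalSpace X] [MeasurableSpace X]
    [OpensMeasurableSpace X] [R1Space X]
    {μ : Measure X} [IsFiniteMeasureOnCompacts μ] {F : X → ℝ} (hF : AEStronglyMeasurable F μ)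
    {K : Set X} (hK : IsCompact K) (hKc : IsClosed K) {M : ℝ} (hM : ∀ x ∈ K, ‖F x‖ ≤ M)
    (h0 : ∀ x ∉ K, F x = 0) :
    Integrable F μ := by
  have : IntegrableOn F K μ := Measure.integrableOn_of_bounded hK.measure_lt_top.ne hF
    ((ae_restrict_iff' hKc.measurableSet).2 (Eventually.of_forall hM))
  exact (integrableOn_iff_integrable_of_support_subset fun x hx ↦ by_contra fun h ↦ hx (h0 x h)).1 this

theorem measurable_fderiv_apply {E : Type*} [NormedAddCommGroup E] [NormedSpace ℝ E]
    [FiniteDimensional ℝ E] [MeasurableSpace E] [BorelSpace E] (u : E → ℝ) {W : E → E}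
    (hW : Measurable W) : Measurable fun q ↦ fderiv ℝ u q (W q) := by
  have h1 : Continuous fun p : (E →L[ℝ] ℝ) × E ↦ p.1 p.2 := isBoundedBilinearMap_apply.continuous
  have : SecondCountableTopology (E →L[ℝ] ℝ) := inferInstance
  exact h1.measurable.comp ((measurable_fderiv ℝ u).prodMk hW)

theorem norm_fderiv_apply_le {E : Type*} [NormedAddCommGroup E] [NormedSpace ℝ E] {u : E → ℝ}
    {C : NNReal} (hu : LipschitzWith C u) (q w : E) : ‖fderiv ℝ u q w‖ ≤ C * ‖w‖ :=
  (ContinuousLinearMap.le_opNorm _ _).trans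
    (mul_le_mul_of_nonneg_right (norm_fderiv_le_of_lipschitz ℝ hu) (norm_nonneg _))

theorem fderiv_apply_eq_zero {E : Type*} [NormedAddCommGroup E] [NormedSpace ℝ E] {u : E → ℝ}
    {q : E} (hq : q ∉ tsupport u) (w : E) : fderiv ℝ u q w = 0 := by
  have : fderiv ℝ u q = 0 := by
    by_contra h
    exact hq (support_fderiv_subset ℝ h)
  simp [this]

theorem integrable_fderiv_apply {E : Type*} [NormedAddCommGroup E] [NormedSpace ℝ E]
    [FiniteDimensional ℝ E] [MeasurableSpace E] [BorelSpace E] {μ : Measure E}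
    [IsFiniteMeasureOnCompacts μ] {u : E → ℝ} {C : NNReal} (hu : LipschitzWith C u)
    (huc : HasCompactSupport u) {W : E → E} (hW : Continuous W) :
    Integrable (fun q ↦ fderiv ℝ u q (W q)) μ := by
  obtain ⟨M, hM⟩ := huc.isCompact.exists_bound_of_continuousOn hW.continuousOn
  refine integrable_of_compact (measurable_fderiv_apply u hW.measurable).aestronglyMeasurable
    huc.isCompact (isClosed_tsupport u) (M := C * M) (fun q hq ↦ ?_)
    fun q hq ↦ fderiv_apply_eq_zero hq _
  exact (norm_fderiv_apply_le hu _ _).trans (mul_le_mul_of_nonneg_left (hM q hq) C.2)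

theorem lipschitzWith_coord (i : Fin n) : LipschitzWith 1 fun θ : Sp n ↦ θ i :=
  LipschitzWith.of_dist_le_mul fun θ θ' ↦ by
    simpa [Real.dist_eq, dist_eq_norm] using PiLp.norm_apply_le (θ - θ') i

/-- A field `b + Aθ` with `A` skew-symmetric is divergence free. -/
theorem integral_fderiv_skew_eq_zero {w : Sp n → ℝ} {C : NNReal} (hw : LipschitzWith C w)
    (hwc : HasCompactSupport w) (b : Sp n) {A : Matrix (Fin n) (Fin n) ℝ} (hA : A.transpose = -A) :
    ∫ θ, fderiv ℝ w θ (b + Matrix.toEuclideanLin A θ) = 0 := by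
  have hAi : ∀ i, A i i = 0 := fun i ↦ by
    have := congrFun (congrFun hA i) i
    simp only [Matrix.transpose_apply, Matrix.neg_apply] at this
    linarith
  set L : Sp n →L[ℝ] Sp n := LinearMap.toContinuousLinearMap (Matrix.toEuclideanLin A)
  let W : Sp n → Sp n := fun θ ↦ b + L θ
  have hWc : Continuous W := by fun_prop
  let ε : Fin n → Sp n := fun i ↦ EuclideanSpace.single i 1
  have hsum : ∀ θ, fderiv ℝ w θ (W θ) = ∑ i, fderiv ℝ w θ ((W θ) i • ε i) := by
    intro θ
    rw [← map_sum]
    congr 1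
    have := (EuclideanSpace.basisFun (Fin n) ℝ).sum_repr (W θ)
    simpa [ε] using this.symm
  change ∫ θ, fderiv ℝ w θ (W θ) = 0
  simp only [hsum]
  rw [integral_finsetSum]
  · refine Finset.sum_eq_zero fun i _ ↦ ?_
    have hf : ∃ K, LipschitzWith K fun θ ↦ W θ i :=
      ⟨_, (lipschitzWith_coord i).comp ((LipschitzWith.const b).add L.lipschitz)⟩
    obtain ⟨K, hf⟩ := hf
    have h1 := hf.integral_lineDeriv_mul_eq (μ := volume) hw hwc (ε i)
    -- The zero diagonal makes the `i`-th component of `b + Aθ` independent of `θ i`, so integration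
    -- by parts in that coordinate leaves nothing.
    have h2 : ∀ θ, lineDeriv ℝ (fun θ ↦ W θ i) θ (ε i) = 0 := by
      intro θ
      have : ∀ t : ℝ, W (θ + t • ε i) i = W θ i := by
        intro t
        simp [W, ε, L, Matrix.toLpLin_apply, Matrix.mulVec_add, Matrix.mulVec_smul, hAi]
      simp [lineDeriv, this]
    simp only [h2, zero_mul, integral_zero] at h1
    rw [← neg_eq_zero, h1, ← integral_neg]
    refine integral_congr_ae ?_
    filter_upwards [hw.ae_differentiableAt] with θ hθ
    rw [hθ.lineDeriv_eq_fderiv, map_neg, map_smul, smul_eq_mul]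
    ring
  · intro i _
    exact integrable_fderiv_apply hw hwc (W := fun θ ↦ W θ i • ε i)
      (((lipschitzWith_coord i).continuous.comp hWc).smul continuous_const)

variable {Ω : Set (Sp n)} {C : NNReal} {e : Sp n} {B : Set (Hyp e)} {a b : ℝ}
  {h : Hyp e → ℝ} {φ : Sp n → ℝ} {Y : Sp n → Matrix (Fin n) (Fin n) ℝ}

/-- Split the generator into `(θ, 0)` and `(0, F)`. For fixed `θ` the first part is a constant
direction in `x` and yields the boundary term by the divergence theorem. For fixed `x` the second
part is divergence free in `θ` and contributes zero. Rademacher's theorem turns the total derivative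
of `u` into partial derivatives almost everywhere. -/
theorem integral_fderiv_vectorField (hΩ : IsOpen Ω) (hΩb : Bornology.IsBounded Ω)
    (hΩs : HasSmoothBoundary Ω) (hc : IsGraphChart Ω e B a b h) [SFinite (surfaceMeasure Ω)]
    (hF : Continuous fun q : Sp n × Sp n ↦ force φ Y q.1 q.2)
    (hY : ∀ x ∈ Ω, (Y x).transpose = - Y x)
    {u : Sp n × Sp n → ℝ} (hu : LipschitzWith C u) (huc : HasCompactSupport u)
    (huB : ∀ q ∈ tsupport u, q.1 ∈ frontier Ω → q.1 ∈ box e B a b) :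
    ∫ q in Ω ×ˢ univ, fderiv ℝ u q (vectorField φ Y q) =
      ∫ θ, ∫ x, u (x, θ) * inner ℝ θ (outerNormal Ω x) ∂surfaceMeasure Ω := by
  have hW1 : Continuous fun q : Sp n × Sp n ↦ ((q.2, 0) : Sp n × Sp n) := by fun_prop
  have hW2 : Continuous fun q : Sp n × Sp n ↦ ((0, force φ Y q.1 q.2) : Sp n × Sp n) := by fun_prop
  have hi1 := integrable_fderiv_apply (μ := volume) hu huc hW1
  have hi2 := integrable_fderiv_apply (μ := volume) hu huc hW2
  have hsplit : ∀ q : Sp n × Sp n, fderiv ℝ u q (vectorField φ Y q) =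
      fderiv ℝ u q (q.2, 0) + fderiv ℝ u q (0, force φ Y q.1 q.2) := fun q ↦ by
    rw [← map_add]; simp [vectorField]
  simp only [hsplit]
  rw [integral_add hi1.integrableOn hi2.integrableOn]
  have hcs1 : ∀ θ, HasCompactSupport fun x ↦ u (x, θ) := fun θ ↦
    HasCompactSupport.intro (huc.isCompact.image continuous_fst) fun x hx ↦
      image_eq_zero_of_notMem_tsupport fun h' ↦ hx ⟨_, h', rfl⟩
  have hcs2 : ∀ x, HasCompactSupport fun θ ↦ u (x, θ) := fun x ↦
    HasCompactSupport.intro (huc.isCompact.image continuous_snd) fun θ hx ↦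
      image_eq_zero_of_notMem_tsupport fun h' ↦ hx ⟨_, h', rfl⟩
  have hl1 : ∀ θ, LipschitzWith (C * 1) fun x ↦ u (x, θ) := fun θ ↦
    hu.comp (LipschitzWith.prodMk_right θ)
  have hl2 : ∀ x, LipschitzWith (C * 1) fun θ ↦ u (x, θ) := fun x ↦
    hu.comp (LipschitzWith.prodMk_left x)
  have hvol : (volume : Measure (Sp n × Sp n)).restrict (Ω ×ˢ univ) =
      ((volume : Measure (Sp n)).restrict Ω).prod volume := by
    rw [Measure.volume_eq_prod, ← Measure.prod_restrict, Measure.restrict_univ]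
  have hvolp : (volume : Measure (Sp n × Sp n)).IsAddHaarMeasure := by
    rw [Measure.volume_eq_prod]; infer_instance
  have hdiff : ∀ᵐ q : Sp n × Sp n, DifferentiableAt ℝ u q := hu.ae_differentiableAt
  have hA : ∫ q in Ω ×ˢ univ, fderiv ℝ u q (q.2, 0) =
      ∫ θ, ∫ x, u (x, θ) * inner ℝ θ (outerNormal Ω x) ∂surfaceMeasure Ω := by
    have hi := hi1.integrableOn (s := Ω ×ˢ univ)
    rw [IntegrableOn, hvol] at hi
    rw [hvol, integral_prod_symm _ hi]
    have hd' : ∀ᵐ θ : Sp n, ∀ᵐ x : Sp n, DifferentiableAt ℝ u (x, θ) := by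
      rw [Measure.volume_eq_prod] at hdiff
      exact Measure.ae_ae_of_ae_prod (Measure.measurePreserving_swap.quasiMeasurePreserving.ae hdiff)
    refine integral_congr_ae ?_
    filter_upwards [hd'] with θ hθ
    have hB : tsupport (fun x ↦ u (x, θ)) ∩ frontier Ω ⊆ box e B a b := by
      rintro x ⟨hx, hxf⟩
      refine huB (x, θ) ?_ hxf
      have := tsupport_comp_subset_preimage u (f := fun x ↦ (x, θ)) (by fun_prop)
      exact this hx
    rw [← hc.integral_lineDeriv_eq hΩ hΩb hΩs (hl1 θ) (hcs1 θ) hB θ]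
    refine integral_congr_ae (ae_restrict_of_ae ?_)
    filter_upwards [hθ] with x hx
    have h1 : HasFDerivAt (fun x ↦ u (x, θ)) _ x :=
      HasFDerivAt.comp (g := u) (f := fun x ↦ (x, θ)) x hx.hasFDerivAt ((hasFDerivAt_id x).prodMk (hasFDerivAt_const θ x))
    rw [h1.hasLineDerivAt θ |>.lineDeriv]
    simp
  have hB : ∫ q in Ω ×ˢ univ, fderiv ℝ u q (0, force φ Y q.1 q.2) = 0 := by
    have hi := hi2.integrableOn (s := Ω ×ˢ univ)
    rw [IntegrableOn, hvol] at hi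
    rw [hvol, integral_prod _ hi]
    have hd' : ∀ᵐ x : Sp n, ∀ᵐ θ : Sp n, DifferentiableAt ℝ u (x, θ) := by
      rw [Measure.volume_eq_prod] at hdiff
      exact Measure.ae_ae_of_ae_prod hdiff
    refine integral_eq_zero_of_ae ?_
    filter_upwards [ae_restrict_of_ae hd', ae_restrict_mem hΩ.measurableSet] with x hx hxΩ
    rw [Pi.zero_apply, ← integral_fderiv_skew_eq_zero (hl2 x) (hcs2 x) (-∇ φ x) (hY x hxΩ)]
    refine integral_congr_ae ?_
    filter_upwards [hx] with θ hθ
    have h1 : HasFDerivAt (fun θ ↦ u (x, θ)) _ θ :=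
      HasFDerivAt.comp (g := u) (f := fun θ ↦ (x, θ)) θ hθ.hasFDerivAt ((hasFDerivAt_const x θ).prodMk (hasFDerivAt_id θ))
    rw [h1.fderiv]
    simp [force]
  rw [hA, hB, add_zero]

end DivergenceFree

/-! ### Finiteness of the surface measure -/

section SurfaceFinite

open Filter Topology

variable {Ω : Set (Sp n)} {e : Sp n} {B : Set (Hyp e)} {a b : ℝ} {h : Hyp e → ℝ}

theorem pt_mem_box_iff (he : ‖e‖ = 1) {y : Hyp e} {t : ℝ} :
    pt e y t ∈ box e B a b ↔ y ∈ B ∧ t ∈ Ioo a b := by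
  refine ⟨?_, fun ⟨hy, ht⟩ ↦ ⟨y, hy, t, ht, rfl⟩⟩
  rintro ⟨y', hy', t', ht', heq⟩
  obtain ⟨rfl, rfl⟩ := Prod.ext_iff.1 ((splitEquiv he).injective (a₁ := (y', t')) (a₂ := (y, t)) heq)
  exact ⟨hy', ht'⟩

theorem IsGraphChart.finiteAt (hΩ : IsOpen Ω) (hc : IsGraphChart Ω e B a b h) {x : Sp n}
    (hx : x ∈ box e B a b) : (surfaceMeasure Ω).FiniteAtFilter (𝓝 x) := by
  have he := hc.norm_eq_one
  obtain ⟨y₀, hy₀, t₀, ht₀, rfl⟩ := hx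
  have hd := (hc.continuousOn_density.continuousAt (hc.isOpen.mem_nhds hy₀)).eventually_lt_const
    (lt_add_one _)
  obtain ⟨N, hN, hNo, hyN⟩ := eventually_nhds_iff.1 ((hd.and (hc.isOpen.mem_nhds hy₀)).and
    (Metric.ball_mem_nhds y₀ one_pos))
  have hNB : N ⊆ B := fun y hy ↦ (hN y hy).1.2
  have hbN := isOpen_box he hNo a b
  refine ⟨box e N a b, hbN.mem_nhds ⟨y₀, hyN, t₀, ht₀, rfl⟩, ?_⟩
  have hsub : box e N a b ⊆ box e B a b := by
    rintro _ ⟨y, hy, t, ht, rfl⟩; exact ⟨y, hNB hy, t, ht, rfl⟩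
  rw [← inter_eq_self_of_subset_left hsub, ← Measure.restrict_apply hbN.measurableSet,
    hc.surfaceMeasure_restrict_box hΩ, Measure.map_apply_of_aemeasurable _ hbN.measurableSet]
  · have hpre : (fun y ↦ pt e y (h y)) ⁻¹' box e N a b ⊆ N := fun y hy ↦
      ((pt_mem_box_iff he).1 hy).1
    refine (measure_mono hpre).trans_lt ?_
    rw [withDensity_apply _ hNo.measurableSet, Measure.restrict_restrict hNo.measurableSet,
      inter_eq_self_of_subset_left hNB]
    refine (setLIntegral_mono' hNo.measurableSet (fun y hy ↦
      ENNReal.ofReal_le_ofReal (hN y hy).1.1.le)).trans_lt ?_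
    rw [setLIntegral_const]
    refine ENNReal.mul_lt_top ENNReal.ofReal_lt_top ?_
    exact (measure_mono fun y hy ↦ (hN y hy).2).trans_lt Metric.isBounded_ball.measure_lt_top
  · exact (hc.contDiffOn_graph.continuousOn.aemeasurable hc.isOpen.measurableSet).mono_ac
      (withDensity_absolutelyContinuous _ _)

theorem isFiniteMeasure_surfaceMeasure (hΩ : IsOpen Ω) (hΩb : Bornology.IsBounded Ω)
    (hΩs : HasSmoothBoundary Ω) : IsFiniteMeasure (surfaceMeasure Ω) := by
  have hK : IsCompact (frontier Ω) :=
    Metric.isCompact_of_isClosed_isBounded isClosed_frontier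
      (hΩb.closure.subset frontier_subset_closure)
  have h1 : surfaceMeasure Ω (frontier Ω) < ⊤ := by
    refine hK.measure_lt_top_of_nhdsWithin fun x hx ↦ ?_
    obtain ⟨e, B, a, b, h, hc, hxb⟩ := exists_isGraphChart hΩs hx
    exact (hc.finiteAt hΩ hxb).filter_mono nhdsWithin_le_nhds
  refine ⟨?_⟩
  rw [surfaceMeasure, Measure.restrict_apply MeasurableSet.univ, univ_inter] at *
  rwa [Measure.restrict_apply isClosed_frontier.measurableSet, inter_self] at h1

end SurfaceFinite

/-! ### From thin energy layers to the energy shell -/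

section ThinShell

open Filter Topology

theorem integral_polar {F : Sp n → ℝ} (hn : 1 ≤ n) (hF : Integrable F) :
    ∫ θ, F θ = ∫ v : Metric.sphere (0 : Sp n) 1, (∫ r in Ioi (0 : ℝ), r ^ (n - 1) * F (r • (v : Sp n)))
      ∂((volume : Measure (Sp n)).toSphere) := by
  have : Nonempty (Fin n) := ⟨⟨0, hn⟩⟩
  have : Nontrivial (Sp n) := inferInstance
  have hmp := (volume : Measure (Sp n)).measurePreserving_homeomorphUnitSphereProd
  have hme := (homeomorphUnitSphereProd (Sp n)).measurableEmbedding
  have hfin : Module.finrank ℝ (Sp n) - 1 = n - 1 := by simp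
  rw [hfin] at hmp
  let F' : Metric.sphere (0 : Sp n) 1 × Ioi (0 : ℝ) → ℝ := fun p ↦ F ((p.2 : ℝ) • (p.1 : Sp n))
  have hcomp : ∀ θ : ({0}ᶜ : Set (Sp n)), F' (homeomorphUnitSphereProd (Sp n) θ) = F θ := by
    intro θ
    have hθ : ‖(θ : Sp n)‖ ≠ 0 := norm_ne_zero_iff.2 θ.2
    simp [F', smul_smul, hθ]
  have hm0 : MeasurableSet ({0}ᶜ : Set (Sp n)) := (measurableSet_singleton _).compl
  have hF'i : Integrable F' (((volume : Measure (Sp n)).toSphere).prod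
      (Measure.volumeIoiPow (n - 1))) := by
    rw [← hmp.integrable_comp_emb hme]
    have : F' ∘ (homeomorphUnitSphereProd (Sp n)) = F ∘ Subtype.val := funext hcomp
    rw [this, ← integrableOn_iff_comap_subtypeVal hm0]
    exact hF.integrableOn
  calc ∫ θ, F θ = ∫ θ in ({0}ᶜ : Set (Sp n)), F θ := by rw [restrict_compl_singleton]
    _ = ∫ θ : ({0}ᶜ : Set (Sp n)), F θ ∂((volume : Measure (Sp n)).comap Subtype.val) :=
      (integral_subtype_comap hm0 F).symm
    _ = ∫ p, F' p ∂(((volume : Measure (Sp n)).toSphere).prod (Measure.volumeIoiPow (n - 1))) := by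
      rw [← hmp.integral_comp hme]
      simp only [hcomp]
    _ = _ := by
      rw [integral_prod _ hF'i]
      refine integral_congr_ae (Eventually.of_forall fun v ↦ ?_)
      simp only [Measure.volumeIoiPow, ENNReal.ofReal, F']
      rw [integral_withDensity_eq_integral_smul,
        integral_subtype_comap measurableSet_Ioi fun a ↦
          Real.toNNReal (a ^ (n - 1)) • F (a • (v : Sp n)),
        setIntegral_congr_fun measurableSet_Ioi fun x hx ↦ ?_]
      · rw [NNReal.smul_def, Real.coe_toNNReal _ (pow_nonneg hx.out.le _), smul_eq_mul]
      · exact (measurable_subtype_coe.pow_const _).real_toNNReal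

/-- Substitute `s = (r² - p²) / (2ε)`: then `r dr = ε ds`, which cancels `ε⁻¹` and one power of `r`,
and leaves the exponent `n - 2`. -/
theorem integral_thin_radial {k G : ℝ → ℝ} (hn : 2 ≤ n) (hk : Continuous k)
    (hk0 : ∀ s ∉ Ioo (0 : ℝ) 1, k s = 0) (hG : Continuous G) {p ε : ℝ} (hp : 0 < p) (hε : 0 < ε) :
    ∫ r in Ioi (0 : ℝ), r ^ (n - 1) * (G r * (ε⁻¹ * k ((r ^ 2 - p ^ 2) / (2 * ε)))) =
      ∫ s in (0 : ℝ)..1, k s * √(p ^ 2 + 2 * ε * s) ^ (n - 2) * G √(p ^ 2 + 2 * ε * s) := by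
  have hpos : ∀ s ∈ uIcc (0 : ℝ) 1, 0 < p ^ 2 + 2 * ε * s := by
    intro s hs
    rw [uIcc_of_le zero_le_one] at hs
    have : 0 ≤ 2 * ε * s := mul_nonneg (by positivity) hs.1
    positivity
  let r : ℝ → ℝ := fun s ↦ √(p ^ 2 + 2 * ε * s)
  have hr : ∀ s ∈ uIcc (0 : ℝ) 1, HasDerivAt r (ε / r s) s := by
    intro s hs
    have h1 : HasDerivAt (fun s ↦ p ^ 2 + 2 * ε * s) (2 * ε * 1) s :=
      ((hasDerivAt_id s).const_mul (2 * ε)).const_add _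
    refine (h1.sqrt (hpos s hs).ne').congr_deriv ?_
    have := Real.sqrt_pos.2 (hpos s hs)
    simp only [r]
    field_simp
  have hrc : Continuous r := by fun_prop
  have hr0 : ∀ s ∈ uIcc (0 : ℝ) 1, r s ≠ 0 := fun s hs ↦ (Real.sqrt_pos.2 (hpos s hs)).ne'
  have h1 := intervalIntegral.integral_comp_mul_deriv hr
    (continuousOn_const.div hrc.continuousOn hr0)
    (g := fun r ↦ r ^ (n - 1) * (G r * (ε⁻¹ * k ((r ^ 2 - p ^ 2) / (2 * ε))))) (by fun_prop)
  have hrz : r 0 = p := by simp [r, Real.sqrt_sq hp.le]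
  have hle : p ≤ r 1 := by
    rw [← hrz]; exact Real.sqrt_le_sqrt (by nlinarith)
  have h2 : ∫ r in Ioi (0 : ℝ), r ^ (n - 1) * (G r * (ε⁻¹ * k ((r ^ 2 - p ^ 2) / (2 * ε)))) =
      ∫ r in p..r 1, r ^ (n - 1) * (G r * (ε⁻¹ * k ((r ^ 2 - p ^ 2) / (2 * ε)))) := by
    rw [intervalIntegral.integral_of_le hle]
    refine setIntegral_eq_of_subset_of_forall_sdiff_eq_zero measurableSet_Ioi
      (fun x hx ↦ hp.trans hx.1) fun x hx ↦ ?_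
    rw [hk0, mul_zero, mul_zero, mul_zero]
    rintro ⟨h3, h4⟩
    have hx0 : 0 < x := hx.1
    rw [lt_div_iff₀ (by positivity), zero_mul, sub_pos] at h3
    rw [div_lt_one (by positivity)] at h4
    refine hx.2 ⟨lt_of_pow_lt_pow_left₀ 2 hx0.le h3, ?_⟩
    exact Real.le_sqrt_of_sq_le (by linarith)
  rw [hrz] at h1
  rw [h2, ← h1]
  refine intervalIntegral.integral_congr fun s hs ↦ ?_
  have hrs := hr0 s hs
  have hsq : r s ^ 2 = p ^ 2 + 2 * ε * s := Real.sq_sqrt (hpos s hs).le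
  simp only [Function.comp_apply]
  rw [hsq, add_sub_cancel_left, mul_div_cancel_left₀ _ (by positivity)]
  change r s ^ (n - 1) * _ * _ = k s * r s ^ (n - 2) * G (r s)
  obtain ⟨m, rfl⟩ : ∃ m, n = m + 2 := ⟨n - 2, by omega⟩
  rw [show m + 2 - 1 = m + 1 by omega, show m + 2 - 2 = m by omega, pow_succ]
  field_simp

variable {φ : Sp n → ℝ} {τ : ℝ} {m : Measure (Sp n)}

/-- The thin energy layers `{τ < H < τ + ε}` converge to the energy shell. -/
theorem tendsto_integral_thin_shell [IsFiniteMeasure m] (hn : 2 ≤ n) (hφ : Continuous φ)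
    (hP0 : ∀ x, 0 < P φ τ x) {A : ℝ} (hPA : ∀ x, P φ τ x ≤ A) {k : ℝ → ℝ} (hk : Continuous k)
    (hk0 : ∀ s ∉ Ioo (0 : ℝ) 1, k s = 0) (hk1 : ∫ s, k s = 1)
    {g : Sp n × Sp n → ℝ} (hg : Measurable g) (hgc : ∀ x, Continuous fun θ ↦ g (x, θ))
    {M : ℝ} (hM : ∀ q, ‖g q‖ ≤ M) :
    Tendsto (fun ε : ℝ ↦ ∫ q, g q * (ε⁻¹ * k ((energy φ q - τ) / ε)) ∂(m.prod volume)) (𝓝[>] 0)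
      (𝓝 (∫ q, g q / speed φ τ q.1 ∂bundleMeasure φ τ m)) := by
  have hp : ∀ x, 0 < speed φ τ x := fun x ↦ Real.sqrt_pos.2 (hP0 x)
  have hpsq : ∀ x, speed φ τ x ^ 2 = P φ τ x := fun x ↦ Real.sq_sqrt (hP0 x).le
  have hPc : Continuous (P φ τ) := by unfold P; fun_prop
  have hpc : Continuous (speed φ τ) := hPc.sqrt
  have hkcs : HasCompactSupport k := HasCompactSupport.intro (K := Icc 0 1) isCompact_Icc
    fun s hs ↦ hk0 s fun h ↦ hs (Ioo_subset_Icc_self h)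
  obtain ⟨Mk, hMk⟩ := hkcs.exists_bound_of_continuous hk
  have hMk0 : 0 ≤ Mk := (norm_nonneg _).trans (hMk 0)
  have hM0 : 0 ≤ M := (norm_nonneg _).trans (hM 0)
  set σ : Measure (Metric.sphere (0 : Sp n) 1) := (volume : Measure (Sp n)).toSphere with hσ
  let I : Measure ℝ := volume.restrict (Ioc 0 1)
  let r : ℝ → Sp n → ℝ → ℝ := fun ε x s ↦ √(P φ τ x + 2 * ε * s)
  -- The integrand after polar coordinates and the radial substitution. Unlike the original one it
  -- is regular at `ε = 0`, so dominated convergence applies.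
  let F : ℝ → (Sp n × Metric.sphere (0 : Sp n) 1) × ℝ → ℝ := fun ε z ↦
    k z.2 * r ε z.1.1 z.2 ^ (n - 2) * g (z.1.1, r ε z.1.1 z.2 • (z.1.2 : Sp n))
  have hFm : ∀ ε, Measurable (F ε) := by
    intro ε
    have hr : Measurable fun z : (Sp n × Metric.sphere (0 : Sp n) 1) × ℝ ↦ r ε z.1.1 z.2 := by
      have : Continuous fun z : (Sp n × Metric.sphere (0 : Sp n) 1) × ℝ ↦ r ε z.1.1 z.2 := by
        fun_prop
      exact this.measurable
    have hv : Measurable fun z : (Sp n × Metric.sphere (0 : Sp n) 1) × ℝ ↦ (z.1.2 : Sp n) :=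
      measurable_subtype_coe.comp (measurable_snd.comp measurable_fst)
    exact ((hk.measurable.comp measurable_snd).mul (hr.pow_const _)).mul
      (hg.comp ((measurable_fst.comp measurable_fst).prodMk (hr.smul hv)))
  have hFb : ∀ ε ∈ Icc (0 : ℝ) 1, ∀ z, z.2 ∈ Ioc (0 : ℝ) 1 → ‖F ε z‖ ≤ Mk * √(A + 2) ^ (n - 2) * M := by
    intro ε hε z hz
    simp only [F, norm_mul, norm_pow]
    have : ‖r ε z.1.1 z.2‖ ≤ √(A + 2) := by
      rw [Real.norm_of_nonneg (Real.sqrt_nonneg _)]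
      refine Real.sqrt_le_sqrt (add_le_add (hPA _) ?_)
      have : ε * z.2 ≤ 1 := mul_le_one₀ hε.2 hz.1.le hz.2
      linarith
    gcongr
    · exact hMk _
    · exact hM _
  have hIae : ∀ᵐ z ∂((m.prod σ).prod I), z.2 ∈ Ioc (0 : ℝ) 1 :=
    Measure.quasiMeasurePreserving_snd.ae (ae_restrict_mem measurableSet_Ioc)
  have hFi : ∀ ε ∈ Icc (0 : ℝ) 1, Integrable (F ε) ((m.prod σ).prod I) := fun ε hε ↦
    Integrable.of_bound (hFm ε).aestronglyMeasurable _ (hIae.mono fun z hz ↦ hFb ε hε z hz)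
  have hB : Tendsto (fun ε ↦ ∫ z, F ε z ∂((m.prod σ).prod I)) (𝓝[>] 0)
      (𝓝 (∫ z, F 0 z ∂((m.prod σ).prod I))) := by
    refine tendsto_integral_filter_of_dominated_convergence
      (fun _ ↦ Mk * √(A + 2) ^ (n - 2) * M)
      (Eventually.of_forall fun ε ↦ (hFm ε).aestronglyMeasurable) ?_ (integrable_const _) ?_
    · filter_upwards [Ioc_mem_nhdsGT (zero_lt_one' ℝ)] with ε hε
      exact hIae.mono fun z hz ↦ hFb ε (Ioc_subset_Icc_self hε) z hz
    · refine Eventually.of_forall fun z ↦ ?_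
      have hr : Continuous fun ε ↦ r ε z.1.1 z.2 := by fun_prop
      have : Continuous fun ε ↦ F ε z :=
        (continuous_const.mul (hr.pow _)).mul
          ((hgc z.1.1).comp (hr.smul continuous_const))
      exact (this.tendsto 0).mono_left nhdsWithin_le_nhds
  have hen : ∀ (ε : ℝ) x θ, (energy φ (x, θ) - τ) / ε =
      (‖θ‖ ^ 2 - speed φ τ x ^ 2) / (2 * ε) := by
    intro ε x θ
    rw [hpsq, energy, P]
    ring
  have hA : ∀ ε ∈ Ioc (0 : ℝ) 1, ∫ q, g q * (ε⁻¹ * k ((energy φ q - τ) / ε)) ∂(m.prod volume) =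
      ∫ z, F ε z ∂((m.prod σ).prod I) := by
    intro ε hε
    have hec : Continuous (energy φ) := by unfold energy; fun_prop
    have hR : ∀ q : Sp n × Sp n, q ∉ univ ×ˢ Metric.closedBall (0 : Sp n) √(A + 2) →
        g q * (ε⁻¹ * k ((energy φ q - τ) / ε)) = 0 := by
      intro q hq
      rw [hk0, mul_zero, mul_zero]
      rintro ⟨-, h2⟩
      rw [show energy φ q = energy φ (q.1, q.2) from rfl, hen, div_lt_one (by linarith [hε.1]),
        hpsq] at h2
      refine hq ⟨mem_univ _, ?_⟩
      rw [mem_closedBall_zero_iff]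
      exact Real.le_sqrt_of_sq_le (by linarith [hPA q.1, hε.2])
    have hint : Integrable (fun q ↦ g q * (ε⁻¹ * k ((energy φ q - τ) / ε))) (m.prod volume) := by
      rw [← integrableOn_iff_integrable_of_support_subset
        (s := univ ×ˢ Metric.closedBall (0 : Sp n) √(A + 2))]
      · refine Measure.integrableOn_of_bounded (M := M * (ε⁻¹ * Mk)) ?_ ?_
          (Eventually.of_forall fun q ↦ ?_)
        · rw [Measure.prod_prod]
          exact (ENNReal.mul_lt_top (measure_lt_top _ _)
            Metric.isBounded_closedBall.measure_lt_top).ne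
        · have : Continuous fun q ↦ k ((energy φ q - τ) / ε) := by fun_prop
          exact (hg.mul (measurable_const.mul this.measurable)).aestronglyMeasurable
        · rw [norm_mul, norm_mul, norm_inv, Real.norm_of_nonneg hε.1.le]
          have := hε.1
          gcongr
          · exact hM q
          · exact hMk _
      · exact fun q hq ↦ by_contra fun h ↦ hq (hR q h)
    have hFi' := hFi ε (Ioc_subset_Icc_self hε)
    rw [integral_prod _ hint, integral_prod _ hFi', integral_prod _ hFi'.integral_prod_left]
    refine integral_congr_ae (Eventually.of_forall fun x ↦ ?_)
    have hxi : Integrable (fun θ ↦ g (x, θ) * (ε⁻¹ * k ((energy φ (x, θ) - τ) / ε))) := by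
      refine Continuous.integrable_of_hasCompactSupport ?_ ?_
      · have : Continuous fun θ ↦ energy φ (x, θ) := by unfold energy; fun_prop
        exact (hgc x).mul (continuous_const.mul (hk.comp (by fun_prop)))
      · exact HasCompactSupport.intro (isCompact_closedBall (0 : Sp n) √(A + 2))
          fun θ hθ ↦ hR (x, θ) fun h ↦ hθ h.2
    beta_reduce
    rw [integral_polar (by omega) hxi]
    refine integral_congr_ae (Eventually.of_forall fun v ↦ ?_)
    beta_reduce
    have hv : ‖(v : Sp n)‖ = 1 := by simp
    have := integral_thin_radial (G := fun r ↦ g (x, r • (v : Sp n))) hn hk hk0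
      ((hgc x).comp (by fun_prop)) (hp x) hε.1
    simp only [hen, norm_smul, hv, mul_one, Real.norm_eq_abs, sq_abs]
    rw [this, intervalIntegral.integral_of_le zero_le_one]
    simp only [F, r, hpsq, I]
  -- At `ε = 0` the radius is `p`, and `p ^ (n - 2) = p ^ (n - 1) / p` accounts for the division by
  -- the speed.
  have hD : ∫ z, F 0 z ∂((m.prod σ).prod I) = ∫ q, g q / speed φ τ q.1 ∂bundleMeasure φ τ m := by
    have hv : Measurable fun z : Sp n × Metric.sphere (0 : Sp n) 1 ↦
        (z.1, speed φ τ z.1 • (z.2 : Sp n)) :=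
      measurable_fst.prodMk ((hpc.measurable.comp measurable_fst).smul
        (measurable_subtype_coe.comp measurable_snd))
    rw [integral_prod _ (hFi 0 (by simp)), bundleMeasure, integral_map hv.aemeasurable,
      integral_withDensity_eq_integral_toReal_smul _ (Eventually.of_forall fun _ ↦
        ENNReal.ofReal_lt_top)]
    · refine integral_congr_ae (Eventually.of_forall fun z ↦ ?_)
      have hk1' : ∫ s in Ioc (0 : ℝ) 1, k s = 1 := by
        refine Eq.trans ?_ hk1
        exact setIntegral_eq_integral_of_forall_compl_eq_zero fun s hs ↦
          hk0 s fun h ↦ hs (Ioo_subset_Ioc_self h)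
      simp only [F, r, I, mul_zero, zero_mul, add_zero, mul_assoc]
      rw [integral_mul_const, hk1', one_mul, ENNReal.toReal_ofReal (pow_nonneg (hp _).le _)]
      change speed φ τ z.1 ^ (n - 2) * g (z.1, speed φ τ z.1 • (z.2 : Sp n)) = _
      obtain ⟨l, rfl⟩ : ∃ l, n = l + 2 := ⟨n - 2, by omega⟩
      rw [show l + 2 - 1 = l + 1 by omega, show l + 2 - 2 = l by omega, pow_succ, smul_eq_mul]
      have := (hp z.1).ne'
      field_simp
    · exact ((hpc.measurable.comp measurable_fst).pow_const _).ennreal_ofReal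
    · exact (hg.div (hpc.measurable.comp measurable_fst)).aestronglyMeasurable
  rw [← hD]
  refine hB.congr' ?_
  filter_upwards [Ioc_mem_nhdsGT (zero_lt_one' ℝ)] with ε hε
  exact (hA ε hε).symm

end ThinShell

/-! ### Height above the boundary -/

section Height

open Filter Topology

variable {Ω : Set (Sp n)} {e : Sp n} {B : Set (Hyp e)} {a b : ℝ} {h : Hyp e → ℝ}

/-- The signed height of `x` over the graph of `h`. -/
def height {e : Sp n} (he : ‖e‖ = 1) (h : Hyp e → ℝ) (x : Sp n) : ℝ :=
  ((splitEquiv he).symm x).2 - h ((splitEquiv he).symm x).1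

@[simp] theorem height_pt (he : ‖e‖ = 1) (y : Hyp e) (t : ℝ) : height he h (pt e y t) = t - h y := by
  have := (splitEquiv he).symm_apply_apply (y, t)
  rw [splitEquiv_apply] at this
  rw [height, this]

namespace IsGraphChart

theorem mem_iff_height (hc : IsGraphChart Ω e B a b h) {x : Sp n} (hx : x ∈ box e B a b) :
    x ∈ Ω ↔ height hc.norm_eq_one h x < 0 := by
  obtain ⟨y, hy, t, ht, rfl⟩ := hx
  rw [height_pt, sub_neg, hc.mem_iff y hy t ht]

theorem mem_frontier_iff_height (hΩ : IsOpen Ω) (hc : IsGraphChart Ω e B a b h) {x : Sp n}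
    (hx : x ∈ box e B a b) : x ∈ frontier Ω ↔ height hc.norm_eq_one h x = 0 := by
  obtain ⟨y, hy, t, ht, rfl⟩ := hx
  rw [height_pt, sub_eq_zero, hc.mem_frontier_iff hΩ hy ht]

theorem notMem_closure_of_height_pos (hΩ : IsOpen Ω) (hc : IsGraphChart Ω e B a b h) {x : Sp n}
    (hx : x ∈ box e B a b) (h0 : 0 < height hc.norm_eq_one h x) : x ∉ closure Ω := by
  intro hxc
  by_cases hxΩ : x ∈ Ω
  · exact h0.not_gt ((hc.mem_iff_height hx).1 hxΩ)
  · exact h0.ne' ((hc.mem_frontier_iff_height hΩ hx).1 (by rw [hΩ.frontier_eq]; exact ⟨hxc, hxΩ⟩))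

theorem hasFDerivAt_height (hc : IsGraphChart Ω e B a b h) {x : Sp n} (hx : x ∈ box e B a b) :
    HasFDerivAt (height hc.norm_eq_one h)
      ((ContinuousLinearMap.snd ℝ (Hyp e) ℝ -
        (fderiv ℝ h ((splitEquiv hc.norm_eq_one).symm x).1).comp
          (ContinuousLinearMap.fst ℝ (Hyp e) ℝ)).comp
            ((splitEquiv hc.norm_eq_one).symm : Sp n →L[ℝ] Hyp e × ℝ)) x := by
  have hy : ((splitEquiv hc.norm_eq_one).symm x).1 ∈ B := by
    obtain ⟨y, hy, t, ht, rfl⟩ := hx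
    rw [← splitEquiv_apply hc.norm_eq_one (y, t), ContinuousLinearEquiv.symm_apply_apply]
    exact hy
  have h1 : HasFDerivAt (fun p : Hyp e × ℝ ↦ p.2 - h p.1) (ContinuousLinearMap.snd ℝ (Hyp e) ℝ -
        (fderiv ℝ h ((splitEquiv hc.norm_eq_one).symm x).1).comp
          (ContinuousLinearMap.fst ℝ (Hyp e) ℝ)) ((splitEquiv hc.norm_eq_one).symm x) :=
    hasFDerivAt_snd.sub
      (HasFDerivAt.comp (g := h) _ (hc.differentiableAt hy).hasFDerivAt hasFDerivAt_fst)
  exact h1.comp x (splitEquiv hc.norm_eq_one).symm.hasFDerivAt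

theorem contDiffOn_height (hc : IsGraphChart Ω e B a b h) :
    ContDiffOn ℝ 2 (height hc.norm_eq_one h) (box e B a b) := by
  have he := hc.norm_eq_one
  have h1 : ContDiffOn ℝ 2 (fun p : Hyp e × ℝ ↦ p.2 - h p.1) (B ×ˢ univ) :=
    contDiffOn_snd.sub (hc.contDiffOn.comp contDiffOn_fst fun p hp ↦ hp.1)
  refine h1.comp (splitEquiv he).symm.contDiff.contDiffOn fun x hx ↦ ?_
  obtain ⟨y, hy, t, ht, rfl⟩ := hx
  rw [← splitEquiv_apply he (y, t), ContinuousLinearEquiv.symm_apply_apply]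
  exact ⟨hy, mem_univ _⟩

theorem continuousOn_fderiv_height (hc : IsGraphChart Ω e B a b h) :
    ContinuousOn (fun q : Sp n × Sp n ↦ fderiv ℝ (height hc.norm_eq_one h) q.1 q.2)
      (box e B a b ×ˢ univ) := by
  have h1 := hc.contDiffOn_height.continuousOn_fderiv_of_isOpen
    (isOpen_box hc.norm_eq_one hc.isOpen a b) one_le_two
  exact (h1.comp continuousOn_fst fun q hq ↦ hq.1).clm_apply continuousOn_snd

/-- On `∂Ω` the sign of `⟨θ, n⟩` thus decides whether the height increases or decreases along a
trajectory with velocity `θ`. -/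
theorem fderiv_height (hΩ : IsOpen Ω) (hc : IsGraphChart Ω e B a b h) {x : Sp n}
    (hx : x ∈ box e B a b) (hxf : x ∈ frontier Ω) :
    ∃ c : ℝ, 0 < c ∧ ∀ θ, fderiv ℝ (height hc.norm_eq_one h) x θ =
      c * inner ℝ θ (outerNormal Ω x) := by
  have he := hc.norm_eq_one
  have hd := hc.hasFDerivAt_height hx
  have h0 := (hc.mem_frontier_iff_height hΩ hx).1 hxf
  obtain ⟨y, hy, t, ht, rfl⟩ := hx
  rw [height_pt, sub_eq_zero] at h0
  subst h0
  refine ⟨√(1 + ‖fderiv ℝ h y‖ ^ 2), by positivity, fun θ ↦ ?_⟩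
  obtain ⟨⟨w, s⟩, rfl⟩ := (splitEquiv he).surjective θ
  have h1 := (splitEquiv he).symm_apply_apply (y, h y)
  rw [splitEquiv_apply] at h1
  rw [hd.fderiv, h1, splitEquiv_apply, hc.normal y hy w s]
  have h2 := (splitEquiv he).symm_apply_apply (w, s)
  rw [splitEquiv_apply] at h2
  simp [h2]

end IsGraphChart

end Height

/-! ### Cutoff flows and tubes of trajectories -/

section Tube

open Filter Topology

/-- `Φ` is the global flow of a bounded Lipschitz field `Z` that is a multiple of `W`, and coincides
with `W` on the ball of radius `R`. -/
structure IsCutoffFlow {E : Type*} [NormedAddCommGroup E] [NormedSpace ℝ E] (W : E → E) (R : ℝ)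
    (Z : E → E) (K M : NNReal) (Φ : ℝ → E → E) : Prop where
  lipschitz : LipschitzWith K Z
  norm_le : ∀ q, ‖Z q‖ ≤ M
  flow : IsGlobalFlow Z Φ
  eq : ∀ q, ‖q‖ < R → Z q = W q
  smul : ∀ q, ∃ c : ℝ, Z q = c • W q

/-- Multiplying by a scalar cutoff gives compact support, hence a bounded Lipschitz field with a
complete flow. The new field stays parallel to `W`, so first integrals of `W` survive the cutoff. -/
theorem exists_isCutoffFlow {E : Type*} [NormedAddCommGroup E] [NormedSpace ℝ E]
    [FiniteDimensional ℝ E] {W : E → E} (hW : ContDiff ℝ ∞ W) (R : ℝ) :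
    ∃ Z K M Φ, IsCutoffFlow W R Z K M Φ := by
  have : CompleteSpace E := FiniteDimensional.complete ℝ E
  obtain ⟨ζ, hζs, hζc, -, hζ1, -⟩ := exists_cutoff (isCompact_closedBall (0 : E) R)
    isOpen_univ (subset_univ _)
  have hZs : ContDiff ℝ ∞ fun q ↦ ζ q • W q := hζs.smul hW
  have hZc : HasCompactSupport fun q ↦ ζ q • W q := hζc.smul_right
  obtain ⟨K, hK⟩ := hZs.lipschitzWith_of_hasCompactSupport hZc (by simp)
  obtain ⟨M, hM⟩ := hZc.exists_bound_of_continuous hZs.continuous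
  have hM' : ∀ q, ‖ζ q • W q‖ ≤ M.toNNReal := fun q ↦ (hM q).trans (Real.le_coe_toNNReal M)
  obtain ⟨Φ, hΦ⟩ := exists_isGlobalFlow hK hM'
  refine ⟨_, K, M.toNNReal, Φ, hK, hM', hΦ, fun q hq ↦ ?_, fun q ↦ ⟨ζ q, rfl⟩⟩
  have := hζ1.self_of_nhdsSet q (mem_closedBall_zero_iff.2 hq.le)
  simp [this]

variable {Ω : Set (Sp n)} {e : Sp n} {B : Set (Hyp e)} {a b : ℝ} {h : Hyp e → ℝ}
  {φ : Sp n → ℝ} {Y : Sp n → Matrix (Fin n) (Fin n) ℝ} {R : ℝ} {K M : NNReal}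
  {Z : Sp n × Sp n → Sp n × Sp n} {Φ : ℝ → Sp n × Sp n → Sp n × Sp n}

theorem IsCutoffFlow.hasDerivAt_height (hΦ : IsCutoffFlow (vectorField φ Y) R Z K M Φ)
    (hc : IsGraphChart Ω e B a b h) {q : Sp n × Sp n} {t : ℝ}
    (hx : (Φ t q).1 ∈ box e B a b) (hR : ‖Φ t q‖ < R) :
    HasDerivAt (fun s ↦ height hc.norm_eq_one h (Φ s q).1)
      (fderiv ℝ (height hc.norm_eq_one h) (Φ t q).1 (Φ t q).2) t := by
  have h1 := hΦ.flow.hasDerivAt q t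
  rw [hΦ.eq _ hR] at h1
  have h2 : HasDerivAt (fun s ↦ (Φ s q).1) (Φ t q).2 t := h1.fst
  exact (hc.hasFDerivAt_height hx).differentiableAt.hasFDerivAt.comp_hasDerivAt t h2

/-- A tube of trajectories around one that leaves `Ω` transversally. -/
theorem IsCutoffFlow.exists_tube (hΦ : IsCutoffFlow (vectorField φ Y) R Z K M Φ) (hΩ : IsOpen Ω)
    (hΩs : HasSmoothBoundary Ω) {q₀ : Sp n × Sp n} {T₀ : ℝ} (hT₀ : 0 < T₀)
    (hin : ∀ t ∈ Ico 0 T₀, (Φ t q₀).1 ∈ Ω) (hout : (Φ T₀ q₀).1 ∈ frontier Ω)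
    (htr : 0 < inner ℝ (Φ T₀ q₀).2 (outerNormal Ω (Φ T₀ q₀).1))
    (hR : ∀ t ∈ Icc 0 T₀, ‖Φ t q₀‖ < R) :
    ∃ r > 0, ∃ T > 0, ∃ e B a b h, IsGraphChart Ω e B a b h ∧
      (∀ q ∈ Metric.ball q₀ r, ∀ t ∈ Icc 0 T, ‖Φ t q‖ < R) ∧
      (∀ q ∈ Metric.ball q₀ r, ∀ t ∈ Icc 0 T, (Φ t q).1 ∈ frontier Ω →
        (Φ t q).1 ∈ box e B a b ∧ 0 < inner ℝ (Φ t q).2 (outerNormal Ω (Φ t q).1) ∧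
          ∀ t' ∈ Ico 0 t, (Φ t' q).1 ∈ Ω) ∧
      ∀ q ∈ Metric.ball q₀ r, (Φ T q).1 ∉ closure Ω := by
  obtain ⟨e, B, a, b, h, hc, hxb⟩ := exists_isGraphChart hΩs hout
  have he := hc.norm_eq_one
  have hbo := isOpen_box he hc.isOpen a b
  have hΦc := hΦ.flow.continuous hΦ.lipschitz
  set F := height he h
  -- the region where the height increases along the flow
  let V : Set (Sp n × Sp n) := {q | (q.1 ∈ box e B a b ∧ 0 < fderiv ℝ F q.1 q.2) ∧ ‖q‖ < R}
  have hVo : IsOpen V := by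
    have h1 : IsOpen ((box e B a b ×ˢ univ) ∩
        (fun q : Sp n × Sp n ↦ fderiv ℝ F q.1 q.2) ⁻¹' Ioi 0) :=
      hc.continuousOn_fderiv_height.isOpen_inter_preimage (hbo.prod isOpen_univ) isOpen_Ioi
    have h2 : IsOpen {q : Sp n × Sp n | ‖q‖ < R} := isOpen_lt continuous_norm continuous_const
    convert h1.inter h2 using 1
    ext q; simp [V]
  have hV0 : Φ T₀ q₀ ∈ V := by
    obtain ⟨c, hc0, hcd⟩ := hc.fderiv_height hΩ hxb hout
    exact ⟨⟨hxb, by rw [hcd]; exact mul_pos hc0 htr⟩, hR T₀ ⟨hT₀.le, le_rfl⟩⟩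
  have hnear : ∀ᶠ p : ℝ × (Sp n × Sp n) in 𝓝 (T₀, q₀), Φ p.1 p.2 ∈ V :=
    hΦc.continuousAt.eventually (hVo.mem_nhds hV0)
  rw [nhds_prod_eq, eventually_prod_iff] at hnear
  obtain ⟨pa, hpa, pb, hpb, hab⟩ := hnear
  obtain ⟨δ', hδ', hδa⟩ := Metric.eventually_nhds_iff.1 hpa
  -- The window of times around `T₀` must stay inside the neighbourhood found above and to the right
  -- of `0`.
  set δ := min (δ' / 2) (T₀ / 2) with hδ
  have hδ0 : 0 < δ := by positivity
  have hδ1 : δ < δ' := (min_le_left _ _).trans_lt (by linarith)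
  have hδT : δ < T₀ := (min_le_right _ _).trans_lt (by linarith)
  have hmemV : ∀ t ∈ Icc (T₀ - δ) (T₀ + δ), ∀ q, pb q → Φ t q ∈ V := fun t ht q hq ↦ by
    refine hab (hδa ?_) hq
    rw [Real.dist_eq]
    exact (abs_le.2 ⟨by linarith [ht.1], by linarith [ht.2]⟩).trans_lt hδ1
  -- Inside the window the height increases strictly along every nearby trajectory, so `∂Ω` is
  -- crossed at most once there, and outward.
  have hmono : ∀ q, pb q → StrictMonoOn (fun t ↦ F (Φ t q).1) (Icc (T₀ - δ) (T₀ + δ)) := by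
    intro q hq
    have hd : ∀ t ∈ Icc (T₀ - δ) (T₀ + δ),
        HasDerivAt (fun s ↦ F (Φ s q).1) (fderiv ℝ F (Φ t q).1 (Φ t q).2) t := fun t ht ↦
      hΦ.hasDerivAt_height hc (hmemV t ht q hq).1.1 (hmemV t ht q hq).2
    refine strictMonoOn_of_deriv_pos (convex_Icc _ _)
      (fun t ht ↦ (hd t ht).continuousAt.continuousWithinAt) fun t ht ↦ ?_
    have ht' := interior_subset ht
    rw [(hd t ht').deriv]
    exact (hmemV t ht' q hq).1.2
  have hpb0 : pb q₀ := hpb.self_of_nhds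
  have hT₀mem : T₀ ∈ Icc (T₀ - δ) (T₀ + δ) := ⟨by linarith, by linarith⟩
  have hTmem : T₀ + δ ∈ Icc (T₀ - δ) (T₀ + δ) := ⟨by linarith, by linarith⟩
  have hFT : 0 < F (Φ (T₀ + δ) q₀).1 := by
    have h1 := hmono q₀ hpb0 hT₀mem hTmem (by linarith)
    have h2 : F (Φ T₀ q₀).1 = 0 := (hc.mem_frontier_iff_height hΩ hxb).1 hout
    simpa only [h2] using h1
  have hend : ∀ᶠ q in 𝓝 q₀, 0 < F (Φ (T₀ + δ) q).1 := by
    have h1 : ContinuousAt F (Φ (T₀ + δ) q₀).1 :=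
      (hc.hasFDerivAt_height (hmemV _ hTmem q₀ hpb0).1.1).continuousAt
    have h2 : Continuous fun q ↦ (Φ (T₀ + δ) q).1 :=
      continuous_fst.comp (hΦc.comp (Continuous.prodMk_right _))
    exact (ContinuousAt.comp (f := fun q ↦ (Φ (T₀ + δ) q).1) h1 h2.continuousAt).eventually
      (lt_mem_nhds hFT)
  -- Before the window the central trajectory runs in the open set `Ω` over a compact time interval,
  -- so nearby trajectories do so too. The tube has length `T₀ + δ`.
  have hbefore : ∀ᶠ q in 𝓝 q₀, ∀ t ∈ Icc 0 (T₀ - δ), (Φ t q).1 ∈ Ω ∧ ‖Φ t q‖ < R := by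
    refine isCompact_Icc.eventually_forall_of_forall_eventually fun t ht ↦ ?_
    have ht' : t ∈ Ico 0 T₀ := ⟨ht.1, by linarith [ht.2]⟩
    have hswap : Continuous fun z : (Sp n × Sp n) × ℝ ↦ Φ z.2 z.1 := hΦc.comp continuous_swap
    have h1 : IsOpen {q : Sp n × Sp n | q.1 ∈ Ω ∧ ‖q‖ < R} :=
      (hΩ.preimage continuous_fst).inter (isOpen_lt continuous_norm continuous_const)
    exact (h1.preimage hswap).mem_nhds
      (show (q₀, t) ∈ _ from ⟨hin t ht', hR t ⟨ht.1, ht'.2.le⟩⟩)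
  obtain ⟨r, hr, hball⟩ := Metric.eventually_nhds_iff_ball.1 ((hpb.and hend).and hbefore)
  have hcases : ∀ t ∈ Icc 0 (T₀ + δ), t ∈ Icc 0 (T₀ - δ) ∨ t ∈ Icc (T₀ - δ) (T₀ + δ) := by
    intro t ht
    rcases le_total t (T₀ - δ) with h1 | h1
    · exact Or.inl ⟨ht.1, h1⟩
    · exact Or.inr ⟨h1, ht.2⟩
  refine ⟨r, hr, T₀ + δ, by linarith, e, B, a, b, h, hc, fun q hq t ht ↦ ?_, fun q hq t ht hf ↦ ?_,
    fun q hq ↦ ?_⟩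
  · obtain ⟨⟨h1, -⟩, h3⟩ := hball q hq
    rcases hcases t ht with h4 | h4
    · exact (h3 t h4).2
    · exact (hmemV t h4 q h1).2
  · obtain ⟨⟨h1, -⟩, h3⟩ := hball q hq
    rcases hcases t ht with h4 | h4
    · exact absurd hf (fun h ↦ (hΩ.frontier_eq ▸ h : _ ∈ closure Ω \ Ω).2 (h3 t h4).1)
    · have h5 := hmemV t h4 q h1
      obtain ⟨c, hc0, hcd⟩ := hc.fderiv_height hΩ h5.1.1 hf
      refine ⟨h5.1.1, ?_, fun t' ht' ↦ ?_⟩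
      · have := h5.1.2
        rw [hcd] at this
        exact pos_of_mul_pos_right this hc0.le
      · rcases hcases t' ⟨ht'.1, ht'.2.le.trans ht.2⟩ with h6 | h6
        · exact (h3 t' h6).1
        · have h7 := hmono q h1 h6 h4 ht'.2
          have h8 : F (Φ t q).1 = 0 := (hc.mem_frontier_iff_height hΩ h5.1.1).1 hf
          simp only [h8] at h7
          exact (hc.mem_iff_height (hmemV t' h6 q h1).1.1).2 h7
  · obtain ⟨⟨h1, h2⟩, h3⟩ := hball q hq
    exact hc.notMem_closure_of_height_pos hΩ (hmemV _ hTmem q h1).1.1 h2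

end Tube

/-! ### Conservation of energy -/

section Energy

variable {φ : Sp n → ℝ} {Y : Sp n → Matrix (Fin n) (Fin n) ℝ}

theorem inner_toEuclideanLin_self_of_skew {A : Matrix (Fin n) (Fin n) ℝ} (hA : A.transpose = -A)
    (θ : Sp n) : inner ℝ θ (Matrix.toEuclideanLin A θ) = 0 := by
  have h1 : inner ℝ θ (Matrix.toEuclideanLin A θ) =
      inner ℝ (Matrix.toEuclideanLin A.transpose θ) θ := by
    have := LinearMap.adjoint_inner_left (Matrix.toEuclideanLin A) θ θ
    rw [← Matrix.toEuclideanLin_conjTranspose_eq_adjoint, Matrix.conjTranspose_eq_transpose_of_trivial]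
      at this
    exact this.symm
  rw [hA, map_neg, LinearMap.neg_apply, inner_neg_left] at h1
  have h2 := real_inner_comm θ (Matrix.toEuclideanLin A θ)
  linarith

/-- The energy is conserved along the flow, up to a time change. -/
theorem energy_eq_of_hasDerivWithinAt (hφ : Differentiable ℝ φ) {c : ℝ → Sp n × Sp n} {t : ℝ}
    {κ : ℝ → ℝ} (hc : ∀ s ∈ uIcc 0 t, HasDerivWithinAt c (κ s • vectorField φ Y (c s)) (uIcc 0 t) s)
    (hY : ∀ s ∈ uIcc 0 t, (Y (c s).1).transpose = -Y (c s).1) {s : ℝ} (hs : s ∈ uIcc 0 t) :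
    energy φ (c s) = energy φ (c 0) := by
  have hd : ∀ s ∈ uIcc 0 t, HasDerivWithinAt (fun s ↦ energy φ (c s)) 0 (uIcc 0 t) s := by
    intro s hs
    have h1 : HasDerivWithinAt (fun s ↦ (c s).1) (κ s • (c s).2) (uIcc 0 t) s := (hc s hs).fst
    have h2 : HasDerivWithinAt (fun s ↦ (c s).2) (κ s • force φ Y (c s).1 (c s).2) (uIcc 0 t) s :=
      (hc s hs).snd
    have h3 := ((hφ _).hasFDerivAt (x := (c s).1)).comp_hasDerivWithinAt s h1
    refine ((h2.norm_sq.div_const 2).add h3).congr_deriv ?_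
    -- The derivative of the energy is `κ (⟨Θ, -∇φ + YΘ⟩ + ⟨∇φ, Θ⟩)`, and the skew part does no
    -- work.
    have h4 := inner_toEuclideanLin_self_of_skew (hY s hs) (c s).2
    rw [map_smul, ← inner_gradient_left, real_inner_smul_right, force, inner_add_right,
      inner_neg_right, h4, real_inner_comm, smul_eq_mul]
    ring
  have := (convex_uIcc (0 : ℝ) t).norm_image_sub_le_of_norm_hasDerivWithin_le (C := 0) hd
    (fun _ _ ↦ by simp) left_mem_uIcc hs
  rw [zero_mul] at this
  exact sub_eq_zero.1 (norm_le_zero_iff.1 this)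

end Energy

/-! ### The local formula in phase space -/

section LocalIdentity

open Filter Topology

variable {Ω : Set (Sp n)} {e : Sp n} {B : Set (Hyp e)} {a b : ℝ} {h : Hyp e → ℝ}
  {φ : Sp n → ℝ} {Y : Sp n → Matrix (Fin n) (Fin n) ℝ} {R : ℝ} {K M : NNReal}
  {Z : Sp n × Sp n → Sp n × Sp n} {Φ : ℝ → Sp n × Sp n → Sp n × Sp n}

theorem IsCutoffFlow.energy_eq (hΦ : IsCutoffFlow (vectorField φ Y) R Z K M Φ)
    (hφ : Differentiable ℝ φ) (hY : ∀ x ∈ closure Ω, (Y x).transpose = -Y x) {q : Sp n × Sp n}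
    {t : ℝ} (ht : ∀ s ∈ uIcc 0 t, (Φ s q).1 ∈ closure Ω) : energy φ (Φ t q) = energy φ q := by
  choose κ hκ using hΦ.smul
  have := energy_eq_of_hasDerivWithinAt (φ := φ) (Y := Y) hφ (c := fun s ↦ Φ s q) (t := t)
    (κ := fun s ↦ κ (Φ s q))
    (fun s hs ↦ by rw [← hκ]; exact (hΦ.flow.hasDerivAt q s).hasDerivWithinAt)
    (fun s hs ↦ hY _ (ht s hs)) right_mem_uIcc
  rwa [hΦ.flow.zero] at this

/-- A tube of trajectories of length `T`, starting from `N`, that leave `Ω` through a chart. -/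
structure IsTube (Ω : Set (Sp n)) (e : Sp n) (B : Set (Hyp e)) (a b R : ℝ)
    (Φ : ℝ → Sp n × Sp n → Sp n × Sp n) (N : Set (Sp n × Sp n)) (T : ℝ) : Prop where
  pos : 0 < T
  norm_lt : ∀ q ∈ N, ∀ t ∈ Icc 0 T, ‖Φ t q‖ < R
  mem_box : ∀ q ∈ N, ∀ t ∈ Icc 0 T, (Φ t q).1 ∈ frontier Ω → (Φ t q).1 ∈ box e B a b
  inner_pos : ∀ q ∈ N, ∀ t ∈ Icc 0 T, (Φ t q).1 ∈ frontier Ω →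
    0 < inner ℝ (Φ t q).2 (outerNormal Ω (Φ t q).1)
  mem_before : ∀ q ∈ N, ∀ t ∈ Icc 0 T, (Φ t q).1 ∈ frontier Ω → ∀ t' ∈ Ico 0 t, (Φ t' q).1 ∈ Ω
  notMem : ∀ q ∈ N, (Φ T q).1 ∉ closure Ω

/-- The integral of `f` along the backward orbit of length `T`. -/
def orbitIntegral (Φ : ℝ → Sp n × Sp n → Sp n × Sp n) (T : ℝ) (f : Sp n × Sp n → ℝ)
    (q : Sp n × Sp n) : ℝ :=
  ∫ s in (0 : ℝ)..T, f (Φ (-s) q)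

variable {N : Set (Sp n × Sp n)} {T : ℝ} {f : Sp n × Sp n → ℝ} {C : NNReal}

/-- Grönwall's bound over times at most `T`; no differentiability of the flow in the initial point
is needed. -/
theorem IsCutoffFlow.lipschitzWith_orbitIntegral (hΦ : IsCutoffFlow (vectorField φ Y) R Z K M Φ)
    (hT : 0 ≤ T) (hf : LipschitzWith C f) : ∃ C', LipschitzWith C' (orbitIntegral Φ T f) := by
  refine ⟨_, LipschitzWith.of_dist_le' (K := C * Real.exp (K * T) * T) fun q q' ↦ ?_⟩
  have hc : ∀ q, Continuous fun s ↦ f (Φ (-s) q) := fun q ↦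
    hf.continuous.comp ((hΦ.flow.continuous_time q).comp continuous_neg)
  rw [Real.dist_eq, orbitIntegral, orbitIntegral, ← intervalIntegral.integral_sub
    ((hc q).intervalIntegrable _ _) ((hc q').intervalIntegrable _ _)]
  have := intervalIntegral.norm_integral_le_of_norm_le_const (a := 0) (b := T)
    (f := fun s ↦ f (Φ (-s) q) - f (Φ (-s) q')) (C := C * (dist q q' * Real.exp (K * T)))
    fun s hs ↦ ?_
  · rw [sub_zero, abs_of_nonneg hT, Real.norm_eq_abs] at this
    linarith
  · rw [uIoc_of_le hT] at hs
    rw [← dist_eq_norm]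
    refine (hf.dist_le_mul _ _).trans ?_
    refine mul_le_mul_of_nonneg_left ((hΦ.flow.dist_le hΦ.lipschitz _ _ _).trans ?_) C.2
    have : |-s| ≤ T := by rw [abs_neg, abs_of_pos hs.1]; exact hs.2
    gcongr

/-- Along an orbit the integral runs over the moving window `[t - T, t]`, so its derivative is the
difference of the end values. This is the transport equation that makes it a primitive of `f`. -/
theorem IsCutoffFlow.hasDerivAt_orbitIntegral (hΦ : IsCutoffFlow (vectorField φ Y) R Z K M Φ)
    (hf : Continuous f) (q : Sp n × Sp n) :
    HasDerivAt (fun t ↦ orbitIntegral Φ T f (Φ t q)) (f q - f (Φ (-T) q)) 0 := by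
  have hc : Continuous fun s ↦ f (Φ s q) := hf.comp (hΦ.flow.continuous_time q)
  have h1 : ∀ t, orbitIntegral Φ T f (Φ t q) =
      (∫ s in (0 : ℝ)..t, f (Φ s q)) - ∫ s in (0 : ℝ)..(t - T), f (Φ s q) := by
    intro t
    rw [orbitIntegral, intervalIntegral.integral_interval_sub_left (hc.intervalIntegrable _ _)
      (hc.intervalIntegrable _ _)]
    simp only [← hΦ.flow.add hΦ.lipschitz]
    have := intervalIntegral.integral_comp_sub_left (a := 0) (b := T) (fun s ↦ f (Φ s q)) t
    simp only [sub_zero] at this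
    rw [← this]
    simp only [sub_eq_add_neg, add_comm]
  simp only [h1]
  have h2 : ∀ k, HasDerivAt (fun t ↦ ∫ s in (0 : ℝ)..t, f (Φ s q)) (f (Φ k q)) k := fun k ↦
    intervalIntegral.integral_hasDerivAt_right (hc.intervalIntegrable _ _)
      (hc.stronglyMeasurableAtFilter _ _) hc.continuousAt
  have h3 := h2 (0 - T)
  have h4 : HasDerivAt (fun t : ℝ ↦ t - T) 1 0 := (hasDerivAt_id (0 : ℝ)).sub_const T
  refine ((h2 0).sub (HasDerivAt.comp (0 : ℝ) h3 h4)).congr_deriv ?_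
  rw [hΦ.flow.zero, mul_one, zero_sub]

theorem IsCutoffFlow.tsupport_orbitIntegral_subset
    (hΦ : IsCutoffFlow (vectorField φ Y) R Z K M Φ) (hT : 0 ≤ T) (hfc : HasCompactSupport f) :
    tsupport (orbitIntegral Φ T f) ⊆
      (fun p : ℝ × (Sp n × Sp n) ↦ Φ p.1 p.2) '' (Icc 0 T ×ˢ tsupport f) := by
  have hcpt : IsCompact ((fun p : ℝ × (Sp n × Sp n) ↦ Φ p.1 p.2) '' (Icc 0 T ×ˢ tsupport f)) :=
    (isCompact_Icc.prod hfc.isCompact).image (hΦ.flow.continuous hΦ.lipschitz)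
  refine closure_minimal (fun q hq ↦ ?_) hcpt.isClosed
  by_contra hn
  refine hq ?_
  refine (intervalIntegral.integral_congr fun s hs ↦ ?_).trans intervalIntegral.integral_zero
  rw [uIcc_of_le hT] at hs
  refine image_eq_zero_of_notMem_tsupport fun h ↦ hn ⟨(s, Φ (-s) q), ⟨hs, h⟩, ?_⟩
  exact hΦ.flow.self_neg hΦ.lipschitz s q

/-- Santaló's formula in phase space, along a tube. -/
theorem IsTube.integral_eq (hN : IsTube Ω e B a b R Φ N T) (hΩ : IsOpen Ω)
    (hΩb : Bornology.IsBounded Ω) (hΩs : HasSmoothBoundary Ω) (hc : IsGraphChart Ω e B a b h)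
    (hF : Continuous fun q : Sp n × Sp n ↦ force φ Y q.1 q.2)
    (hY : ∀ x ∈ closure Ω, (Y x).transpose = -Y x)
    (hΦ : IsCutoffFlow (vectorField φ Y) R Z K M Φ)
    (hf : LipschitzWith C f) (hfc : HasCompactSupport f) (hfN : tsupport f ⊆ N) :
    ∫ q in Ω ×ˢ univ, f q =
      ∫ θ, ∫ x, orbitIntegral Φ T f (x, θ) * inner ℝ θ (outerNormal Ω x) ∂surfaceMeasure Ω := by
  have := isFiniteMeasure_surfaceMeasure hΩ hΩb hΩs
  obtain ⟨C', hu⟩ := hΦ.lipschitzWith_orbitIntegral hN.pos.le hf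
  have hsub := hΦ.tsupport_orbitIntegral_subset hN.pos.le hfc
  have hcpt : IsCompact ((fun p : ℝ × (Sp n × Sp n) ↦ Φ p.1 p.2) '' (Icc 0 T ×ˢ tsupport f)) :=
    (isCompact_Icc.prod hfc.isCompact).image (hΦ.flow.continuous hΦ.lipschitz)
  have huc : HasCompactSupport (orbitIntegral Φ T f) :=
    hcpt.of_isClosed_subset (isClosed_tsupport _) hsub
  rw [← integral_fderiv_vectorField hΩ hΩb hΩs hc hF (fun x hx ↦ hY x (subset_closure hx)) hu huc]
  · have hvolp : (volume : Measure (Sp n × Sp n)).IsAddHaarMeasure := by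
      rw [Measure.volume_eq_prod]; infer_instance
    refine integral_congr_ae ?_
    filter_upwards [ae_restrict_of_ae hu.ae_differentiableAt,
      ae_restrict_mem (hΩ.measurableSet.prod MeasurableSet.univ)] with q hq hqΩ
    by_cases hqR : ‖q‖ < R
    · rw [← hΦ.eq q hqR]
      have h1 := hΦ.flow.hasDerivAt q 0
      rw [hΦ.flow.zero] at h1
      have h2 : HasFDerivAt (orbitIntegral Φ T f) (fderiv ℝ (orbitIntegral Φ T f) q) (Φ 0 q) := by
        rw [hΦ.flow.zero]; exact hq.hasFDerivAt
      have h3 := h2.comp_hasDerivAt (0 : ℝ) h1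
      rw [h3.unique (hΦ.hasDerivAt_orbitIntegral hf.continuous q)]
      -- Otherwise `Φ (-T) q` would lie in the tube, and its end point `q` would be outside the
      -- closure of `Ω`.
      have h4 : f (Φ (-T) q) = 0 := by
        by_contra h5
        have h6 := hN.notMem _ (hfN (subset_tsupport f h5))
        rw [hΦ.flow.self_neg hΦ.lipschitz] at h6
        exact h6 (subset_closure hqΩ.1)
      rw [h4, sub_zero]
    -- Outside the ball of radius `R`, where the cutoff field may differ from the generator, both
    -- sides vanish because the tube stays in the ball.
    · rw [fderiv_apply_eq_zero]
      · by_contra h5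
        have := hN.norm_lt q (hfN (subset_tsupport f h5)) 0 ⟨le_rfl, hN.pos.le⟩
        rw [hΦ.flow.zero] at this
        exact hqR this
      · intro h5
        obtain ⟨⟨s, q'⟩, ⟨hs, hq'⟩, rfl⟩ := hsub h5
        exact hqR (hN.norm_lt q' (hfN hq') s hs)
  · intro q hq hqf
    obtain ⟨⟨s, q'⟩, ⟨hs, hq'⟩, rfl⟩ := hsub hq
    exact hN.mem_box q' (hfN hq') s hs hqf

end LocalIdentity

/-! ### The local formula on the energy shell -/

section ShellIdentity

open Filter Topology

variable {Ω : Set (Sp n)} {e : Sp n} {B : Set (Hyp e)} {a b : ℝ} {h : Hyp e → ℝ}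
  {φ : Sp n → ℝ} {Y : Sp n → Matrix (Fin n) (Fin n) ℝ} {R : ℝ} {K M : NNReal}
  {Z : Sp n × Sp n → Sp n × Sp n} {Φ : ℝ → Sp n × Sp n → Sp n × Sp n}
  {N : Set (Sp n × Sp n)} {T : ℝ} {f : Sp n × Sp n → ℝ} {C : NNReal}

theorem exists_lipschitzWith_mul_contDiff {E : Type*} [NormedAddCommGroup E] [NormedSpace ℝ E]
    [FiniteDimensional ℝ E] {f w : E → ℝ} {C : NNReal} (hf : LipschitzWith C f)
    (hfc : HasCompactSupport f) (hw : ContDiff ℝ ∞ w) :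
    ∃ C', LipschitzWith C' fun q ↦ f q * w q := by
  obtain ⟨ζ, hζs, hζc, -, hζ1, -⟩ := exists_cutoff hfc.isCompact isOpen_univ (subset_univ _)
  have hws : ContDiff ℝ ∞ fun q ↦ ζ q * w q := hζs.mul hw
  have hwc : HasCompactSupport fun q ↦ ζ q * w q := hζc.mul_right
  obtain ⟨C1, hC1⟩ := hws.lipschitzWith_of_hasCompactSupport hwc (by simp)
  obtain ⟨M1, hM1⟩ := hwc.exists_bound_of_continuous hws.continuous
  obtain ⟨M2, hM2⟩ := hfc.exists_bound_of_continuous hf.continuous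
  obtain ⟨C', hC'⟩ := exists_lipschitzWith_mul hf hC1 hM2 hM1
  have heq : (fun q ↦ f q * w q) = fun q ↦ f q * (ζ q * w q) := by
    ext q
    by_cases hq : q ∈ tsupport f
    · rw [hζ1.self_of_nhdsSet q hq, one_mul]
    · rw [image_eq_zero_of_notMem_tsupport hq, zero_mul, zero_mul]
  exact ⟨C', heq ▸ hC'⟩

theorem contDiff_energy (hφ : ContDiff ℝ ∞ φ) : ContDiff ℝ ∞ (energy φ) := by
  have h1 : ContDiff ℝ ∞ fun q : Sp n × Sp n ↦ ‖q.2‖ ^ 2 / 2 :=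
    ((contDiff_norm_sq ℝ).comp contDiff_snd).div_const 2
  exact h1.add (hφ.comp contDiff_fst)

/-- Where `f` does not vanish on the backward orbit, the orbit stays in `Ω` until it reaches the
boundary point `q`. There `Y` is skew, so the energy is constant and its weight can be taken out of
the integral. Boundary points are enough, since only they enter after the divergence theorem. -/
theorem IsTube.orbitIntegral_mul_energy (hN : IsTube Ω e B a b R Φ N T)
    (hY : ∀ x ∈ closure Ω, (Y x).transpose = -Y x) (hφ : Differentiable ℝ φ)
    (hΦ : IsCutoffFlow (vectorField φ Y) R Z K M Φ) (hfN : tsupport f ⊆ N) (w : ℝ → ℝ)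
    {q : Sp n × Sp n} (hq : q.1 ∈ frontier Ω) :
    orbitIntegral Φ T (fun q ↦ f q * w (energy φ q)) q = orbitIntegral Φ T f q * w (energy φ q) := by
  rw [orbitIntegral, orbitIntegral, ← intervalIntegral.integral_mul_const]
  refine intervalIntegral.integral_congr fun s hs ↦ ?_
  rw [uIcc_of_le hN.pos.le] at hs
  by_cases h0 : f (Φ (-s) q) = 0
  · rw [h0, zero_mul, zero_mul]
  · have hmem := hfN (subset_tsupport f h0)
    have hback := hΦ.flow.self_neg hΦ.lipschitz s q
    have hin := hN.mem_before _ hmem s hs (by rwa [hback])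
    have := hΦ.energy_eq hφ hY (q := Φ (-s) q) (t := s) fun t ht ↦ by
      rw [uIcc_of_le hs.1] at ht
      rcases ht.2.eq_or_lt with rfl | ht2
      · rw [hback]; exact frontier_subset_closure hq
      · exact subset_closure (hin t ⟨ht.1, ht2⟩)
    rw [hback] at this
    rw [this]

/-- Santaló's formula on the energy shell, along a tube. -/
theorem IsTube.integral_shell_eq (hn : 2 ≤ n) (hN : IsTube Ω e B a b R Φ N T) (hΩ : IsOpen Ω)
    (hΩb : Bornology.IsBounded Ω) (hΩs : HasSmoothBoundary Ω) (hc : IsGraphChart Ω e B a b h)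
    (hF : Continuous fun q : Sp n × Sp n ↦ force φ Y q.1 q.2)
    (hY : ∀ x ∈ closure Ω, (Y x).transpose = -Y x) (hφ : ContDiff ℝ ∞ φ) {τ A : ℝ}
    (hP0 : ∀ x, 0 < P φ τ x) (hPA : ∀ x, P φ τ x ≤ A)
    (hΦ : IsCutoffFlow (vectorField φ Y) R Z K M Φ)
    (hf : LipschitzWith C f) (hfc : HasCompactSupport f) (hfN : tsupport f ⊆ N) :
    ∫ q, f q / speed φ τ q.1 ∂phaseMeasure φ τ Ω =
      ∫ q, orbitIntegral Φ T f q * inner ℝ q.2 (outerNormal Ω q.1) / speed φ τ q.1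
        ∂bundleMeasure φ τ (surfaceMeasure Ω) := by
  have := isFiniteMeasure_surfaceMeasure hΩ hΩb hΩs
  have hfinΩ : IsFiniteMeasure ((volume : Measure (Sp n)).restrict Ω) :=
    ⟨by rw [Measure.restrict_apply_univ]; exact hΩb.measure_lt_top⟩
  -- Centre and outer radius `1/2` put the support of `k` in `[0, 1]`, so that the layers lie above
  -- the energy `τ`, where radii exceed `p`.
  let bump : ContDiffBump (1 / 2 : ℝ) := ⟨1 / 4, 1 / 2, by norm_num, by norm_num⟩
  let k : ℝ → ℝ := bump.normed volume
  have hks : ContDiff ℝ ∞ k := bump.contDiff_normed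
  have hk0 : ∀ s ∉ Ioo (0 : ℝ) 1, k s = 0 := by
    intro s hs
    by_contra h0
    have h1 : s ∈ Function.support (bump.normed volume) := h0
    rw [bump.support_normed_eq, Real.ball_eq_Ioo] at h1
    norm_num [bump] at h1
    exact hs h1
  have hk1 : ∫ s, k s = 1 := bump.integral_normed
  let w : ℝ → ℝ → ℝ := fun ε s ↦ ε⁻¹ * k ((s - τ) / ε)
  have hws : ∀ ε, ContDiff ℝ ∞ (w ε) := fun ε ↦
    contDiff_const.mul (hks.comp ((contDiff_id.sub contDiff_const).div_const ε))
  obtain ⟨C', hu⟩ := hΦ.lipschitzWith_orbitIntegral hN.pos.le hf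
  have hcpt : IsCompact ((fun p : ℝ × (Sp n × Sp n) ↦ Φ p.1 p.2) '' (Icc 0 T ×ˢ tsupport f)) :=
    (isCompact_Icc.prod hfc.isCompact).image (hΦ.flow.continuous hΦ.lipschitz)
  have huc : HasCompactSupport (orbitIntegral Φ T f) :=
    hcpt.of_isClosed_subset (isClosed_tsupport _)
      (hΦ.tsupport_orbitIntegral_subset hN.pos.le hfc)
  obtain ⟨Mf, hMf⟩ := hfc.exists_bound_of_continuous hf.continuous
  obtain ⟨Mu, hMu⟩ := huc.exists_bound_of_continuous hu.continuous
  have hMu0 : 0 ≤ Mu := (norm_nonneg _).trans (hMu 0)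
  obtain ⟨r, hr⟩ := huc.isCompact.isBounded.exists_norm_le
  let g : Sp n × Sp n → ℝ := fun q ↦ orbitIntegral Φ T f q * inner ℝ q.2 (outerNormal Ω q.1)
  have hgm : Measurable g := hu.continuous.measurable.mul
    (measurable_snd.inner ((measurable_outerNormal hΩ hΩs).comp measurable_fst))
  -- The normal extended by zero is only measurable in `x`, so `g` is continuous in `θ` alone, which
  -- is all the limit requires.
  have hgc : ∀ x, Continuous fun θ ↦ g (x, θ) := fun x ↦
    (hu.continuous.comp (Continuous.prodMk_right x)).mul (continuous_id.inner (continuous_const (y := outerNormal Ω x)))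
  have hg0 : ∀ q, q ∉ tsupport (orbitIntegral Φ T f) → g q = 0 := fun q hq ↦ by
    simp only [g, image_eq_zero_of_notMem_tsupport hq, zero_mul]
  have hgb : ∀ q, ‖g q‖ ≤ Mu * |r| := by
    intro q
    by_cases hq : q ∈ tsupport (orbitIntegral Φ T f)
    · rw [norm_mul]
      refine mul_le_mul (hMu q) ?_ (norm_nonneg _) hMu0
      refine (norm_inner_le_norm _ _).trans ?_
      calc ‖q.2‖ * ‖outerNormal Ω q.1‖ ≤ |r| * 1 :=
            mul_le_mul (((norm_snd_le q).trans (hr q hq)).trans (le_abs_self r))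
              (norm_outerNormal_le _ _) (norm_nonneg _) (abs_nonneg r)
        _ = |r| := mul_one _
    · rw [hg0 q hq, norm_zero]; positivity
  have hlim1 := tendsto_integral_thin_shell (m := (volume : Measure (Sp n)).restrict Ω) hn
    hφ.continuous hP0 hPA hks.continuous hk0 hk1 hf.continuous.measurable
    (fun x ↦ hf.continuous.comp (Continuous.prodMk_right x)) hMf
  have hlim2 := tendsto_integral_thin_shell (m := surfaceMeasure Ω) hn
    hφ.continuous hP0 hPA hks.continuous hk0 hk1 hgm hgc hgb
  refine tendsto_nhds_unique_of_eventuallyEq hlim1 hlim2 (Eventually.of_forall fun ε ↦ ?_)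
  have hwE : ContDiff ℝ ∞ fun q ↦ w ε (energy φ q) := (hws ε).comp (contDiff_energy hφ)
  -- The phase-space formula is used with `f · w_ε(H)`; it then remains to pull the weight out of
  -- the orbit integral.
  obtain ⟨C2, hfw⟩ := exists_lipschitzWith_mul_contDiff hf hfc hwE
  have hid := hN.integral_eq hΩ hΩb hΩs hc hF hY hΦ hfw hfc.mul_right
    ((tsupport_mul_subset_left).trans hfN)
  have hvol : (volume : Measure (Sp n × Sp n)).restrict (Ω ×ˢ univ) =
      ((volume : Measure (Sp n)).restrict Ω).prod volume := by
    rw [Measure.volume_eq_prod, ← Measure.prod_restrict, Measure.restrict_univ]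
  rw [hvol] at hid
  refine hid.trans ?_
  have hint : Integrable (fun q ↦ g q * w ε (energy φ q)) ((surfaceMeasure Ω).prod volume) := by
    obtain ⟨Mw, hMw⟩ := huc.isCompact.exists_bound_of_continuousOn hwE.continuous.continuousOn
    refine integrable_of_compact (hgm.mul hwE.continuous.measurable).aestronglyMeasurable
      huc.isCompact (isClosed_tsupport _) (M := Mu * |r| * Mw) (fun q hq ↦ ?_) fun q hq ↦ ?_
    · rw [norm_mul]
      exact mul_le_mul (hgb q) (hMw q hq) (norm_nonneg _) (by positivity)
    · rw [hg0 q hq, zero_mul]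
  refine Eq.trans ?_ (integral_prod_symm _ hint).symm
  refine integral_congr_ae (Eventually.of_forall fun θ ↦ ?_)
  refine setIntegral_congr_fun isClosed_frontier.measurableSet fun x hx ↦ ?_
  rw [hN.orbitIntegral_mul_energy hY (hφ.differentiable (by simp)) hΦ hfN (w ε) (q := (x, θ)) hx]
  simp only [g]
  ring

end ShellIdentity

/-! ### Local Lipschitz maps -/

section LipschitzAt

open Filter Topology

/-- `f` is Lipschitz on a neighbourhood of `x`. -/
def LipschitzNear {X Y : Type*} [PseudoMetricSpace X] [PseudoMetricSpace Y] (f : X → Y) (x : X) :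
    Prop :=
  ∃ C, ∃ t ∈ 𝓝 x, LipschitzOnWith C f t

namespace LipschitzNear

variable {X Y W : Type*} [PseudoMetricSpace X] [PseudoMetricSpace Y] [PseudoMetricSpace W]

theorem continuousAt {f : X → Y} {x : X} (hf : LipschitzNear f x) : ContinuousAt f x := by
  obtain ⟨C, t, ht, hC⟩ := hf
  exact hC.continuousOn.continuousAt ht

theorem comp {g : Y → W} {f : X → Y} {x : X} (hg : LipschitzNear g (f x)) (hf : LipschitzNear f x) :
    LipschitzNear (fun z ↦ g (f z)) x := by
  have hcont := hf.continuousAt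
  obtain ⟨C, t, ht, hC⟩ := hf
  obtain ⟨D, s, hs, hD⟩ := hg
  exact ⟨D * C, t ∩ f ⁻¹' s, inter_mem ht (hcont hs),
    hD.comp (hC.mono inter_subset_left) fun z hz ↦ hz.2⟩

theorem prodMk {g : X → W} {f : X → Y} {x : X} (hf : LipschitzNear f x) (hg : LipschitzNear g x) :
    LipschitzNear (fun z ↦ (f z, g z)) x := by
  obtain ⟨C, t, ht, hC⟩ := hf
  obtain ⟨D, s, hs, hD⟩ := hg
  exact ⟨max C D, t ∩ s, inter_mem ht hs,
    (hC.mono inter_subset_left).prodMk (hD.mono inter_subset_right)⟩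

theorem of_lipschitzWith {f : X → Y} {C : NNReal} (hf : LipschitzWith C f) (x : X) :
    LipschitzNear f x :=
  ⟨C, univ, univ_mem, hf.lipschitzOnWith⟩

theorem of_contDiffAt {E F : Type*} [NormedAddCommGroup E] [NormedSpace ℝ E]
    [NormedAddCommGroup F] [NormedSpace ℝ F] {f : E → F} {x : E} (hf : ContDiffAt ℝ 1 f x) :
    LipschitzNear f x :=
  hf.exists_lipschitzOnWith

end LipschitzNear

theorem IsGlobalFlow.lipschitzNear {E : Type*} [NormedAddCommGroup E] [NormedSpace ℝ E]
    {Z : E → E} {K M : NNReal} {Φ : ℝ → E → E} (hΦ : IsGlobalFlow Z Φ)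
    (hZ : LipschitzWith K Z) (hM : ∀ q, ‖Z q‖ ≤ M) (p : ℝ × E) :
    LipschitzNear (fun p : ℝ × E ↦ Φ p.1 p.2) p := by
  refine ⟨Real.toNNReal (M + Real.exp (K * (|p.1| + 1))), {z | |z.1| < |p.1| + 1}, ?_, ?_⟩
  · have : IsOpen {z : ℝ × E | |z.1| < |p.1| + 1} := isOpen_lt (by fun_prop) (by fun_prop)
    exact this.mem_nhds (show |p.1| < |p.1| + 1 by linarith)
  · refine LipschitzOnWith.of_dist_le_mul fun z hz z' _ ↦ ?_
    rw [Real.coe_toNNReal _ (by positivity)]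
    have h1 := hΦ.dist_le hZ z.1 z.2 z'.2
    have h2 := hΦ.dist_time_le hM z.1 z'.1 z'.2
    have h3 : dist z.1 z'.1 ≤ dist z z' := le_max_left _ _
    have h4 : dist z.2 z'.2 ≤ dist z z' := le_max_right _ _
    have h5 : Real.exp (K * |z.1|) ≤ Real.exp (K * (|p.1| + 1)) := by
      have : |z.1| ≤ |p.1| + 1 := le_of_lt hz
      gcongr
    calc dist (Φ z.1 z.2) (Φ z'.1 z'.2)
        ≤ dist (Φ z.1 z.2) (Φ z.1 z'.2) + dist (Φ z.1 z'.2) (Φ z'.1 z'.2) := dist_triangle _ _ _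
      _ ≤ dist z z' * Real.exp (K * (|p.1| + 1)) + M * dist z z' :=
          add_le_add (h1.trans (mul_le_mul h4 h5 (Real.exp_pos _).le dist_nonneg))
            (h2.trans (mul_le_mul_of_nonneg_left h3 M.2))
      _ = _ := by ring

end LipschitzAt

/-! ### Trajectories tangent to the boundary -/

section Glancing

open Filter Topology

variable {Ω : Set (Sp n)} {e : Sp n} {B : Set (Hyp e)} {a b : ℝ} {h : Hyp e → ℝ}
  {φ : Sp n → ℝ} {Y : Sp n → Matrix (Fin n) (Fin n) ℝ} {R τ : ℝ} {K M : NNReal}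
  {Z : Sp n × Sp n → Sp n × Sp n} {Φ : ℝ → Sp n × Sp n → Sp n × Sp n}

/-- The glancing part of the boundary of the energy shell. -/
def glancing (φ : Sp n → ℝ) (τ : ℝ) (Ω : Set (Sp n)) : Set (Sp n × Sp n) :=
  {q | q.1 ∈ frontier Ω ∧ ‖q.2‖ = speed φ τ q.1 ∧ inner ℝ q.2 (outerNormal Ω q.1) = 0}

theorem contDiff_speed (hφ : ContDiff ℝ ∞ φ) (hP0 : ∀ x, 0 < P φ τ x) :
    ContDiff ℝ ∞ (speed φ τ) := by
  have h1 : ContDiff ℝ ∞ (P φ τ) := contDiff_const.mul (contDiff_const.sub hφ)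
  exact h1.sqrt fun x ↦ (hP0 x).ne'

/-- The tangent vector to a graph over `w`. -/
def tangentVector (h : Hyp e → ℝ) (p : Hyp e × Hyp e) : Sp n := pt e p.2 (fderiv ℝ h p.1 p.2)

/-- The parametrization of glancing vectors. -/
def glancingVector (φ : Sp n → ℝ) (τ : ℝ) (h : Hyp e → ℝ) (p : Hyp e × Hyp e) : Sp n × Sp n :=
  (pt e p.1 (h p.1), (speed φ τ (pt e p.1 (h p.1)) / ‖tangentVector h p‖) • tangentVector h p)

theorem tangentVector_ne_zero (he : ‖e‖ = 1) {p : Hyp e × Hyp e} (hp : p.2 ≠ 0) :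
    tangentVector h p ≠ 0 := by
  intro h0
  have := (splitEquiv he).injective (a₁ := (p.2, fderiv ℝ h p.1 p.2)) (a₂ := 0)
    (by rw [map_zero]; exact h0)
  exact hp (congrArg Prod.fst this)

/-- The derivative of `h` enters, which costs one order: this is where charts of class `C²` are
needed. -/
theorem IsGraphChart.contDiffAt_glancingVector (hc : IsGraphChart Ω e B a b h)
    (hφ : ContDiff ℝ ∞ φ) (hP0 : ∀ x, 0 < P φ τ x) {p : Hyp e × Hyp e} (hp1 : p.1 ∈ B)
    (hp2 : p.2 ≠ 0) : ContDiffAt ℝ 1 (glancingVector φ τ h) p := by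
  have hh := hc.contDiffOn.contDiffAt (hc.isOpen.mem_nhds hp1)
  have hD : ContDiffAt ℝ 1 (fderiv ℝ h) p.1 := hh.fderiv_right (by norm_num)
  have hsp := (splitEquiv hc.norm_eq_one).contDiff (n := 1)
  have hv : ContDiffAt ℝ 1 (tangentVector h) p :=
    hsp.contDiffAt.comp p (contDiffAt_snd.prodMk
      ((hD.comp p contDiffAt_fst).clm_apply contDiffAt_snd))
  have hx : ContDiffAt ℝ 1 (fun p : Hyp e × Hyp e ↦ pt e p.1 (h p.1)) p :=
    hsp.contDiffAt.comp p (contDiffAt_fst.prodMk ((hh.of_le one_le_two).comp p contDiffAt_fst))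
  have hs : ContDiff ℝ 1 (speed φ τ) := (contDiff_speed hφ hP0).of_le (by simp)
  have hne := tangentVector_ne_zero (h := h) hc.norm_eq_one hp2
  exact hx.prodMk (((hs.contDiffAt.comp p hx).div (hv.norm ℝ hne) (norm_ne_zero_iff.2 hne)).smul hv)

/-- The parametrization of the cone over the trajectories through glancing vectors. -/
def glancingCone (φ : Sp n → ℝ) (τ : ℝ) (h : Hyp e → ℝ) (Φ : ℝ → Sp n × Sp n → Sp n × Sp n)
    (z : (Hyp e × Hyp e) × ℝ) : Sp n × Sp n :=
  ((Φ (-z.2) (glancingVector φ τ h z.1)).1, ‖z.1.2‖ • (Φ (-z.2) (glancingVector φ τ h z.1)).2)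

theorem IsGraphChart.lipschitzNear_glancingCone (hc : IsGraphChart Ω e B a b h)
    (hΦ : IsCutoffFlow (vectorField φ Y) R Z K M Φ)
    (hφ : ContDiff ℝ ∞ φ) (hP0 : ∀ x, 0 < P φ τ x) {z : (Hyp e × Hyp e) × ℝ} (hp1 : z.1.1 ∈ B)
    (hp2 : z.1.2 ≠ 0) : LipschitzNear (glancingCone φ τ h Φ) z := by
  have h1 : LipschitzNear (fun z : (Hyp e × Hyp e) × ℝ ↦ z.1) z :=
    .of_lipschitzWith LipschitzWith.prod_fst z
  have h2 : LipschitzNear (fun z : (Hyp e × Hyp e) × ℝ ↦ -z.2) z :=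
    .of_lipschitzWith LipschitzWith.prod_snd.neg z
  have h3 : LipschitzNear (fun z : (Hyp e × Hyp e) × ℝ ↦ glancingVector φ τ h z.1) z :=
    LipschitzNear.comp (g := glancingVector φ τ h) (f := fun z : (Hyp e × Hyp e) × ℝ ↦ z.1)
      (.of_contDiffAt (hc.contDiffAt_glancingVector hφ hP0 hp1 hp2)) h1
  have h4 : LipschitzNear (fun z : (Hyp e × Hyp e) × ℝ ↦ Φ (-z.2) (glancingVector φ τ h z.1)) z :=
    LipschitzNear.comp (g := fun p : ℝ × (Sp n × Sp n) ↦ Φ p.1 p.2)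
      (f := fun z : (Hyp e × Hyp e) × ℝ ↦ (-z.2, glancingVector φ τ h z.1))
      (hΦ.flow.lipschitzNear hΦ.lipschitz hΦ.norm_le _) (h2.prodMk h3)
  have h5 : LipschitzNear (fun z : (Hyp e × Hyp e) × ℝ ↦ ‖z.1.2‖) z :=
    .of_lipschitzWith (lipschitzWith_one_norm.comp
      (LipschitzWith.prod_snd.comp LipschitzWith.prod_fst)) z
  have h6 : ContDiff ℝ 1 fun p : ℝ × (Sp n × Sp n) ↦ (p.2.1, p.1 • p.2.2) := by fun_prop
  exact LipschitzNear.comp (g := fun p : ℝ × (Sp n × Sp n) ↦ (p.2.1, p.1 • p.2.2))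
    (f := fun z : (Hyp e × Hyp e) × ℝ ↦ (‖z.1.2‖, Φ (-z.2) (glancingVector φ τ h z.1)))
    (.of_contDiffAt h6.contDiffAt) (h5.prodMk h4)

/-- The parameters form a space of dimension `(n - 1) + (n - 1) + 1`, less than `2n`, and a locally
Lipschitz map does not raise Hausdorff dimension. -/
theorem IsGraphChart.volume_image_glancingCone (hn : 1 ≤ n) (hc : IsGraphChart Ω e B a b h)
    (hΦ : IsCutoffFlow (vectorField φ Y) R Z K M Φ)
    (hφ : ContDiff ℝ ∞ φ) (hP0 : ∀ x, 0 < P φ τ x) :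
    volume (glancingCone φ τ h Φ '' {z | z.1.1 ∈ B ∧ z.1.2 ≠ 0}) = 0 := by
  have hvolp : (volume : Measure (Sp n × Sp n)).IsAddHaarMeasure := by
    rw [Measure.volume_eq_prod]; infer_instance
  have hfr : Module.finrank ℝ (Sp n × Sp n) = n + n := by simp
  have hac : (volume : Measure (Sp n × Sp n)) ≪ Measure.hausdorffMeasure ((n + n : ℕ) : ℝ) := by
    have : (Measure.hausdorffMeasure ((n + n : ℕ) : ℝ) : Measure (Sp n × Sp n)).IsAddHaarMeasure := by
      rw [← hfr]; infer_instance
    exact Measure.absolutelyContinuous_isAddHaarMeasure _ _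
  have hdim : dimH (univ : Set ((Hyp e × Hyp e) × ℝ)) = ((n - 1 + (n - 1) + 1 : ℕ) : ENNReal) := by
    rw [Real.dimH_univ_eq_finrank, Module.finrank_prod, Module.finrank_prod,
      finrank_hyp hc.norm_eq_one, Module.finrank_self]
  refine measure_zero_of_dimH_lt (d := ((n + n : ℕ) : NNReal)) (by simpa using hac) ?_
  refine (dimH_image_le_of_locally_lipschitzOn fun z hz ↦ ?_).trans_lt
    ((dimH_mono (subset_univ _)).trans_lt ?_)
  · obtain ⟨C, t, ht, hC⟩ := hc.lipschitzNear_glancingCone hΦ hφ hP0 hz.1 hz.2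
    exact ⟨C, t, nhdsWithin_le_nhds ht, hC⟩
  · rw [hdim]
    have : n - 1 + (n - 1) + 1 < n + n := by omega
    exact_mod_cast this

end Glancing

/-! ### Glancing orbits form a null set -/

section GlancingNull

open Filter Topology

variable {Ω : Set (Sp n)} {e : Sp n} {B : Set (Hyp e)} {a b : ℝ} {h : Hyp e → ℝ}
  {φ : Sp n → ℝ} {Y : Sp n → Matrix (Fin n) (Fin n) ℝ} {R τ : ℝ} {K M : NNReal}
  {Z : Sp n × Sp n → Sp n × Sp n} {Φ : ℝ → Sp n × Sp n → Sp n × Sp n}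

theorem isCompact_glancing (hΩ : IsOpen Ω) (hΩb : Bornology.IsBounded Ω)
    (hΩs : HasSmoothBoundary Ω) (hφ : Continuous φ) : IsCompact (glancing φ τ Ω) := by
  have hK : IsCompact (frontier Ω) := Metric.isCompact_of_isClosed_isBounded isClosed_frontier
    (hΩb.closure.subset frontier_subset_closure)
  have hs : Continuous (speed φ τ) := by unfold speed P; fun_prop
  obtain ⟨A, hA⟩ := hK.exists_bound_of_continuousOn hs.continuousOn
  refine (hK.prod (isCompact_closedBall (0 : Sp n) A)).of_isClosed_subset ?_ fun q hq ↦ ?_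
  · have h1 : IsClosed {q : Sp n × Sp n | q.1 ∈ frontier Ω} := isClosed_frontier.preimage continuous_fst
    have h2 : IsClosed {q : Sp n × Sp n | ‖q.2‖ = speed φ τ q.1} :=
      isClosed_eq (by fun_prop) (by fun_prop)
    have h3 : ContinuousOn (fun q : Sp n × Sp n ↦ inner ℝ q.2 (outerNormal Ω q.1))
        {q : Sp n × Sp n | q.1 ∈ frontier Ω} :=
      continuousOn_snd.inner ((continuousOn_outerNormal hΩ hΩs).comp continuousOn_fst fun q hq ↦ hq)
    have h4 := h2.inter (h3.preimage_isClosed_of_isClosed h1 (isClosed_singleton (x := (0 : ℝ))))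
    convert h4 using 1
    ext q
    simp only [glancing, mem_ofPred_eq, mem_inter_iff, mem_preimage, mem_singleton_iff]
    tauto
  · refine ⟨hq.1, mem_closedBall_zero_iff.2 ?_⟩
    rw [hq.2.1]
    exact (le_abs_self _).trans (hA _ hq.1)

/-- The vectors whose trajectory meets the boundary tangentially. -/
def glancingOrbits (φ : Sp n → ℝ) (τ : ℝ) (Ω : Set (Sp n))
    (Φ : ℝ → Sp n × Sp n → Sp n × Sp n) : Set (Sp n × Sp n) :=
  {q | ∃ t, Φ t q ∈ glancing φ τ Ω}

/-- Reversing the flow presents the set as a countable union of compact images of `[-k, k] ×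
glancing`. -/
theorem IsCutoffFlow.measurableSet_glancingOrbits (hΦ : IsCutoffFlow (vectorField φ Y) R Z K M Φ)
    (hΩ : IsOpen Ω) (hΩb : Bornology.IsBounded Ω)
    (hΩs : HasSmoothBoundary Ω) (hφ : Continuous φ) :
    MeasurableSet (glancingOrbits φ τ Ω Φ) := by
  have heq : glancingOrbits φ τ Ω Φ = ⋃ k : ℕ, (fun p : ℝ × (Sp n × Sp n) ↦ Φ p.1 p.2) ''
      (Icc (-(k : ℝ)) k ×ˢ glancing φ τ Ω) := by
    ext q
    simp only [glancingOrbits, mem_ofPred_eq, mem_iUnion]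
    constructor
    · rintro ⟨t, ht⟩
      obtain ⟨k, hk⟩ := exists_nat_ge |t|
      refine ⟨k, (-t, Φ t q), ⟨?_, ht⟩, hΦ.flow.neg_self hΦ.lipschitz t q⟩
      have := abs_le.1 hk
      exact ⟨by linarith, by linarith⟩
    · rintro ⟨k, ⟨s, b⟩, ⟨-, hb⟩, rfl⟩
      exact ⟨-s, by rwa [hΦ.flow.neg_self hΦ.lipschitz]⟩
  rw [heq]
  exact MeasurableSet.iUnion fun k ↦ ((isCompact_Icc.prod
    (isCompact_glancing hΩ hΩb hΩs hφ)).image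
      (hΦ.flow.continuous hΦ.lipschitz)).isClosed.measurableSet

/-- Letting the length of the velocity vary freely turns a statement about the shell into one about
Lebesgue measure on phase space. Finitely many charts cover `∂Ω`, and in each one the cone is
contained in the image of `glancingCone`. -/
theorem IsCutoffFlow.volume_cone_glancingOrbits (hn : 1 ≤ n)
    (hΦ : IsCutoffFlow (vectorField φ Y) R Z K M Φ)
    (hΩ : IsOpen Ω) (hΩb : Bornology.IsBounded Ω) (hΩs : HasSmoothBoundary Ω)
    (hφ : ContDiff ℝ ∞ φ) (hP0 : ∀ x, 0 < P φ τ x) :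
    volume {q : Sp n × Sp n | q.2 ≠ 0 ∧
      (q.1, (speed φ τ q.1 / ‖q.2‖) • q.2) ∈ glancingOrbits φ τ Ω Φ} = 0 := by
  have hp : ∀ x, 0 < speed φ τ x := fun x ↦ Real.sqrt_pos.2 (hP0 x)
  have hK : IsCompact (frontier Ω) := Metric.isCompact_of_isClosed_isBounded isClosed_frontier
    (hΩb.closure.subset frontier_subset_closure)
  have hloc : ∀ x ∈ frontier Ω, ∃ V, IsOpen V ∧ x ∈ V ∧ volume {q : Sp n × Sp n | q.2 ≠ 0 ∧
      ∃ t, Φ t (q.1, (speed φ τ q.1 / ‖q.2‖) • q.2) ∈ glancing φ τ Ω ∧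
        (Φ t (q.1, (speed φ τ q.1 / ‖q.2‖) • q.2)).1 ∈ V} = 0 := by
    intro x hx
    obtain ⟨e, B, a, b, h, hc, hxb⟩ := exists_isGraphChart hΩs hx
    have he := hc.norm_eq_one
    refine ⟨box e B a b, isOpen_box he hc.isOpen a b, hxb,
      measure_mono_null ?_ (hc.volume_image_glancingCone hn hΦ hφ hP0)⟩
    rintro ⟨x', θ⟩ ⟨hθ, t, hg, hbox⟩
    obtain ⟨y, hy, hyx⟩ := (hc.box_inter_frontier hΩ).subset ⟨hbox, hg.1⟩
    set β := Φ t (x', (speed φ τ x' / ‖θ‖) • θ) with hβ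
    obtain ⟨⟨w, s⟩, hws⟩ := (splitEquiv he).surjective β.2
    rw [splitEquiv_apply] at hws
    have hnor := hc.normal y hy w s
    beta_reduce at hyx
    have hg2 := hg.2.2
    dsimp only at hws
    rw [← hyx, ← hws] at hg2
    rw [hg2, mul_zero, eq_comm, sub_eq_zero] at hnor
    -- Tangency forces the vertical component `s` of `β.2` to be `Dh(y) w`, so `β.2` is the tangent
    -- vector over `w`.
    have htv : ∀ c : ℝ, tangentVector h (y, c • w) = c • β.2 := by
      intro c
      have := map_smul (splitEquiv he) c (w, s)
      rw [splitEquiv_apply, splitEquiv_apply] at this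
      rw [← hws, ← this, tangentVector, map_smul, hnor]
      rfl
    have hβpos : 0 < ‖β.2‖ := by rw [hg.2.1]; exact hp _
    have hw : w ≠ 0 := by
      rintro rfl
      have := htv 1
      rw [smul_zero, one_smul] at this
      refine hβpos.ne' ?_
      rw [← this, tangentVector]
      simp [pt]
    have hwn : 0 < ‖w‖ := norm_pos_iff.2 hw
    have hθn : 0 < ‖θ‖ := norm_pos_iff.2 hθ
    set l := ‖θ‖ / speed φ τ x' with hl
    have hl0 : 0 < l := div_pos hθn (hp x')
    have hc0 : 0 < l / ‖w‖ := div_pos hl0 hwn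
    -- The direction of `w` determines the glancing vector. Its length is free and is set to `l =
    -- ‖θ‖ / p`, the factor that rescales the shell velocity back to `θ`.
    refine ⟨((y, (l / ‖w‖) • w), t), ⟨hy, smul_ne_zero hc0.ne' hw⟩, ?_⟩
    have hgv : glancingVector φ τ h (y, (l / ‖w‖) • w) = β := by
      refine Prod.ext hyx ?_
      change (speed φ τ (pt e y (h y)) / ‖tangentVector h (y, (l / ‖w‖) • w)‖) •
        tangentVector h (y, (l / ‖w‖) • w) = β.2
      rw [hyx, htv, norm_smul, Real.norm_of_nonneg hc0.le, hg.2.1, smul_smul]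
      have := (hp β.1).ne'
      rw [show speed φ τ β.1 / (l / ‖w‖ * speed φ τ β.1) * (l / ‖w‖) = 1 by field_simp, one_smul]
    rw [glancingCone, hgv, hβ, hΦ.flow.neg_self hΦ.lipschitz]
    refine Prod.ext rfl ?_
    change ‖(l / ‖w‖) • w‖ • (speed φ τ x' / ‖θ‖) • θ = θ
    rw [norm_smul, Real.norm_of_nonneg hc0.le, smul_smul, div_mul_cancel₀ _ hwn.ne', hl]
    have := (hp x').ne'
    rw [show ‖θ‖ / speed φ τ x' * (speed φ τ x' / ‖θ‖) = 1 by field_simp, one_smul]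
  choose! V hVo hxV hV0 using hloc
  obtain ⟨t, ht, hcov⟩ := hK.elim_nhds_subcover V fun x hx ↦ (hVo x hx).mem_nhds (hxV x hx)
  refine measure_mono_null ?_ ((measure_biUnion_null_iff t.countable_toSet).2 fun x hx ↦
    hV0 x (ht x hx))
  rintro q ⟨hq, s, hs⟩
  obtain ⟨x, hx, hxV'⟩ := mem_iUnion₂.1 (hcov hs.1)
  exact mem_iUnion₂.2 ⟨x, hx, hq, s, hs, hxV'⟩

/-- Almost every trajectory meets the boundary transversally. -/
theorem IsCutoffFlow.phaseMeasure_glancingOrbits (hn : 1 ≤ n)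
    (hΦ : IsCutoffFlow (vectorField φ Y) R Z K M Φ)
    (hΩ : IsOpen Ω) (hΩb : Bornology.IsBounded Ω) (hΩs : HasSmoothBoundary Ω)
    (hφ : ContDiff ℝ ∞ φ) (hP0 : ∀ x, 0 < P φ τ x) :
    phaseMeasure φ τ Ω (glancingOrbits φ τ Ω Φ) = 0 := by
  have hp : ∀ x, 0 < speed φ τ x := fun x ↦ Real.sqrt_pos.2 (hP0 x)
  have hpc : Continuous (speed φ τ) := (contDiff_speed hφ hP0).continuous
  have hΓ := hΦ.measurableSet_glancingOrbits (τ := τ) hΩ hΩb hΩs hφ.continuous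
  have hv : Measurable fun z : Sp n × Metric.sphere (0 : Sp n) 1 ↦
      (z.1, speed φ τ z.1 • (z.2 : Sp n)) :=
    measurable_fst.prodMk ((hpc.measurable.comp measurable_fst).smul
      (measurable_subtype_coe.comp measurable_snd))
  rw [phaseMeasure, bundleMeasure, Measure.map_apply hv hΓ]
  refine withDensity_absolutelyContinuous _ _ ?_
  rw [Measure.measure_prod_null (hv hΓ)]
  have hcone := hΦ.volume_cone_glancingOrbits hn hΩ hΩb hΩs hφ hP0
  rw [Measure.volume_eq_prod] at hcone
  refine ae_restrict_of_ae ?_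
  filter_upwards [Measure.measure_ae_null_of_prod_null hcone] with x hx
  -- The measure of a subset of the unit sphere is, up to a constant, the volume of the cone over
  -- it, and that cone lies in the null set just found.
  rw [Pi.zero_apply, Measure.toSphere_apply' _ ((hv hΓ).preimage measurable_prodMk_left)]
  rw [measure_mono_null ?_ hx, mul_zero]
  rintro _ ⟨r, hr, _, ⟨v, hv, rfl⟩, rfl⟩
  have hvn : ‖(v : Sp n)‖ = 1 := by simp
  have hv0 : (v : Sp n) ≠ 0 := by rw [← norm_ne_zero_iff, hvn]; exact one_ne_zero
  refine ⟨smul_ne_zero hr.1.ne' hv0, ?_⟩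
  have : (speed φ τ x / ‖r • (v : Sp n)‖) • r • (v : Sp n) = speed φ τ x • (v : Sp n) := by
    rw [norm_smul, hvn, mul_one, Real.norm_of_nonneg hr.1.le, smul_smul, div_mul_cancel₀ _ hr.1.ne']
  change (x, (speed φ τ x / ‖r • (v : Sp n)‖) • r • (v : Sp n)) ∈ glancingOrbits φ τ Ω Φ
  rw [this]
  exact hv

end GlancingNull

/-! ### Trajectories in the domain and the global flow -/

section Trajectories

open Filter Topology

variable {Ω : Set (Sp n)} {φ : Sp n → ℝ} {Y : Sp n → Matrix (Fin n) (Fin n) ℝ} {R τ : ℝ}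
  {K M : NNReal} {Z : Sp n × Sp n → Sp n × Sp n} {Φ : ℝ → Sp n × Sp n → Sp n × Sp n}

theorem mem_shell_iff (hP0 : ∀ x, 0 < P φ τ x) {A : Set (Sp n)} {q : Sp n × Sp n} :
    q ∈ shell φ τ A ↔ q.1 ∈ A ∧ energy φ q = τ := by
  refine ⟨fun h ↦ ⟨h.1, h.2.2⟩, fun h ↦ ⟨h.1, fun h0 ↦ ?_, h.2⟩⟩
  have h1 := h.2
  have h2 := hP0 q.1
  rw [energy, h0, norm_zero] at h1
  rw [P] at h2
  linarith

theorem energy_eq_iff (hP0 : ∀ x, 0 < P φ τ x) {q : Sp n × Sp n} :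
    energy φ q = τ ↔ ‖q.2‖ = speed φ τ q.1 := by
  rw [speed, eq_comm (a := ‖q.2‖), Real.sqrt_eq_iff_mul_self_eq (hP0 _).le (norm_nonneg _), energy, P,
    ← sq]
  constructor <;> intro h <;> linarith

variable (hΦ : IsCutoffFlow (vectorField φ Y) R Z K M Φ) (hφ : Differentiable ℝ φ)
  (hY : ∀ x ∈ closure Ω, (Y x).transpose = -Y x) (hP0 : ∀ x, 0 < P φ τ x)
  (hR : ∀ q ∈ shell φ τ (closure Ω), ‖q‖ < R)

include hΦ hφ hY hP0 hR

/-- Conservation of energy keeps the trajectory on the shell, hence in the ball where the cutoff is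
inactive. It therefore solves the cutoff equation, whose solutions are unique. -/
theorem IsTrajectory.eqOn {q : Sp n × Sp n} (hq : q ∈ shell φ τ (closure Ω)) {t : ℝ}
    {c : ℝ → Sp n × Sp n} (hc : IsTrajectory φ Y Ω q t c) :
    EqOn c (fun s ↦ Φ s q) (uIcc 0 t) := by
  obtain ⟨hc0, hci, hcΩ⟩ := hc
  have hder : ∀ s ∈ uIcc 0 t, HasDerivWithinAt c (vectorField φ Y (c s)) (uIcc 0 t) s := hci
  have hen : ∀ s ∈ uIcc 0 t, energy φ (c s) = τ := fun s hs ↦ by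
    have := energy_eq_of_hasDerivWithinAt (φ := φ) (Y := Y) hφ (κ := fun _ ↦ 1)
      (fun s hs ↦ by rw [one_smul]; exact hder s hs) (fun s hs ↦ hY _ (hcΩ s hs)) hs
    rw [this, hc0, hq.2.2]
  rw [← hc0]
  refine hΦ.flow.eqOn_uIcc hΦ.lipschitz fun s hs ↦ ?_
  rw [hΦ.eq _ (hR _ ((mem_shell_iff hP0).2 ⟨hcΩ s hs, hen s hs⟩))]
  exact hder s hs

omit hR in
theorem mem_shell_of_forall_mem {q : Sp n × Sp n} (hq : q ∈ shell φ τ (closure Ω)) {t : ℝ}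
    (ht : ∀ s ∈ uIcc 0 t, (Φ s q).1 ∈ closure Ω) : Φ t q ∈ shell φ τ (closure Ω) :=
  (mem_shell_iff hP0).2 ⟨ht t right_mem_uIcc, (hΦ.energy_eq hφ hY ht).trans hq.2.2⟩

theorem isTrajectory_of_forall_mem {q : Sp n × Sp n} (hq : q ∈ shell φ τ (closure Ω)) {t : ℝ}
    (ht : ∀ s ∈ uIcc 0 t, (Φ s q).1 ∈ closure Ω) : IsTrajectory φ Y Ω q t fun s ↦ Φ s q := by
  refine ⟨hΦ.flow.zero q, fun s hs ↦ ?_, ht⟩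
  have hs' : Φ s q ∈ shell φ τ (closure Ω) :=
    mem_shell_of_forall_mem hΦ hφ hY hP0 hq fun r hr ↦
      ht r (uIcc_subset_uIcc left_mem_uIcc hs hr)
  have := (hΦ.flow.hasDerivAt q s).hasDerivWithinAt (s := uIcc 0 t)
  rw [hΦ.eq _ (hR _ hs')] at this
  exact this

theorem flow_eq {q : Sp n × Sp n} (hq : q ∈ shell φ τ (closure Ω)) {t : ℝ}
    (ht : ∀ s ∈ uIcc 0 t, (Φ s q).1 ∈ closure Ω) : flow φ Y Ω q t = Φ t q := by
  have hex : ∃ c, IsTrajectory φ Y Ω q t c :=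
    ⟨_, isTrajectory_of_forall_mem hΦ hφ hY hP0 hR hq ht⟩
  rw [flow, dif_pos hex]
  exact hex.choose_spec.eqOn hΦ hφ hY hP0 hR hq right_mem_uIcc

theorem mem_backwardTimes_iff {q : Sp n × Sp n} (hq : q ∈ shell φ τ (closure Ω)) {t : ℝ} :
    t ∈ backwardTimes φ Y Ω q ↔ t ≤ 0 ∧ ∀ s ∈ Ioo t 0, (Φ s q).1 ∈ Ω := by
  constructor
  · rintro ⟨ht, c, hc, hcΩ⟩
    refine ⟨ht, fun s hs ↦ ?_⟩
    have h1 := hc.eqOn hΦ hφ hY hP0 hR hq (x := s) (by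
      rw [uIcc_of_ge ht]; exact Ioo_subset_Icc_self hs)
    beta_reduce at h1
    rw [← h1]
    exact hcΩ s hs
  · rintro ⟨ht, hΩ⟩
    refine ⟨ht, _, isTrajectory_of_forall_mem hΦ hφ hY hP0 hR hq fun s hs ↦ ?_, hΩ⟩
    rw [uIcc_of_ge ht] at hs
    rcases ht.eq_or_lt with rfl | ht'
    · have : s = 0 := le_antisymm hs.2 hs.1
      rw [this, hΦ.flow.zero]; exact hq.1
    · rw [← closure_Ioo ht'.ne] at hs
      have hxc : Continuous fun t ↦ (Φ t q).1 :=
        continuous_fst.comp (hΦ.flow.continuous_time q)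
      exact map_mem_closure (f := fun t ↦ (Φ t q).1) hxc hs hΩ

theorem mem_forwardTimes_of {q : Sp n × Sp n} (hq : q ∈ shell φ τ (closure Ω)) {t : ℝ}
    (ht : 0 ≤ t) (hΩ : ∀ s ∈ Icc 0 t, (Φ s q).1 ∈ Ω) : t ∈ forwardTimes φ Y Ω q := by
  refine ⟨ht, _, isTrajectory_of_forall_mem hΦ hφ hY hP0 hR hq fun s hs ↦ ?_,
    fun s hs ↦ hΩ s (Ioo_subset_Icc_self hs)⟩
  rw [uIcc_of_le ht] at hs
  exact subset_closure (hΩ s hs)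

/-- The backward trajectory of `q` in `Ω` is defined on `(ℓ₋(q), 0)`. -/
theorem ae_mem_Ioc_ellMinus_iff {q : Sp n × Sp n} (hq : q ∈ shell φ τ (closure Ω))
    (hb : BddBelow (backwardTimes φ Y Ω q)) :
    ∀ᵐ s : ℝ, s ∈ Ioc (ellMinus φ Y Ω q) 0 ↔ s < 0 ∧ ∀ s' ∈ Ico s 0, (Φ s' q).1 ∈ Ω := by
  have h0 : (0 : ℝ) ∈ backwardTimes φ Y Ω q :=
    (mem_backwardTimes_iff hΦ hφ hY hP0 hR hq).2 ⟨le_rfl, fun s hs ↦ absurd (hs.1.trans hs.2) (lt_irrefl _)⟩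
  -- The two times `0` and `ℓ₋` are discarded; at them the two conditions may differ.
  filter_upwards [compl_mem_ae_iff.2 (measure_singleton (0 : ℝ)),
    compl_mem_ae_iff.2 (measure_singleton (ellMinus φ Y Ω q))] with s hs1 hs2
  constructor
  · rintro ⟨h1, h2⟩
    refine ⟨h2.lt_of_ne hs1, fun s' hs' ↦ ?_⟩
    obtain ⟨t, ht, hts⟩ := exists_lt_of_csInf_lt ⟨0, h0⟩ h1
    exact ((mem_backwardTimes_iff hΦ hφ hY hP0 hR hq).1 ht).2 s' ⟨hts.trans_le hs'.1, hs'.2⟩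
  · rintro ⟨h1, h2⟩
    refine ⟨lt_of_le_of_ne (csInf_le hb ?_) (Ne.symm hs2), h1.le⟩
    exact (mem_backwardTimes_iff hΦ hφ hY hP0 hR hq).2
      ⟨h1.le, fun s' hs' ↦ h2 s' (Ioo_subset_Ico_self hs')⟩

/-- The exit point of a trajectory that starts in `Ω`. -/
theorem exists_exit (hΩ : IsOpen Ω) {q : Sp n × Sp n} (hq : q ∈ shell φ τ Ω)
    (hb : BddAbove (forwardTimes φ Y Ω q)) :
    ∃ T > 0, (∀ t ∈ Ico 0 T, (Φ t q).1 ∈ Ω) ∧ (Φ T q).1 ∈ frontier Ω ∧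
      ∀ t ∈ Icc 0 T, Φ t q ∈ shell φ τ (closure Ω) := by
  have hq' : q ∈ shell φ τ (closure Ω) := ⟨subset_closure hq.1, hq.2⟩
  have hxc : Continuous fun t ↦ (Φ t q).1 := continuous_fst.comp (hΦ.flow.continuous_time q)
  let S : Set ℝ := {t | 0 ≤ t ∧ (Φ t q).1 ∉ Ω}
  have hSc : IsClosed S := isClosed_Ici.inter (hΩ.isClosed_compl.preimage hxc)
  have hSb : BddBelow S := ⟨0, fun t ht ↦ ht.1⟩
  have hSn : S.Nonempty := by
    by_contra hne
    rw [not_nonempty_iff_eq_empty] at hne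
    obtain ⟨u, hu⟩ := hb
    -- If the trajectory never left `Ω`, then `|u| + 1` would be a forward time above the bound `u`.
    have h1 : |u| + 1 ∈ forwardTimes φ Y Ω q :=
      mem_forwardTimes_of hΦ hφ hY hP0 hR hq' (by positivity) fun s hs ↦ by
        by_contra hsΩ
        have : s ∈ S := ⟨hs.1, hsΩ⟩
        rw [hne] at this
        exact this
    linarith [hu h1, le_abs_self u]
  have hTS : sInf S ∈ S := hSc.csInf_mem hSn hSb
  have hbefore : ∀ t ∈ Ico 0 (sInf S), (Φ t q).1 ∈ Ω := fun t ht ↦ by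
    by_contra htΩ
    exact (csInf_le hSb ⟨ht.1, htΩ⟩).not_gt ht.2
  have hT : 0 < sInf S := hTS.1.lt_of_ne fun h0 ↦ hTS.2 (by rw [← h0, hΦ.flow.zero]; exact hq.1)
  have hcl : ∀ t ∈ Icc 0 (sInf S), (Φ t q).1 ∈ closure Ω := fun t ht ↦ by
    rw [← closure_Ico hT.ne] at ht
    exact map_mem_closure (f := fun t ↦ (Φ t q).1) hxc ht hbefore
  refine ⟨sInf S, hT, hbefore, ?_, fun t ht ↦ ?_⟩
  · rw [hΩ.frontier_eq]
    exact ⟨hcl _ ⟨hT.le, le_rfl⟩, hTS.2⟩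
  · refine mem_shell_of_forall_mem hΦ hφ hY hP0 hq' fun s hs ↦ ?_
    rw [uIcc_of_le ht.1] at hs
    exact hcl s ⟨hs.1, hs.2.trans ht.2⟩

omit hφ hY hP0 hR in
-- The height is negative before the exit and zero at it, so its left difference quotients are
-- nonnegative. A zero limit means tangency and can be excluded only off the glancing orbits.
theorem inner_outerNormal_nonneg_of_exit (hΩ : IsOpen Ω) (hΩs : HasSmoothBoundary Ω)
    {q : Sp n × Sp n} {T : ℝ} (hT : 0 < T) (hin : ∀ t ∈ Ico 0 T, (Φ t q).1 ∈ Ω)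
    (hout : (Φ T q).1 ∈ frontier Ω) (hTR : ‖Φ T q‖ < R) :
    0 ≤ inner ℝ (Φ T q).2 (outerNormal Ω (Φ T q).1) := by
  obtain ⟨e, B, a, b, h, hc, hxb⟩ := exists_isGraphChart hΩs hout
  obtain ⟨c, hc0, hcd⟩ := hc.fderiv_height hΩ hxb hout
  have hder := hΦ.hasDerivAt_height hc hxb hTR
  rw [hcd] at hder
  have hlim := (hasDerivWithinAt_iff_tendsto_slope' (s := Iio T) (by simp)).1
    hder.hasDerivWithinAt
  have hxc : Continuous fun t ↦ (Φ t q).1 := continuous_fst.comp (hΦ.flow.continuous_time q)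
  have hbox : ∀ᶠ t in 𝓝[<] T, (Φ t q).1 ∈ box e B a b := nhdsWithin_le_nhds
    (hxc.continuousAt.eventually ((isOpen_box hc.norm_eq_one hc.isOpen a b).mem_nhds hxb))
  have hnn : 0 ≤ c * inner ℝ (Φ T q).2 (outerNormal Ω (Φ T q).1) := by
    refine ge_of_tendsto hlim ?_
    filter_upwards [hbox, Ico_mem_nhdsLT hT] with t ht1 ht2
    have h1 := (hc.mem_iff_height ht1).1 (hin t ht2)
    have h2 := (hc.mem_frontier_iff_height hΩ hxb).1 hout
    rw [slope_def_field, h2, sub_zero]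
    exact div_nonneg_of_nonpos h1.le (by linarith [ht2.2])
  exact nonneg_of_mul_nonneg_right hnn hc0

end Trajectories

/-! ### Measures on the shell and the backward domain -/

section Measures

open Filter Topology

variable {Ω : Set (Sp n)} {φ : Sp n → ℝ} {Y : Sp n → Matrix (Fin n) (Fin n) ℝ} {R τ A c : ℝ}
  {K M : NNReal} {Z : Sp n × Sp n → Sp n × Sp n} {Φ : ℝ → Sp n × Sp n → Sp n × Sp n}
  {m : Measure (Sp n)}

theorem continuous_speed (hφ : Continuous φ) : Continuous (speed φ τ) := by
  unfold speed P; fun_prop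

theorem measurable_bundleMap (hφ : Continuous φ) :
    Measurable fun z : Sp n × Metric.sphere (0 : Sp n) 1 ↦ (z.1, speed φ τ z.1 • (z.2 : Sp n)) :=
  measurable_fst.prodMk (((continuous_speed hφ).measurable.comp measurable_fst).smul
    (measurable_subtype_coe.comp measurable_snd))

theorem isFiniteMeasure_bundleMeasure [IsFiniteMeasure m] (hPA : ∀ x, P φ τ x ≤ A) :
    IsFiniteMeasure (bundleMeasure φ τ m) := by
  rw [bundleMeasure]
  have : IsFiniteMeasure ((m.prod (volume : Measure (Sp n)).toSphere).withDensity
      fun r ↦ ENNReal.ofReal (speed φ τ r.1 ^ (n - 1))) := by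
    refine isFiniteMeasure_withDensity (ne_of_lt ?_)
    refine (lintegral_mono (g := fun _ ↦ ENNReal.ofReal (√A ^ (n - 1))) fun r ↦ ?_).trans_lt ?_
    · exact ENNReal.ofReal_le_ofReal (pow_le_pow_left₀ (Real.sqrt_nonneg _)
        (Real.sqrt_le_sqrt (hPA _)) _)
    · rw [lintegral_const]
      exact ENNReal.mul_lt_top ENNReal.ofReal_lt_top (measure_lt_top _ _)
  exact Measure.isFiniteMeasure_map _ _

theorem measurableSet_shell (hφ : Continuous φ) {S : Set (Sp n)} (hS : MeasurableSet S) :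
    MeasurableSet (shell φ τ S) := by
  have h1 : Continuous (energy φ) := by unfold energy; fun_prop
  exact (measurable_fst hS).inter (((measurable_snd (measurableSet_singleton 0)).compl).inter
    (h1.measurable (measurableSet_singleton τ)))

theorem measurableSet_outgoing (hΩ : IsOpen Ω) (hΩs : HasSmoothBoundary Ω) (hφ : Continuous φ) :
    MeasurableSet (outgoing φ τ Ω) :=
  (measurableSet_shell hφ isClosed_frontier.measurableSet).inter
    (measurableSet_lt (f := fun _ ↦ (0 : ℝ)) (g := fun q : Sp n × Sp n ↦
      inner ℝ q.2 (outerNormal Ω q.1)) measurable_const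
      (measurable_snd.inner ((measurable_outerNormal hΩ hΩs).comp measurable_fst)))

theorem ae_bundleMeasure_mem_shell [SFinite m] (hφ : Continuous φ) (hP0 : ∀ x, 0 < P φ τ x)
    {S : Set (Sp n)} (hS : MeasurableSet S) (hm : ∀ᵐ x ∂m, x ∈ S) :
    ∀ᵐ q ∂bundleMeasure φ τ m, q ∈ shell φ τ S := by
  refine (ae_map_iff (measurable_bundleMap hφ).aemeasurable (measurableSet_shell hφ hS)).2 ?_
  refine (withDensity_absolutelyContinuous _ _).ae_le ?_
  filter_upwards [Measure.quasiMeasurePreserving_fst.ae hm] with z hz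
  refine (mem_shell_iff hP0 (q := (z.1, speed φ τ z.1 • (z.2 : Sp n)))).2 ⟨hz, (energy_eq_iff hP0).2 ?_⟩
  dsimp only
  rw [norm_smul, Real.norm_of_nonneg (show 0 ≤ speed φ τ z.1 from Real.sqrt_nonneg _)]
  simp

theorem measurable_density (hφ : Continuous φ) :
    Measurable fun q : Sp n × Sp n ↦ ENNReal.ofReal (speed φ τ q.1)⁻¹ :=
  (((continuous_speed hφ).measurable.comp measurable_fst).inv).ennreal_ofReal

theorem isFiniteMeasure_withDensity_inv_speed {μ : Measure (Sp n × Sp n)} [IsFiniteMeasure μ]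
    (hc : 0 < c) (hPc : ∀ x, c ≤ P φ τ x) :
    IsFiniteMeasure (μ.withDensity fun q ↦ ENNReal.ofReal (speed φ τ q.1)⁻¹) := by
  refine isFiniteMeasure_withDensity (ne_of_lt ?_)
  refine (lintegral_mono (g := fun _ ↦ ENNReal.ofReal (√c)⁻¹) fun r ↦ ?_).trans_lt ?_
  · exact ENNReal.ofReal_le_ofReal (inv_anti₀ (Real.sqrt_pos.2 hc) (Real.sqrt_le_sqrt (hPc _)))
  · rw [lintegral_const]
    exact ENNReal.mul_lt_top ENNReal.ofReal_lt_top (measure_lt_top _ _)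

theorem isFiniteMeasure_xiMeasure (hΩ : IsOpen Ω) (hΩb : Bornology.IsBounded Ω)
    (hΩs : HasSmoothBoundary Ω) (hφ : Continuous φ) (hP0 : ∀ x, 0 < P φ τ x)
    (hPA : ∀ x, P φ τ x ≤ A) : IsFiniteMeasure (xiMeasure φ τ Ω) := by
  have := isFiniteMeasure_surfaceMeasure hΩ hΩb hΩs
  have := isFiniteMeasure_bundleMeasure (m := surfaceMeasure Ω) hPA
  refine isFiniteMeasure_withDensity (ne_of_lt ?_)
  refine (lintegral_mono_ae (g := fun _ ↦ ENNReal.ofReal √A) ?_).trans_lt ?_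
  · filter_upwards [ae_restrict_mem (measurableSet_outgoing hΩ hΩs hφ)] with q hq
    refine ENNReal.ofReal_le_ofReal ((real_inner_le_norm _ _).trans ?_)
    rw [(energy_eq_iff hP0).1 hq.1.2.2]
    calc speed φ τ q.1 * ‖outerNormal Ω q.1‖ ≤ √A * 1 :=
          mul_le_mul (Real.sqrt_le_sqrt (hPA _)) (norm_outerNormal_le _ _) (norm_nonneg _)
            (Real.sqrt_nonneg _)
      _ = √A := mul_one _
  · rw [lintegral_const]
    exact ENNReal.mul_lt_top ENNReal.ofReal_lt_top (measure_lt_top _ _)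

theorem ae_xiMeasure_mem_outgoing (hΩ : IsOpen Ω) (hΩs : HasSmoothBoundary Ω)
    (hφ : Continuous φ) : ∀ᵐ q ∂xiMeasure φ τ Ω, q ∈ outgoing φ τ Ω :=
  (withDensity_absolutelyContinuous _ _).ae_le (ae_restrict_mem (measurableSet_outgoing hΩ hΩs hφ))

/-- The pairs `(q, s)` such that the backward trajectory of `q` stays in `Ω` on `[s, 0)`. -/
def backwardDomain (Ω : Set (Sp n)) (Φ : ℝ → Sp n × Sp n → Sp n × Sp n) :
    Set ((Sp n × Sp n) × ℝ) :=
  {z | z.2 < 0 ∧ ∀ s ∈ Ico z.2 0, (Φ s z.1).1 ∈ Ω}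

/-- Writing times as `l s` with `l ∈ (0, 1]` and cutting off at `l ≥ 1 / (k + 1)` gives conditions
over compact intervals. These are open, and countably many of them describe the set. -/
theorem measurableSet_backwardDomain (hΩ : IsOpen Ω)
    (hΦ : Continuous fun p : ℝ × (Sp n × Sp n) ↦ Φ p.1 p.2) :
    MeasurableSet (backwardDomain Ω Φ) := by
  have heq : backwardDomain Ω Φ = {z | z.2 < 0} ∩
      ⋂ k : ℕ, {z | ∀ l ∈ Icc (1 / ((k : ℝ) + 1)) 1, (Φ (l * z.2) z.1).1 ∈ Ω} := by
    ext ⟨q, s⟩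
    simp only [backwardDomain, mem_inter_iff, mem_iInter, mem_ofPred_eq]
    refine and_congr_right fun hs ↦ ⟨fun h k l hl ↦ h _ ⟨?_, ?_⟩, fun h r hr ↦ ?_⟩
    · nlinarith [hl.2]
    · have : 0 < l := lt_of_lt_of_le (by positivity) hl.1
      nlinarith
    · have hrs : 0 < r / s := div_pos_of_neg_of_neg hr.2 hs
      obtain ⟨k, hk⟩ := exists_nat_one_div_lt hrs
      have := h k (r / s) ⟨hk.le, (div_le_one_of_neg hs).2 hr.1⟩
      rwa [div_mul_cancel₀ _ hs.ne] at this
  rw [heq]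
  refine (measurableSet_lt measurable_snd measurable_const).inter (MeasurableSet.iInter fun k ↦ ?_)
  refine IsOpen.measurableSet (isOpen_iff_eventually.2 fun z hz ↦ ?_)
  refine isCompact_Icc.eventually_forall_of_forall_eventually fun l hl ↦ ?_
  have hcont : Continuous fun w : ((Sp n × Sp n) × ℝ) × ℝ ↦ (Φ (w.2 * w.1.2) w.1.1).1 :=
    continuous_fst.comp (hΦ.comp (f := fun w : ((Sp n × Sp n) × ℝ) × ℝ ↦ (w.2 * w.1.2, w.1.1))
      (by fun_prop))
  exact (hΩ.preimage hcont).mem_nhds (hz l hl)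

variable {e : Sp n} {B : Set (Hyp e)} {a b T : ℝ} {N : Set (Sp n × Sp n)}

/-- If `Φ s q` lies in the tube and `s < -T`, the orbit has been outside the closure of `Ω` at time
`s + T < 0`; if `-T ≤ s < 0`, it stays in `Ω` until `q`. So for functions supported in the tube the
exit time may be replaced by the fixed length `T`. -/
theorem IsTube.backwardDomain_indicator (hN : IsTube Ω e B a b R Φ N T)
    (hΦ : IsCutoffFlow (vectorField φ Y) R Z K M Φ) {F : Sp n × Sp n → ENNReal}
    (hF : ∀ q ∉ N, F q = 0) {q : Sp n × Sp n} (hq : q.1 ∈ frontier Ω) (s : ℝ) :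
    (backwardDomain Ω Φ).indicator (fun z ↦ F (Φ z.2 z.1)) (q, s) =
      (Ico (-T) 0).indicator (fun s ↦ F (Φ s q)) s := by
  by_cases hmem : Φ s q ∈ N
  · have hiff : (q, s) ∈ backwardDomain Ω Φ ↔ s ∈ Ico (-T) 0 := by
      have hadd : ∀ t, Φ t (Φ s q) = Φ (t + s) q := fun t ↦ (hΦ.flow.add hΦ.lipschitz t s q).symm
      constructor
      · rintro ⟨h1, h2⟩
        refine ⟨?_, h1⟩
        by_contra hs
        have hs : s < -T := not_le.1 hs
        dsimp only at h1 h2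
        have h3 := hN.notMem _ hmem
        rw [hadd] at h3
        exact h3 (subset_closure (h2 _ ⟨by linarith [hN.pos], by linarith⟩))
      · rintro ⟨h1, h2⟩
        refine ⟨h2, fun s' hs' ↦ ?_⟩
        have h3 := hN.mem_before _ hmem (-s) ⟨by linarith, by linarith⟩
          (by rw [hadd, neg_add_cancel, hΦ.flow.zero]; exact hq) (s' - s)
          ⟨by linarith [hs'.1], by linarith [hs'.2]⟩
        rwa [hadd, sub_add_cancel] at h3
    by_cases hs : s ∈ Ico (-T) 0
    · rw [indicator_of_mem hs, indicator_of_mem (hiff.2 hs)]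
    · rw [indicator_of_notMem hs, indicator_of_notMem (mt hiff.1 hs)]
  · have h0 := hF _ hmem
    simp [indicator_apply, h0]

end Measures

/-! ### Local equality of the two measures -/

section LocalMeasures

open Filter Topology

/-- Two measures coincide on an open set if they coincide on Lipschitz functions. -/
theorem measure_eq_of_lintegral_lipschitz {X : Type*} [PseudoMetricSpace X] [MeasurableSpace X]
    [OpensMeasurableSpace X] {μ ν : Measure X} {V : Set X} (hV : IsOpen V) (hVc : Vᶜ.Nonempty)
    (h : ∀ (f : X → ℝ) (C : NNReal), LipschitzWith C f → (∀ x, 0 ≤ f x) → (∀ x ∉ V, f x = 0) →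
      ∫⁻ x, ENNReal.ofReal (f x) ∂μ = ∫⁻ x, ENNReal.ofReal (f x) ∂ν) : μ V = ν V := by
  let f : ℕ → X → ℝ := fun j x ↦ min 1 (j * Metric.infDist x Vᶜ)
  have hf0 : ∀ j x, 0 ≤ f j x := fun j x ↦
    le_min zero_le_one (mul_nonneg j.cast_nonneg Metric.infDist_nonneg)
  have hfL : ∀ j : ℕ, LipschitzWith (j : NNReal) (f j) := by
    intro j
    have h1 : LipschitzWith (j : NNReal) fun x ↦ (j : ℝ) * Metric.infDist x Vᶜ := by
      refine LipschitzWith.of_dist_le_mul fun x y ↦ ?_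
      have h2 := (Metric.lipschitz_infDist_pt Vᶜ).dist_le_mul x y
      rw [NNReal.coe_one, one_mul] at h2
      rw [Real.dist_eq, ← mul_sub, abs_mul, Nat.abs_cast, NNReal.coe_natCast]
      exact mul_le_mul_of_nonneg_left h2 j.cast_nonneg
    simpa using h1.const_min 1
  have hfz : ∀ j, ∀ x ∉ V, f j x = 0 := fun j x hx ↦ by
    simp [f, Metric.infDist_zero_of_mem (show x ∈ Vᶜ from hx)]
  have hsup : ∀ ρ : Measure X, Tendsto (fun j ↦ ∫⁻ x, ENNReal.ofReal (f j x) ∂ρ) atTop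
      (𝓝 (ρ V)) := by
    intro ρ
    rw [← lintegral_indicator_one hV.measurableSet]
    refine lintegral_tendsto_of_tendsto_of_monotone
      (fun j ↦ (hfL j).continuous.measurable.ennreal_ofReal.aemeasurable)
      (Eventually.of_forall fun x i j hij ↦ ?_) (Eventually.of_forall fun x ↦ ?_)
    · refine ENNReal.ofReal_le_ofReal (min_le_min le_rfl ?_)
      exact mul_le_mul_of_nonneg_right (Nat.cast_le.2 hij) Metric.infDist_nonneg
    · by_cases hx : x ∈ V
      · rw [indicator_of_mem hx]
        have hd : 0 < Metric.infDist x Vᶜ :=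
          (hV.isClosed_compl.notMem_iff_infDist_pos hVc).1 (not_not.2 hx)
        refine tendsto_const_nhds.congr' ?_
        obtain ⟨j₀, hj₀⟩ := exists_nat_gt (1 / Metric.infDist x Vᶜ)
        filter_upwards [eventually_ge_atTop j₀] with j hj
        have : 1 ≤ j * Metric.infDist x Vᶜ := by
          rw [div_lt_iff₀ hd] at hj₀
          have : (j₀ : ℝ) ≤ j := Nat.cast_le.2 hj
          nlinarith
        simp [f, min_eq_left this]
      · rw [indicator_of_notMem hx]
        simp only [hfz _ x hx, ENNReal.ofReal_zero]
        exact tendsto_const_nhds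
  refine tendsto_nhds_unique (hsup μ) ?_
  exact (hsup ν).congr fun j ↦ (h _ _ (hfL j) (hf0 j) (hfz j)).symm

theorem restrict_eq_of_lintegral_lipschitz {X : Type*} [MetricSpace X] [MeasurableSpace X]
    [BorelSpace X] [SecondCountableTopology X] {μ ν : Measure X} [IsFiniteMeasure μ] {V : Set X}
    (hV : IsOpen V) (hVc : Vᶜ.Nonempty)
    (h : ∀ (f : X → ℝ) (C : NNReal), LipschitzWith C f → (∀ x, 0 ≤ f x) → (∀ x ∉ V, f x = 0) →
      ∫⁻ x, ENNReal.ofReal (f x) ∂μ = ∫⁻ x, ENNReal.ofReal (f x) ∂ν) :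
    μ.restrict V = ν.restrict V := by
  have key : ∀ U : Set X, IsOpen U → μ.restrict V U = ν.restrict V U := fun U hU ↦ by
    rw [Measure.restrict_apply hU.measurableSet, Measure.restrict_apply hU.measurableSet]
    refine measure_eq_of_lintegral_lipschitz (hU.inter hV)
      (hVc.mono (compl_subset_compl.2 inter_subset_right)) fun f C hf h0 hfU ↦ h f C hf h0 fun x hx ↦
        hfU x fun hx' ↦ hx hx'.2
  refine ext_of_generate_finite _ BorelSpace.measurable_eq isPiSystem_isOpen (fun U hU ↦ key U hU)
    (key univ isOpen_univ)

variable {Ω : Set (Sp n)} {φ : Sp n → ℝ} {Y : Sp n → Matrix (Fin n) (Fin n) ℝ} {R τ A c : ℝ}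
  {K M : NNReal} {Z : Sp n × Sp n → Sp n × Sp n} {Φ : ℝ → Sp n × Sp n → Sp n × Sp n}
  {e : Sp n} {B : Set (Hyp e)} {a b T : ℝ} {h : Hyp e → ℝ} {N : Set (Sp n × Sp n)}

/-- The measure `p⁻¹ dθ dx` on `S^τΩ`. -/
def phaseTime (φ : Sp n → ℝ) (τ : ℝ) (Ω : Set (Sp n)) : Measure (Sp n × Sp n) :=
  (phaseMeasure φ τ Ω).withDensity fun q ↦ ENNReal.ofReal (speed φ τ q.1)⁻¹

/-- The measure `p⁻¹ dξ` on `∂₊S^τΩ`. -/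
def xiTime (φ : Sp n → ℝ) (τ : ℝ) (Ω : Set (Sp n)) : Measure (Sp n × Sp n) :=
  (xiMeasure φ τ Ω).withDensity fun q ↦ ENNReal.ofReal (speed φ τ q.1)⁻¹

/-- The image of `p⁻¹ dξ ds` under the flow. -/
def orbitMeasure (φ : Sp n → ℝ) (τ : ℝ) (Ω : Set (Sp n)) (Φ : ℝ → Sp n × Sp n → Sp n × Sp n) :
    Measure (Sp n × Sp n) :=
  (((xiTime φ τ Ω).prod volume).restrict (backwardDomain Ω Φ)).map fun z ↦ Φ z.2 z.1

/-- This is the shell formula for `f ≥ 0`, read as an equality of integrals against two measures.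
The orbit integral is nonzero at a boundary point only if that point is outgoing, so the surface
integral reduces to the one against `ξ`. -/
theorem IsTube.lintegral_phaseTime_eq (hn : 2 ≤ n) (hN : IsTube Ω e B a b R Φ N T) (hΩ : IsOpen Ω)
    (hΩb : Bornology.IsBounded Ω) (hΩs : HasSmoothBoundary Ω) (hc : IsGraphChart Ω e B a b h)
    (hF : Continuous fun q : Sp n × Sp n ↦ force φ Y q.1 q.2)
    (hY : ∀ x ∈ closure Ω, (Y x).transpose = -Y x) (hφ : ContDiff ℝ ∞ φ)
    (hc0 : 0 < c) (hPc : ∀ x, c ≤ P φ τ x) (hPA : ∀ x, P φ τ x ≤ A)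
    (hΦ : IsCutoffFlow (vectorField φ Y) R Z K M Φ) {f : Sp n × Sp n → ℝ} {C : NNReal}
    (hf : LipschitzWith C f) (hf0 : ∀ q, 0 ≤ f q) (hfc : HasCompactSupport f)
    (hfN : tsupport f ⊆ N) :
    ∫⁻ q, ENNReal.ofReal (f q) ∂phaseTime φ τ Ω =
      ∫⁻ q, ENNReal.ofReal (f q) ∂orbitMeasure φ τ Ω Φ := by
  have hP0 : ∀ x, 0 < P φ τ x := fun x ↦ hc0.trans_le (hPc x)
  have hp : ∀ x, 0 < speed φ τ x := fun x ↦ Real.sqrt_pos.2 (hP0 x)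
  have := isFiniteMeasure_surfaceMeasure hΩ hΩb hΩs
  have hfinΩ : IsFiniteMeasure ((volume : Measure (Sp n)).restrict Ω) :=
    ⟨by rw [Measure.restrict_apply_univ]; exact hΩb.measure_lt_top⟩
  have := isFiniteMeasure_bundleMeasure (m := surfaceMeasure Ω) hPA
  have hph : IsFiniteMeasure (phaseMeasure φ τ Ω) := isFiniteMeasure_bundleMeasure hPA
  have := isFiniteMeasure_xiMeasure hΩ hΩb hΩs hφ.continuous hP0 hPA
  have hxi : IsFiniteMeasure (xiTime φ τ Ω) := isFiniteMeasure_withDensity_inv_speed hc0 hPc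
  have hΦc := hΦ.flow.continuous hΦ.lipschitz
  have hpc := continuous_speed (τ := τ) hφ.continuous
  obtain ⟨Mf, hMf⟩ := hfc.exists_bound_of_continuous hf.continuous
  obtain ⟨C', hu⟩ := hΦ.lipschitzWith_orbitIntegral hN.pos.le hf
  have hu0 : ∀ q, 0 ≤ orbitIntegral Φ T f q := fun q ↦
    intervalIntegral.integral_nonneg hN.pos.le fun s _ ↦ hf0 _
  have hpinv : ∀ x, (speed φ τ x)⁻¹ ≤ (√c)⁻¹ := fun x ↦
    inv_anti₀ (Real.sqrt_pos.2 hc0) (Real.sqrt_le_sqrt (hPc _))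
  have hfm : Measurable fun q ↦ ENNReal.ofReal (f q) := hf.continuous.measurable.ennreal_ofReal
  -- the left-hand side
  have hl : ∫⁻ q, ENNReal.ofReal (f q) ∂phaseTime φ τ Ω =
      ENNReal.ofReal (∫ q, f q / speed φ τ q.1 ∂phaseMeasure φ τ Ω) := by
    rw [phaseTime, lintegral_withDensity_eq_lintegral_mul _ (measurable_density hφ.continuous) hfm,
      ofReal_integral_eq_lintegral_ofReal]
    · refine lintegral_congr fun q ↦ ?_
      rw [Pi.mul_apply, ← ENNReal.ofReal_mul (inv_nonneg.2 (hp _).le), div_eq_inv_mul]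
    · refine Integrable.of_bound (C := Mf * (√c)⁻¹) ?_ (Eventually.of_forall fun q ↦ ?_)
      · exact (hf.continuous.measurable.div
          (hpc.measurable.comp measurable_fst)).aestronglyMeasurable
      · rw [div_eq_mul_inv, norm_mul, norm_inv, Real.norm_of_nonneg (hp _).le]
        exact mul_le_mul (hMf q) (hpinv _) (inv_nonneg.2 (hp _).le)
          ((norm_nonneg _).trans (hMf q))
    · exact Eventually.of_forall fun q ↦ div_nonneg (hf0 q) (hp _).le
  -- the right-hand side
  have hsurf : ∀ᵐ q ∂bundleMeasure φ τ (surfaceMeasure Ω), q ∈ shell φ τ (frontier Ω) :=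
    ae_bundleMeasure_mem_shell hφ.continuous hP0 isClosed_frontier.measurableSet
      (ae_restrict_mem isClosed_frontier.measurableSet)
  have hpos : ∀ q : Sp n × Sp n, q.1 ∈ frontier Ω → orbitIntegral Φ T f q ≠ 0 →
      0 < inner ℝ q.2 (outerNormal Ω q.1) := by
    intro q hq hne
    have := hΦ.tsupport_orbitIntegral_subset hN.pos.le hfc (subset_tsupport _ hne)
    obtain ⟨⟨s, q'⟩, ⟨hs, hq'⟩, rfl⟩ := this
    exact hN.inner_pos q' (hfN hq') s hs hq
  have hr : ∫⁻ q, ENNReal.ofReal (f q) ∂orbitMeasure φ τ Ω Φ =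
      ∫⁻ q, ENNReal.ofReal (orbitIntegral Φ T f q) ∂xiTime φ τ Ω := by
    have hΦm : Measurable fun z : (Sp n × Sp n) × ℝ ↦ Φ z.2 z.1 :=
      (hΦc.comp continuous_swap).measurable
    have hDm := measurableSet_backwardDomain hΩ hΦc
    have hfΦ : Measurable fun z : (Sp n × Sp n) × ℝ ↦ ENNReal.ofReal (f (Φ z.2 z.1)) :=
      hfm.comp hΦm
    rw [orbitMeasure, lintegral_map hfm hΦm, ← lintegral_indicator hDm,
      lintegral_prod _ (hfΦ.indicator hDm).aemeasurable]
    refine lintegral_congr_ae ?_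
    have hxiae : ∀ᵐ q ∂xiTime φ τ Ω, q ∈ outgoing φ τ Ω :=
      (withDensity_absolutelyContinuous _ _).ae_le
        (ae_xiMeasure_mem_outgoing hΩ hΩs hφ.continuous)
    filter_upwards [hxiae] with q hq
    have hind := fun s ↦ hN.backwardDomain_indicator hΦ (F := fun q ↦ ENNReal.ofReal (f q))
      (fun q hq ↦ by simp [image_eq_zero_of_notMem_tsupport fun h ↦ hq (hfN h)]) hq.1.1 s
    have hcq : Continuous fun s ↦ f (Φ s q) := hf.continuous.comp (hΦ.flow.continuous_time q)
    have hor : orbitIntegral Φ T f q = ∫ s in Ico (-T) 0, f (Φ s q) := by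
      have h1 := intervalIntegral.integral_comp_neg (a := 0) (b := T) fun s ↦ f (Φ s q)
      rw [neg_zero] at h1
      rw [orbitIntegral, h1, intervalIntegral.integral_of_le (by linarith [hN.pos]),
        ← integral_Ico_eq_integral_Ioc]
    rw [lintegral_congr hind, lintegral_indicator measurableSet_Ico, hor,
      ofReal_integral_eq_lintegral_ofReal]
    · exact hcq.integrableOn_Icc.mono_set Ico_subset_Icc_self
    · exact Eventually.of_forall fun s ↦ hf0 _
  have hr2 : ∫⁻ q, ENNReal.ofReal (orbitIntegral Φ T f q) ∂xiTime φ τ Ω =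
      ∫⁻ q, ENNReal.ofReal (orbitIntegral Φ T f q * inner ℝ q.2 (outerNormal Ω q.1) /
        speed φ τ q.1) ∂bundleMeasure φ τ (surfaceMeasure Ω) := by
    have hum : Measurable fun q ↦ ENNReal.ofReal (orbitIntegral Φ T f q) :=
      hu.continuous.measurable.ennreal_ofReal
    have hout := measurableSet_outgoing (τ := τ) hΩ hΩs hφ.continuous
    have hnm : Measurable fun q : Sp n × Sp n ↦ ENNReal.ofReal (inner ℝ q.2 (outerNormal Ω q.1)) :=
      (measurable_snd.inner ((measurable_outerNormal hΩ hΩs).comp measurable_fst)).ennreal_ofReal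
    have hdm := measurable_density (n := n) (τ := τ) hφ.continuous
    rw [xiTime, lintegral_withDensity_eq_lintegral_mul _ hdm hum, xiMeasure,
      lintegral_withDensity_eq_lintegral_mul _ hnm (hdm.mul hum), ← lintegral_indicator hout]
    refine lintegral_congr_ae ?_
    filter_upwards [hsurf] with q hq
    by_cases hqo : q ∈ outgoing φ τ Ω
    · rw [indicator_of_mem hqo]
      simp only [Pi.mul_apply]
      rw [← ENNReal.ofReal_mul (inv_nonneg.2 (hp _).le), ← ENNReal.ofReal_mul hqo.2.le]
      congr 1
      ring
    · rw [indicator_of_notMem hqo]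
      have : orbitIntegral Φ T f q = 0 := by
        by_contra hne
        exact hqo ⟨hq, hpos q hq.1 hne⟩
      rw [this, zero_mul, zero_div, ENNReal.ofReal_zero]
  rw [hl, hr, hr2, hN.integral_shell_eq hn hΩ hΩb hΩs hc hF hY hφ hP0 hPA hΦ hf hfc hfN,
    ofReal_integral_eq_lintegral_ofReal]
  · refine Integrable.of_bound (C := Mf * |T - 0|) ?_ ?_
    · exact ((hu.continuous.measurable.mul (measurable_snd.inner
        ((measurable_outerNormal hΩ hΩs).comp measurable_fst))).div
          (hpc.measurable.comp measurable_fst)).aestronglyMeasurable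
    · filter_upwards [hsurf] with q hq
      have h1 : ‖orbitIntegral Φ T f q‖ ≤ Mf * |T - 0| :=
        intervalIntegral.norm_integral_le_of_norm_le_const fun s _ ↦ hMf _
      have h2 : ‖inner ℝ q.2 (outerNormal Ω q.1)‖ ≤ speed φ τ q.1 := by
        refine (norm_inner_le_norm _ _).trans ?_
        rw [(energy_eq_iff hP0).1 hq.2.2]
        exact mul_le_of_le_one_right (hp _).le (norm_outerNormal_le _ _)
      rw [norm_div, norm_mul, Real.norm_of_nonneg (hp q.1).le, div_le_iff₀ (hp _)]
      exact mul_le_mul h1 h2 (norm_nonneg _) ((norm_nonneg _).trans h1)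
  · filter_upwards [hsurf] with q hq
    refine div_nonneg ?_ (hp _).le
    by_cases h0 : orbitIntegral Φ T f q = 0
    · rw [h0, zero_mul]
    · exact mul_nonneg (hu0 q) (hpos q hq.1 h0).le

end LocalMeasures

/-! ### Global equality of the two measures -/

section OrbitMeasure

open Filter Topology

variable {Ω : Set (Sp n)} {φ : Sp n → ℝ} {Y : Sp n → Matrix (Fin n) (Fin n) ℝ} {R τ A c : ℝ}
  {K M : NNReal} {Z : Sp n × Sp n → Sp n × Sp n} {Φ : ℝ → Sp n × Sp n → Sp n × Sp n}

theorem eq_of_restrict_eq_of_ae {X : Type*} [TopologicalSpace X] [SecondCountableTopology X]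
    [MeasurableSpace X] [OpensMeasurableSpace X] {μ ν : Measure X} {G : Set X}
    (hG : ∀ x ∈ G, ∃ V, IsOpen V ∧ x ∈ V ∧ μ.restrict V = ν.restrict V)
    (hμ : ∀ᵐ x ∂μ, x ∈ G) (hν : ∀ᵐ x ∂ν, x ∈ G) : μ = ν := by
  choose! V hVo hxV hV using hG
  obtain ⟨T, hTc, hT⟩ := TopologicalSpace.isOpen_iUnion_countable (fun x : G ↦ V x)
    fun x ↦ hVo x x.2
  have hcover : G ⊆ ⋃ x ∈ T, V x := by
    rw [hT]
    exact fun x hx ↦ mem_iUnion.2 ⟨⟨x, hx⟩, hxV x hx⟩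
  have h1 : μ.restrict (⋃ x ∈ T, V x) = ν.restrict (⋃ x ∈ T, V x) :=
    (Measure.restrict_biUnion_congr hTc).2 fun x _ ↦ hV x x.2
  rwa [Measure.restrict_eq_self_of_ae_mem (hμ.mono fun x hx ↦ hcover hx),
    Measure.restrict_eq_self_of_ae_mem (hν.mono fun x hx ↦ hcover hx)] at h1

variable (hn : 2 ≤ n) (hΩ : IsOpen Ω) (hΩb : Bornology.IsBounded Ω) (hΩs : HasSmoothBoundary Ω)
  (hF : Continuous fun q : Sp n × Sp n ↦ force φ Y q.1 q.2)
  (hY : ∀ x ∈ closure Ω, (Y x).transpose = -Y x) (hφ : ContDiff ℝ ∞ φ)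
  (hc0 : 0 < c) (hPc : ∀ x, c ≤ P φ τ x) (hPA : ∀ x, P φ τ x ≤ A)
  (hΦ : IsCutoffFlow (vectorField φ Y) R Z K M Φ)

include hn hΩ hΩb hΩs hF hY hφ hc0 hPc hPA hΦ

/-- A transversal exit gives a tube around `q₀`, and the local formula tests the measures on
Lipschitz functions supported there. -/
theorem exists_restrict_phaseTime_eq {q₀ : Sp n × Sp n} {T₀ : ℝ} (hT₀ : 0 < T₀)
    (hin : ∀ t ∈ Ico 0 T₀, (Φ t q₀).1 ∈ Ω) (hout : (Φ T₀ q₀).1 ∈ frontier Ω)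
    (htr : 0 < inner ℝ (Φ T₀ q₀).2 (outerNormal Ω (Φ T₀ q₀).1))
    (hR : ∀ t ∈ Icc 0 T₀, ‖Φ t q₀‖ < R) :
    ∃ V, IsOpen V ∧ q₀ ∈ V ∧
      (phaseTime φ τ Ω).restrict V = (orbitMeasure φ τ Ω Φ).restrict V := by
  obtain ⟨r, hr, T, hT, e, B, a, b, h, hc, h1, h2, h3⟩ :=
    hΦ.exists_tube hΩ hΩs hT₀ hin hout htr hR
  have hN : IsTube Ω e B a b R Φ (Metric.ball q₀ r) T :=
    ⟨hT, h1, fun q hq t ht hf ↦ (h2 q hq t ht hf).1, fun q hq t ht hf ↦ (h2 q hq t ht hf).2.1,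
      fun q hq t ht hf ↦ (h2 q hq t ht hf).2.2, h3⟩
  have hfinΩ : IsFiniteMeasure ((volume : Measure (Sp n)).restrict Ω) :=
    ⟨by rw [Measure.restrict_apply_univ]; exact hΩb.measure_lt_top⟩
  have hph : IsFiniteMeasure (phaseMeasure φ τ Ω) := isFiniteMeasure_bundleMeasure hPA
  have hpt : IsFiniteMeasure (phaseTime φ τ Ω) := isFiniteMeasure_withDensity_inv_speed hc0 hPc
  have : Nonempty (Fin n) := ⟨⟨0, by omega⟩⟩
  -- Half the radius makes the supports compact and contained in the tube.
  refine ⟨Metric.ball q₀ (r / 2), Metric.isOpen_ball, Metric.mem_ball_self (by linarith),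
    restrict_eq_of_lintegral_lipschitz Metric.isOpen_ball ?_ fun f C hf hf0 hfV ↦ ?_⟩
  · by_contra hne
    rw [not_nonempty_iff_eq_empty, compl_empty_iff] at hne
    have := NormedSpace.unbounded_univ ℝ (Sp n × Sp n)
    rw [← hne] at this
    exact this Metric.isBounded_ball
  · have hsub : tsupport f ⊆ Metric.closedBall q₀ (r / 2) :=
      closure_minimal (fun x hx ↦ Metric.ball_subset_closedBall (by_contra fun hx' ↦ hx (hfV x hx')))
        Metric.isClosed_closedBall
    exact hN.lintegral_phaseTime_eq hn hΩ hΩb hΩs hc hF hY hφ hc0 hPc hPA hΦ hf hf0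
      ((isCompact_closedBall q₀ (r / 2)).of_isClosed_subset (isClosed_tsupport f) hsub)
      (hsub.trans (Metric.closedBall_subset_ball (by linarith)))

/-- Santaló's formula as an equality of measures. -/
theorem phaseTime_eq_orbitMeasure (hR : ∀ q ∈ shell φ τ (closure Ω), ‖q‖ < R)
    (hnt : NonTrapping φ Y τ Ω) : phaseTime φ τ Ω = orbitMeasure φ τ Ω Φ := by
  have hP0 : ∀ x, 0 < P φ τ x := fun x ↦ hc0.trans_le (hPc x)
  have hφd : Differentiable ℝ φ := hφ.differentiable (by simp)
  have hΦc := hΦ.flow.continuous hΦ.lipschitz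
  have hfinΩ : IsFiniteMeasure ((volume : Measure (Sp n)).restrict Ω) :=
    ⟨by rw [Measure.restrict_apply_univ]; exact hΩb.measure_lt_top⟩
  have := isFiniteMeasure_surfaceMeasure hΩ hΩb hΩs
  have := isFiniteMeasure_xiMeasure hΩ hΩb hΩs hφ.continuous hP0 hPA
  have hxi : IsFiniteMeasure (xiTime φ τ Ω) := isFiniteMeasure_withDensity_inv_speed hc0 hPc
  refine eq_of_restrict_eq_of_ae (G := {q | ∃ V, IsOpen V ∧ q ∈ V ∧
    (phaseTime φ τ Ω).restrict V = (orbitMeasure φ τ Ω Φ).restrict V}) (fun q hq ↦ hq) ?_ ?_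
  -- Phase side: by non-trapping every trajectory from `Ω` exits, and off the null set of glancing
  -- orbits it does so transversally.
  · refine (withDensity_absolutelyContinuous _ _).ae_le ?_
    have h1 : ∀ᵐ q ∂phaseMeasure φ τ Ω, q ∈ shell φ τ Ω :=
      ae_bundleMeasure_mem_shell hφ.continuous hP0 hΩ.measurableSet (ae_restrict_mem hΩ.measurableSet)
    have h2 : ∀ᵐ q ∂phaseMeasure φ τ Ω, q ∉ glancingOrbits φ τ Ω Φ :=
      compl_mem_ae_iff.2 (by
        simpa using hΦ.phaseMeasure_glancingOrbits (by omega) hΩ hΩb hΩs hφ hP0)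
    filter_upwards [h1, h2] with q hq hqg
    have hq' : q ∈ shell φ τ (closure Ω) := ⟨subset_closure hq.1, hq.2⟩
    obtain ⟨T, hT, hin, hout, hsh⟩ := exists_exit hΦ hφd hY hP0 hR hΩ hq (hnt q hq').1
    have hRt : ∀ t ∈ Icc 0 T, ‖Φ t q‖ < R := fun t ht ↦ hR _ (hsh t ht)
    have hTm : T ∈ Icc 0 T := ⟨hT.le, le_rfl⟩
    refine exists_restrict_phaseTime_eq hn hΩ hΩb hΩs hF hY hφ hc0 hPc hPA hΦ hT hin hout ?_ hRt
    refine (inner_outerNormal_nonneg_of_exit hΦ hΩ hΩs hT hin hout (hRt T hTm)).lt_of_ne' ?_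
    exact fun h0 ↦ hqg ⟨T, hout, (energy_eq_iff hP0).1 (hsh T hTm).2.2, h0⟩
  · have hΦm : Measurable fun z : (Sp n × Sp n) × ℝ ↦ Φ z.2 z.1 :=
      (hΦc.comp continuous_swap).measurable
    have hDm := measurableSet_backwardDomain hΩ hΦc
    -- Orbit side: a point `Φ s q` with `q` outgoing leaves `Ω` transversally at time `-s` by
    -- construction. Openness of the good set provides the measurability needed to test it on an
    -- image measure.
    have hGo : IsOpen {q | ∃ V, IsOpen V ∧ q ∈ V ∧
        (phaseTime φ τ Ω).restrict V = (orbitMeasure φ τ Ω Φ).restrict V} := by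
      refine isOpen_iff_mem_nhds.2 fun q ⟨V, hV, hqV, hres⟩ ↦ ?_
      filter_upwards [hV.mem_nhds hqV] with q' hq'
      exact ⟨V, hV, hq', hres⟩
    refine (ae_map_iff hΦm.aemeasurable hGo.measurableSet).2 ?_
    have hxiae : ∀ᵐ z ∂((xiTime φ τ Ω).prod (volume : Measure ℝ)), z.1 ∈ outgoing φ τ Ω :=
      Measure.quasiMeasurePreserving_fst.ae ((withDensity_absolutelyContinuous _ _).ae_le
        (ae_xiMeasure_mem_outgoing hΩ hΩs hφ.continuous))
    filter_upwards [ae_restrict_of_ae hxiae, ae_restrict_mem hDm] with ⟨q, s⟩ hq ⟨hs, hsΩ⟩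
    dsimp only at hq hs hsΩ
    have hadd : ∀ t, Φ t (Φ s q) = Φ (t + s) q := fun t ↦ (hΦ.flow.add hΦ.lipschitz t s q).symm
    have hq' : q ∈ shell φ τ (closure Ω) := ⟨frontier_subset_closure hq.1.1, hq.1.2⟩
    have hcl : ∀ t ∈ Icc s 0, (Φ t q).1 ∈ closure Ω := fun t ht ↦ by
      rcases ht.2.eq_or_lt with rfl | h0
      · rw [hΦ.flow.zero]; exact hq'.1
      · exact subset_closure (hsΩ t ⟨ht.1, h0⟩)
    have hback : Φ (-s) (Φ s q) = q := by rw [hadd, neg_add_cancel, hΦ.flow.zero]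
    refine exists_restrict_phaseTime_eq hn hΩ hΩb hΩs hF hY hφ hc0 hPc hPA hΦ (T₀ := -s)
      (by linarith) (fun t ht ↦ ?_) ?_ ?_ fun t ht ↦ ?_
    · rw [hadd]; exact hsΩ _ ⟨by linarith [ht.1], by linarith [ht.2]⟩
    · rw [hback]; exact hq.1.1
    · rw [hback]; exact hq.2
    · rw [hadd]
      refine hR _ (mem_shell_of_forall_mem hΦ hφd hY hP0 hq' fun t' ht' ↦ hcl t' ?_)
      rw [uIcc_of_ge (by linarith [ht.2])] at ht'
      exact ⟨by linarith [ht.1, ht'.1], ht'.2⟩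

end OrbitMeasure

/-! ### Fubini's theorem on the sphere bundle -/

section Disintegration

open Filter Topology

variable {Ω : Set (Sp n)} {φ : Sp n → ℝ} {Y : Sp n → Matrix (Fin n) (Fin n) ℝ} {R τ A c : ℝ}
  {K M : NNReal} {Z : Sp n × Sp n → Sp n × Sp n} {Φ : ℝ → Sp n × Sp n → Sp n × Sp n}
  {m : Measure (Sp n)} {𝕜 : Type*} [RCLike 𝕜] {f : Sp n × Sp n → 𝕜}

theorem measurableEmbedding_smul_sphere {p : ℝ} (hp : 0 < p) :
    MeasurableEmbedding fun v : Metric.sphere (0 : Sp n) 1 ↦ p • (v : Sp n) := by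
  have h1 : Continuous fun v : Metric.sphere (0 : Sp n) 1 ↦ p • (v : Sp n) := by fun_prop
  refine (h1.isClosedEmbedding fun v w h ↦ Subtype.ext ?_).measurableEmbedding
  exact smul_right_injective _ hp.ne' h

theorem integrable_fiberMeasure_iff {x : Sp n} (hp : 0 < speed φ τ x) :
    Integrable (fun θ ↦ f (x, θ)) (fiberMeasure φ τ x) ↔
      Integrable (fun v : Metric.sphere (0 : Sp n) 1 ↦
        speed φ τ x ^ (n - 1) • f (x, speed φ τ x • (v : Sp n)))
          (volume : Measure (Sp n)).toSphere := by
  have h0 : 0 < speed φ τ x ^ (n - 1) := pow_pos hp _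
  rw [fiberMeasure, (measurableEmbedding_smul_sphere hp).integrable_map_iff,
    integrable_smul_measure (ENNReal.ofReal_pos.2 h0).ne' ENNReal.ofReal_ne_top,
    integrable_fun_smul_iff h0.ne']
  rfl

theorem integral_fiberMeasure {x : Sp n} (hp : 0 < speed φ τ x) :
    ∫ θ, f (x, θ) ∂fiberMeasure φ τ x = ∫ v : Metric.sphere (0 : Sp n) 1,
      speed φ τ x ^ (n - 1) • f (x, speed φ τ x • (v : Sp n)) ∂(volume : Measure (Sp n)).toSphere := by
  have h0 : 0 < speed φ τ x ^ (n - 1) := pow_pos hp _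
  rw [fiberMeasure, (measurableEmbedding_smul_sphere hp).integral_map, integral_smul_measure,
    integral_smul, ENNReal.toReal_ofReal h0.le]

/-- Fubini's theorem on the sphere bundle. -/
theorem integrable_fiber_of_integrable_bundleMeasure [SFinite m] (hφ : Continuous φ)
    (hP0 : ∀ x, 0 < P φ τ x) (hf : Integrable f (bundleMeasure φ τ m)) :
    (∀ᵐ x ∂m, Integrable (fun θ ↦ f (x, θ)) (fiberMeasure φ τ x)) ∧
      Integrable (fun x ↦ ∫ θ, f (x, θ) ∂fiberMeasure φ τ x) m ∧
      ∫ x, ∫ θ, f (x, θ) ∂fiberMeasure φ τ x ∂m = ∫ q, f q ∂bundleMeasure φ τ m := by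
  have hp : ∀ x, 0 < speed φ τ x := fun x ↦ Real.sqrt_pos.2 (hP0 x)
  have hJ := (measurable_bundleMap (τ := τ) hφ).aemeasurable
    (μ := (m.prod (volume : Measure (Sp n)).toSphere).withDensity
      fun r ↦ ENNReal.ofReal (speed φ τ r.1 ^ (n - 1)))
  have hw : Measurable fun r : Sp n × Metric.sphere (0 : Sp n) 1 ↦
      ENNReal.ofReal (speed φ τ r.1 ^ (n - 1)) :=
    (((continuous_speed hφ).measurable.comp measurable_fst).pow_const _).ennreal_ofReal
  have hwr : ∀ r : Sp n × Metric.sphere (0 : Sp n) 1,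
      (ENNReal.ofReal (speed φ τ r.1 ^ (n - 1))).toReal = speed φ τ r.1 ^ (n - 1) :=
    fun r ↦ ENNReal.toReal_ofReal (pow_pos (hp _) _).le
  have hF : Integrable (fun r : Sp n × Metric.sphere (0 : Sp n) 1 ↦
      speed φ τ r.1 ^ (n - 1) • f (r.1, speed φ τ r.1 • (r.2 : Sp n)))
      (m.prod (volume : Measure (Sp n)).toSphere) := by
    have h1 := (integrable_map_measure hf.1 hJ).1 hf
    have h2 := (integrable_withDensity_iff_integrable_smul₀' hw.aemeasurable
      (Eventually.of_forall fun _ ↦ ENNReal.ofReal_lt_top)).1 h1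
    simpa only [hwr, Function.comp_def] using h2
  refine ⟨?_, ?_, ?_⟩
  · filter_upwards [hF.prod_right_ae] with x hx
    exact (integrable_fiberMeasure_iff (hp x)).2 hx
  · refine hF.integral_prod_left.congr (Eventually.of_forall fun x ↦ ?_)
    exact (integral_fiberMeasure (hp x)).symm
  · simp only [integral_fiberMeasure (hp _)]
    rw [bundleMeasure, integral_map hJ hf.1, integral_withDensity_eq_integral_toReal_smul hw
      (Eventually.of_forall fun _ ↦ ENNReal.ofReal_lt_top), ← integral_prod _ hF]
    simp only [hwr]

theorem integrable_withDensity_inv_speed_iff {μ : Measure (Sp n × Sp n)} (hφ : Continuous φ) :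
    Integrable f (μ.withDensity fun q ↦ ENNReal.ofReal (speed φ τ q.1)⁻¹) ↔
      Integrable (fun q ↦ (speed φ τ q.1)⁻¹ • f q) μ := by
  have hwr : ∀ q : Sp n × Sp n, (ENNReal.ofReal (speed φ τ q.1)⁻¹).toReal = (speed φ τ q.1)⁻¹ :=
    fun q ↦ ENNReal.toReal_ofReal (inv_nonneg.2 (Real.sqrt_nonneg _))
  rw [integrable_withDensity_iff_integrable_smul₀' (measurable_density hφ).aemeasurable
    (Eventually.of_forall fun _ ↦ ENNReal.ofReal_lt_top)]
  simp only [hwr]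

theorem integral_withDensity_inv_speed {μ : Measure (Sp n × Sp n)} (hφ : Continuous φ) :
    ∫ q, f q ∂(μ.withDensity fun q ↦ ENNReal.ofReal (speed φ τ q.1)⁻¹) =
      ∫ q, (speed φ τ q.1)⁻¹ • f q ∂μ := by
  have hwr : ∀ q : Sp n × Sp n, (ENNReal.ofReal (speed φ τ q.1)⁻¹).toReal = (speed φ τ q.1)⁻¹ :=
    fun q ↦ ENNReal.toReal_ofReal (inv_nonneg.2 (Real.sqrt_nonneg _))
  rw [integral_withDensity_eq_integral_toReal_smul (measurable_density hφ)
    (Eventually.of_forall fun _ ↦ ENNReal.ofReal_lt_top)]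
  simp only [hwr]

theorem ae_of_ae_withDensity_inv_speed {μ : Measure (Sp n × Sp n)} (hφ : Continuous φ)
    (hP0 : ∀ x, 0 < P φ τ x) {p : Sp n × Sp n → Prop}
    (h : ∀ᵐ q ∂(μ.withDensity fun q ↦ ENNReal.ofReal (speed φ τ q.1)⁻¹), p q) : ∀ᵐ q ∂μ, p q := by
  filter_upwards [(ae_withDensity_iff (measurable_density hφ)).1 h] with q hq
  exact hq (ENNReal.ofReal_pos.2 (inv_pos.2 (Real.sqrt_pos.2 (hP0 _)))).ne'

theorem rpow_neg_half_P (hP0 : ∀ x, 0 < P φ τ x) (x : Sp n) :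
    P φ τ x ^ (-1 / 2 : ℝ) = (speed φ τ x)⁻¹ := by
  rw [speed, Real.sqrt_eq_rpow, ← Real.rpow_neg (hP0 x).le]
  norm_num

theorem rpow_half_P (x : Sp n) : P φ τ x ^ (1 / 2 : ℝ) = speed φ τ x := by
  rw [speed, Real.sqrt_eq_rpow]

end Disintegration

/-! ### The formula for a globally defined force -/

section GlobalForce

open Filter Topology

variable {Ω : Set (Sp n)} {φ : Sp n → ℝ} {Y : Sp n → Matrix (Fin n) (Fin n) ℝ} {R τ A c : ℝ}
  {K M : NNReal} {Z : Sp n × Sp n → Sp n × Sp n} {Φ : ℝ → Sp n × Sp n → Sp n × Sp n}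
  {𝕜 : Type*} [RCLike 𝕜] {f : Sp n × Sp n → 𝕜}

theorem indicator_backwardDomain_ae_eq (hΦ : IsCutoffFlow (vectorField φ Y) R Z K M Φ)
    (hφ : Differentiable ℝ φ) (hY : ∀ x ∈ closure Ω, (Y x).transpose = -Y x)
    (hP0 : ∀ x, 0 < P φ τ x) (hR : ∀ q ∈ shell φ τ (closure Ω), ‖q‖ < R)
    {q : Sp n × Sp n} (hq : q ∈ shell φ τ (closure Ω)) (hb : BddBelow (backwardTimes φ Y Ω q))
    (f : Sp n × Sp n → 𝕜) :
    (fun s ↦ (backwardDomain Ω Φ).indicator (fun z ↦ f (Φ z.2 z.1)) (q, s)) =ᵐ[volume]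
      (Ioc (ellMinus φ Y Ω q) 0).indicator fun s ↦ f (flow φ Y Ω q s) := by
  filter_upwards [ae_mem_Ioc_ellMinus_iff hΦ hφ hY hP0 hR hq hb] with s hs
  by_cases h : s ∈ Ioc (ellMinus φ Y Ω q) 0
  · have h' := hs.1 h
    have hmem : (q, s) ∈ backwardDomain Ω Φ := h'
    rw [indicator_of_mem h, indicator_of_mem hmem, flow_eq hΦ hφ hY hP0 hR hq]
    intro t ht
    rw [uIcc_of_ge h'.1.le] at ht
    rcases ht.2.eq_or_lt with rfl | h0
    · rw [hΦ.flow.zero]; exact hq.1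
    · exact subset_closure (h'.2 t ⟨ht.1, h0⟩)
  · have hmem : (q, s) ∉ backwardDomain Ω Φ := fun h' ↦ h (hs.2 h')
    rw [indicator_of_notMem h, indicator_of_notMem hmem]

theorem santalo_of_global (hn : 2 ≤ n) (hΩ : IsOpen Ω)
    (hΩb : Bornology.IsBounded Ω) (hΩs : HasSmoothBoundary Ω)
    (hF : Continuous fun q : Sp n × Sp n ↦ force φ Y q.1 q.2)
    (hY : ∀ x ∈ closure Ω, (Y x).transpose = -Y x) (hφ : ContDiff ℝ ∞ φ)
    (hc0 : 0 < c) (hPc : ∀ x, c ≤ P φ τ x) (hPA : ∀ x, P φ τ x ≤ A)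
    (hΦ : IsCutoffFlow (vectorField φ Y) R Z K M Φ)
    (hR : ∀ q ∈ shell φ τ (closure Ω), ‖q‖ < R) (hnt : NonTrapping φ Y τ Ω)
    (hf : Integrable f (phaseMeasure φ τ Ω)) :
    (∀ᵐ q ∂(xiMeasure φ τ Ω), IntervalIntegrable
      (fun s ↦ P φ τ (flow φ Y Ω q s).1 ^ (1 / 2 : ℝ) • f (flow φ Y Ω q s))
      volume (ellMinus φ Y Ω q) 0) ∧
    Integrable (fun q ↦ P φ τ q.1 ^ (-1 / 2 : ℝ) •
      ∫ s in (ellMinus φ Y Ω q)..0,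
        P φ τ (flow φ Y Ω q s).1 ^ (1 / 2 : ℝ) • f (flow φ Y Ω q s)) (xiMeasure φ τ Ω) ∧
    ∫ q, f q ∂phaseMeasure φ τ Ω =
      ∫ q, P φ τ q.1 ^ (-1 / 2 : ℝ) • (∫ s in (ellMinus φ Y Ω q)..0,
        P φ τ (flow φ Y Ω q s).1 ^ (1 / 2 : ℝ) • f (flow φ Y Ω q s)) ∂(xiMeasure φ τ Ω) := by
  have hP0 : ∀ x, 0 < P φ τ x := fun x ↦ hc0.trans_le (hPc x)
  have hp : ∀ x, 0 < speed φ τ x := fun x ↦ Real.sqrt_pos.2 (hP0 x)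
  have hφd : Differentiable ℝ φ := hφ.differentiable (by simp)
  have hΦc := hΦ.flow.continuous hΦ.lipschitz
  have hΨ : Measurable fun z : (Sp n × Sp n) × ℝ ↦ Φ z.2 z.1 :=
    (hΦc.comp continuous_swap).measurable
  have hDm := measurableSet_backwardDomain hΩ hΦc
  have := isFiniteMeasure_surfaceMeasure hΩ hΩb hΩs
  have := isFiniteMeasure_xiMeasure hΩ hΩb hΩs hφ.continuous hP0 hPA
  have hxi : IsFiniteMeasure (xiTime φ τ Ω) := isFiniteMeasure_withDensity_inv_speed hc0 hPc
  simp only [rpow_half_P, rpow_neg_half_P hP0]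
  -- Multiplying by `p` cancels the density `p⁻¹` on the phase side. On the boundary side the factor
  -- `p` is evaluated along the trajectory, while `p⁻¹` stays at its end point on `∂Ω`.
  let g : Sp n × Sp n → 𝕜 := fun q ↦ speed φ τ q.1 • f q
  have hgf : (fun q ↦ (speed φ τ q.1)⁻¹ • g q) = f := funext fun q ↦
    inv_smul_smul₀ (hp q.1).ne' _
  have hmeas := phaseTime_eq_orbitMeasure hn hΩ hΩb hΩs hF hY hφ hc0 hPc hPA hΦ hR hnt
  have hg : Integrable g (phaseTime φ τ Ω) := by
    rw [phaseTime, integrable_withDensity_inv_speed_iff hφ.continuous, hgf]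
    exact hf
  have hg' : Integrable g (orbitMeasure φ τ Ω Φ) := hmeas ▸ hg
  have hI : Integrable ((backwardDomain Ω Φ).indicator fun z ↦ g (Φ z.2 z.1))
      ((xiTime φ τ Ω).prod volume) :=
    (integrable_indicator_iff hDm).2 ((integrable_map_measure hg'.1 hΨ.aemeasurable).1 hg')
  have hind : ∀ᵐ q ∂xiMeasure φ τ Ω,
      (fun s ↦ (backwardDomain Ω Φ).indicator (fun z ↦ g (Φ z.2 z.1)) (q, s)) =ᵐ[volume]
        (Ioc (ellMinus φ Y Ω q) 0).indicator fun s ↦ g (flow φ Y Ω q s) := by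
    filter_upwards [ae_xiMeasure_mem_outgoing hΩ hΩs hφ.continuous] with q hq
    have hq' : q ∈ shell φ τ (closure Ω) := ⟨frontier_subset_closure hq.1.1, hq.1.2⟩
    exact indicator_backwardDomain_ae_eq hΦ hφd hY hP0 hR hq' (hnt q hq').2 g
  have hle : ∀ q, ellMinus φ Y Ω q ≤ 0 := fun q ↦ Real.sInf_nonpos fun t ht ↦ ht.1
  have hint : ∀ᵐ q ∂xiMeasure φ τ Ω,
      (speed φ τ q.1)⁻¹ • ∫ s, (backwardDomain Ω Φ).indicator (fun z ↦ g (Φ z.2 z.1)) (q, s) =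
        (speed φ τ q.1)⁻¹ • ∫ s in (ellMinus φ Y Ω q)..0, g (flow φ Y Ω q s) := by
    filter_upwards [hind] with q hq
    rw [integral_congr_ae hq, integral_indicator measurableSet_Ioc,
      intervalIntegral.integral_of_le (hle q)]
  refine ⟨?_, ?_, ?_⟩
  · filter_upwards [hind, ae_of_ae_withDensity_inv_speed hφ.continuous hP0 hI.prod_right_ae]
      with q hq hqi
    rw [intervalIntegrable_iff_integrableOn_Ioc_of_le (hle q)]
    exact (integrable_indicator_iff measurableSet_Ioc).1 (hqi.congr hq)
  · exact ((integrable_withDensity_inv_speed_iff hφ.continuous).1 hI.integral_prod_left).congr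
      hint
  · calc ∫ q, f q ∂phaseMeasure φ τ Ω = ∫ q, g q ∂phaseTime φ τ Ω := by
          rw [phaseTime, integral_withDensity_inv_speed hφ.continuous, hgf]
      _ = ∫ q, (∫ s, (backwardDomain Ω Φ).indicator (fun z ↦ g (Φ z.2 z.1)) (q, s))
            ∂xiTime φ τ Ω := by
          rw [hmeas, orbitMeasure, integral_map hΨ.aemeasurable hg'.1, ← integral_indicator hDm,
            integral_prod _ hI]
      _ = _ := by
          rw [xiTime, integral_withDensity_inv_speed hφ.continuous]
          exact integral_congr_ae hint

end GlobalForce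

/-! ### Extension of the force to the whole space -/

section Extension

open Filter Topology

theorem contDiff_mul_of_tsupport_subset {E : Type*} [NormedAddCommGroup E] [NormedSpace ℝ E]
    {U : Set E} (hU : IsOpen U) {χ g : E → ℝ} (hχ : ContDiff ℝ ∞ χ) (hχU : tsupport χ ⊆ U)
    (hg : ContDiffOn ℝ ∞ g U) : ContDiff ℝ ∞ fun x ↦ χ x * g x := by
  refine contDiff_iff_contDiffAt.2 fun x ↦ ?_
  by_cases hx : x ∈ tsupport χ
  · exact hχ.contDiffAt.mul (hg.contDiffAt (hU.mem_nhds (hχU hx)))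
  · refine (contDiffAt_const (c := (0 : ℝ))).congr_of_eventuallyEq ?_
    filter_upwards [notMem_tsupport_iff_eventuallyEq.1 hx] with y hy
    rw [hy, Pi.zero_apply, zero_mul]

/-- The force can be extended to the whole space. -/
theorem exists_global_extension {K U : Set (Sp n)} (hK : IsCompact K) (hU : IsOpen U)
    (hKU : K ⊆ U) {φ : Sp n → ℝ} (hφ : ContDiffOn ℝ ∞ φ U) {Y : Sp n → Matrix (Fin n) (Fin n) ℝ}
    (hY : ∀ i j, ContDiffOn ℝ ∞ (fun x ↦ Y x i j) U) {τ : ℝ} (hτ : ∀ x ∈ K, φ x < τ) :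
    ∃ (φ' : Sp n → ℝ) (Y' : Sp n → Matrix (Fin n) (Fin n) ℝ) (c A : ℝ), ContDiff ℝ ∞ φ' ∧
      (∀ i j, ContDiff ℝ ∞ fun x ↦ Y' x i j) ∧ 0 < c ∧ (∀ x, c ≤ P φ' τ x) ∧
      (∀ x, P φ' τ x ≤ A) ∧ (∀ᶠ x in 𝓝ˢ K, φ' x = φ x) ∧ ∀ x ∈ K, Y' x = Y x := by
  -- The cutoff must also live where `φ < τ`, so that the extended potential stays below `τ`.
  have hU' : IsOpen (U ∩ φ ⁻¹' Iio τ) := hφ.continuousOn.isOpen_inter_preimage hU isOpen_Iio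
  obtain ⟨χ, hχ, hχc, hχ01, hχ1, hχU⟩ :=
    exists_cutoff hK hU' (subset_inter hKU fun x hx ↦ hτ x hx)
  -- This interpolates between `φ` and the constant `τ - 1`. Then `P` is a convex combination of its
  -- old positive value and `2`, and equals `2` outside a compact set, whence the uniform bounds.
  have hφ' : ContDiff ℝ ∞ fun x ↦ χ x * (φ x - (τ - 1)) + (τ - 1) :=
    (contDiff_mul_of_tsupport_subset hU hχ (hχU.trans inter_subset_left)
      (hφ.sub contDiffOn_const)).add contDiff_const
  let φ' : Sp n → ℝ := fun x ↦ χ x * (φ x - (τ - 1)) + (τ - 1)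
  have hPφ : ∀ x, P φ' τ x = 2 * (χ x * (τ - φ x) + (1 - χ x)) := fun x ↦ by
    simp only [P, φ']; ring
  have hPc : Continuous (P φ' τ) := by
    have := hφ'.continuous
    unfold P; fun_prop
  have hpos : ∀ x ∈ tsupport χ, 0 < P φ' τ x := fun x hx ↦ by
    have h1 : φ x < τ := (hχU hx).2
    obtain ⟨h2, h3⟩ := hχ01 x
    rw [hPφ]
    rcases h2.eq_or_lt with h0 | h0
    · rw [← h0]; norm_num
    · nlinarith [mul_pos h0 (sub_pos.2 h1)]
  have hout : ∀ x ∉ tsupport χ, P φ' τ x = 2 := fun x hx ↦ by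
    rw [hPφ, image_eq_zero_of_notMem_tsupport hx]; norm_num
  obtain ⟨c, hc, hc'⟩ := hχc.isCompact.exists_forall_le' hPc.continuousOn hpos
  obtain ⟨A, hA⟩ := hχc.isCompact.bddAbove_image hPc.continuousOn
  refine ⟨φ', fun x ↦ χ x • Y x, min c 2, max A 2, hφ', fun i j ↦ ?_, lt_min hc two_pos,
    fun x ↦ ?_, fun x ↦ ?_, ?_, fun x hx ↦ ?_⟩
  · exact contDiff_mul_of_tsupport_subset hU hχ (hχU.trans inter_subset_left) (hY i j)
  · by_cases hx : x ∈ tsupport χ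
    · exact (min_le_left _ _).trans (hc' x hx)
    · rw [hout x hx]; exact min_le_right _ _
  · by_cases hx : x ∈ tsupport χ
    · exact (hA (mem_image_of_mem _ hx)).trans (le_max_left _ _)
    · rw [hout x hx]; exact le_max_right _ _
  · filter_upwards [hχ1] with x hx
    simp only [φ', hx]; ring
  · beta_reduce
    rw [hχ1.self_of_nhdsSet x hx, one_smul]

theorem contDiff_force {φ : Sp n → ℝ} {Y : Sp n → Matrix (Fin n) (Fin n) ℝ}
    (hφ : ContDiff ℝ ∞ φ) (hY : ∀ i j, ContDiff ℝ ∞ fun x ↦ Y x i j) :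
    ContDiff ℝ ∞ fun q : Sp n × Sp n ↦ force φ Y q.1 q.2 := by
  have h1 : ContDiff ℝ ∞ (∇ φ) :=
    (InnerProductSpace.toDual ℝ (Sp n)).symm.contDiff.comp (hφ.fderiv_right (m := ∞) (by simp))
  have h2 : ContDiff ℝ ∞ fun q : Sp n × Sp n ↦ Matrix.toEuclideanLin (Y q.1) q.2 := by
    refine contDiff_euclidean.2 fun i ↦ ?_
    have h3 : ∀ q : Sp n × Sp n, Matrix.toEuclideanLin (Y q.1) q.2 i =
        ∑ j, Y q.1 i j * q.2 j := fun q ↦ rfl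
    simp only [h3]
    refine ContDiff.sum fun j _ ↦ ((hY i j).comp contDiff_fst).mul ?_
    exact (contDiff_euclidean.1 contDiff_snd) j
  exact ((h1.comp contDiff_fst).neg).add h2

theorem isBounded_shell {φ : Sp n → ℝ} {τ A : ℝ} {S : Set (Sp n)} (hS : Bornology.IsBounded S)
    (hP0 : ∀ x, 0 < P φ τ x) (hPA : ∀ x, P φ τ x ≤ A) :
    ∃ R, ∀ q ∈ shell φ τ S, ‖q‖ < R := by
  obtain ⟨r, hr⟩ := hS.exists_norm_le
  refine ⟨max r (√A) + 1, fun q hq ↦ lt_of_le_of_lt (max_le_max (hr _ hq.1) ?_) (lt_add_one _)⟩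
  rw [(energy_eq_iff hP0).1 hq.2.2]
  exact Real.sqrt_le_sqrt (hPA _)

end Extension

/-! ### Independence of the extension -/

section Congruence

open Filter Topology

variable {Ω : Set (Sp n)} {φ φ' : Sp n → ℝ} {Y Y' : Sp n → Matrix (Fin n) (Fin n) ℝ} {τ : ℝ}

/-- At times without a solution the default value `q` of the flow is also in the closure, so
potentials that agree there can be exchanged at every time. -/
theorem flow_mem_closure {q : Sp n × Sp n} (hq : q.1 ∈ closure Ω) (t : ℝ) :
    (flow φ Y Ω q t).1 ∈ closure Ω := by
  unfold flow
  split_ifs with h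
  · exact h.choose_spec.2.2 t right_mem_uIcc
  · exact hq

theorem P_congr {x : Sp n} (h : φ' x = φ x) : P φ' τ x = P φ τ x := by rw [P, P, h]

theorem speed_congr {x : Sp n} (h : φ' x = φ x) : speed φ' τ x = speed φ τ x := by
  rw [speed, speed, P_congr h]

theorem fiberMeasure_congr {x : Sp n} (h : φ' x = φ x) :
    fiberMeasure φ' τ x = fiberMeasure φ τ x := by
  rw [fiberMeasure, fiberMeasure, speed_congr h]

theorem bundleMeasure_congr {m : Measure (Sp n)} [SFinite m] (h : ∀ᵐ x ∂m, φ' x = φ x) :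
    bundleMeasure φ' τ m = bundleMeasure φ τ m := by
  have h1 : ∀ᵐ r ∂(m.prod (volume : Measure (Sp n)).toSphere), φ' r.1 = φ r.1 :=
    Measure.quasiMeasurePreserving_fst.ae h
  rw [bundleMeasure, bundleMeasure]
  have h2 : (fun r : Sp n × Metric.sphere (0 : Sp n) 1 ↦
      ENNReal.ofReal (speed φ' τ r.1 ^ (n - 1))) =ᵐ[m.prod (volume : Measure (Sp n)).toSphere]
      fun r ↦ ENNReal.ofReal (speed φ τ r.1 ^ (n - 1)) := by
    filter_upwards [h1] with r hr
    rw [speed_congr hr]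
  rw [withDensity_congr_ae h2]
  refine Measure.map_congr ((withDensity_absolutelyContinuous _ _).ae_le ?_)
  filter_upwards [h1] with r hr
  rw [speed_congr hr]

theorem shell_congr {S : Set (Sp n)} (h : ∀ x ∈ S, φ' x = φ x) : shell φ' τ S = shell φ τ S := by
  ext q
  refine and_congr_right fun hq ↦ and_congr_right fun _ ↦ ?_
  rw [energy, energy, h _ hq]

theorem phaseMeasure_congr (hΩ : IsOpen Ω) (h : ∀ x ∈ closure Ω, φ' x = φ x) :
    phaseMeasure φ' τ Ω = phaseMeasure φ τ Ω := by
  refine bundleMeasure_congr ?_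
  filter_upwards [ae_restrict_mem hΩ.measurableSet] with x hx
  exact h x (subset_closure hx)

theorem xiMeasure_congr [SFinite (surfaceMeasure Ω)] (h : ∀ x ∈ closure Ω, φ' x = φ x) :
    xiMeasure φ' τ Ω = xiMeasure φ τ Ω := by
  have h1 : bundleMeasure φ' τ (surfaceMeasure Ω) = bundleMeasure φ τ (surfaceMeasure Ω) := by
    refine bundleMeasure_congr ?_
    filter_upwards [ae_restrict_mem isClosed_frontier.measurableSet] with x hx
    exact h x (frontier_subset_closure hx)
  rw [xiMeasure, xiMeasure, h1, outgoing, outgoing,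
    shell_congr fun x hx ↦ h x (frontier_subset_closure hx)]

/-- The gradient enters the force, so the potentials must agree on a neighbourhood of the closure;
for the matrix field its values on the closure suffice. -/
theorem isTrajectory_congr (h : ∀ᶠ x in 𝓝ˢ (closure Ω), φ' x = φ x)
    (hY : ∀ x ∈ closure Ω, Y' x = Y x) : IsTrajectory φ' Y' Ω = IsTrajectory φ Y Ω := by
  have hv : ∀ q : Sp n × Sp n, q.1 ∈ closure Ω → vectorField φ' Y' q = vectorField φ Y q := by
    intro q hq
    have h1 : φ' =ᶠ[𝓝 q.1] φ := eventually_nhdsSet_iff_forall.1 h _ hq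
    rw [vectorField, vectorField, force, force, hY _ hq, gradient, gradient, h1.fderiv_eq]
  ext q t c
  refine and_congr_right fun _ ↦ ⟨fun ⟨h1, h2⟩ ↦ ⟨fun s hs ↦ ?_, h2⟩,
    fun ⟨h1, h2⟩ ↦ ⟨fun s hs ↦ ?_, h2⟩⟩
  · beta_reduce
    rw [← hv _ (h2 s hs)]; exact h1 s hs
  · beta_reduce
    rw [hv _ (h2 s hs)]; exact h1 s hs

theorem flow_congr (h : IsTrajectory φ' Y' Ω = IsTrajectory φ Y Ω) :
    flow φ' Y' Ω = flow φ Y Ω := by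
  unfold flow; rw [h]

theorem backwardTimes_congr (h : IsTrajectory φ' Y' Ω = IsTrajectory φ Y Ω) :
    backwardTimes φ' Y' Ω = backwardTimes φ Y Ω := by
  unfold backwardTimes; rw [h]

theorem nonTrapping_congr (h : IsTrajectory φ' Y' Ω = IsTrajectory φ Y Ω)
    (hφ : ∀ x ∈ closure Ω, φ' x = φ x) : NonTrapping φ' Y' τ Ω ↔ NonTrapping φ Y τ Ω := by
  unfold NonTrapping forwardTimes
  rw [backwardTimes_congr h, h, shell_congr hφ]

end Congruence

/-- Santaló's formula with an external force. -/
theorem santalo_formula {𝕜 : Type*} [RCLike 𝕜] (hn : 2 ≤ n)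
    (Ω : Set (Sp n)) (hΩ : IsOpen Ω) (hΩb : Bornology.IsBounded Ω)
    (hΩs : HasSmoothBoundary Ω)
    (U : Set (Sp n)) (hU : IsOpen U) (hΩU : closure Ω ⊆ U)
    (φ : Sp n → ℝ) (hφ : ContDiffOn ℝ ∞ φ U)
    (Y : Sp n → Matrix (Fin n) (Fin n) ℝ)
    (hY : ∀ i j, ContDiffOn ℝ ∞ (fun x ↦ Y x i j) U)
    (hYskew : ∀ x ∈ closure Ω, (Y x).transpose = -Y x)
    (τ : ℝ) (hτ : ∀ x ∈ closure Ω, φ x < τ)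
    (hnt : NonTrapping φ Y τ Ω)
    (f : Sp n × Sp n → 𝕜)
    (hf : Integrable f (phaseMeasure φ τ Ω)) :
    (∀ᵐ x ∂(volume.restrict Ω), Integrable (fun θ ↦ f (x, θ)) (fiberMeasure φ τ x)) ∧
    Integrable (fun x ↦ ∫ θ, f (x, θ) ∂(fiberMeasure φ τ x)) (volume.restrict Ω) ∧
    (∀ᵐ q ∂(xiMeasure φ τ Ω), IntervalIntegrable
      (fun s ↦ P φ τ (flow φ Y Ω q s).1 ^ (1 / 2 : ℝ) • f (flow φ Y Ω q s))
      volume (ellMinus φ Y Ω q) 0) ∧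
    Integrable (fun q ↦ P φ τ q.1 ^ (-1 / 2 : ℝ) •
      ∫ s in (ellMinus φ Y Ω q)..0,
        P φ τ (flow φ Y Ω q s).1 ^ (1 / 2 : ℝ) • f (flow φ Y Ω q s))
      (xiMeasure φ τ Ω) ∧
    ∫ x in Ω, ∫ θ, f (x, θ) ∂(fiberMeasure φ τ x) =
      ∫ q, P φ τ q.1 ^ (-1 / 2 : ℝ) •
        (∫ s in (ellMinus φ Y Ω q)..0,
          P φ τ (flow φ Y Ω q s).1 ^ (1 / 2 : ℝ) • f (flow φ Y Ω q s))
        ∂(xiMeasure φ τ Ω) := by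
  have hK : IsCompact (closure Ω) := hΩb.isCompact_closure
  obtain ⟨φ', Y', c, A, hφ', hY', hc, hPc, hPA, hφe, hYe⟩ :=
    exists_global_extension hK hU hΩU hφ hY hτ
  have hφK : ∀ x ∈ closure Ω, φ' x = φ x := fun x hx ↦ hφe.self_of_nhdsSet x hx
  have hP0 : ∀ x, 0 < P φ' τ x := fun x ↦ hc.trans_le (hPc x)
  have hF := contDiff_force hφ' hY'
  -- The shell over the closure of `Ω` is bounded, so the field can be cut off outside a ball
  -- containing it without changing any trajectory in question.
  obtain ⟨R, hR⟩ := isBounded_shell hK.isBounded hP0 hPA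
  obtain ⟨Z, K, M, Φ, hΦ⟩ := exists_isCutoffFlow (W := vectorField φ' Y')
    (contDiff_snd.prodMk hF) R
  have := isFiniteMeasure_surfaceMeasure hΩ hΩb hΩs
  have htr := isTrajectory_congr hφe hYe
  have hflow := flow_congr htr
  have hell : ellMinus φ' Y' Ω = ellMinus φ Y Ω := by
    unfold ellMinus; rw [backwardTimes_congr htr]
  have hxi := xiMeasure_congr (τ := τ) hφK
  have hph := phaseMeasure_congr (τ := τ) hΩ hφK
  have hout : ∀ᵐ q ∂xiMeasure φ τ Ω, q.1 ∈ closure Ω := by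
    rw [← hxi]
    filter_upwards [ae_xiMeasure_mem_outgoing hΩ hΩs hφ'.continuous] with q hq
    exact frontier_subset_closure hq.1.1
  rw [← hph] at hf
  obtain ⟨h1, h2, h3⟩ := santalo_of_global hn hΩ hΩb hΩs hF.continuous
    (fun x hx ↦ by rw [hYe x hx]; exact hYskew x hx) hφ' hc hPc hPA hΦ hR
    ((nonTrapping_congr htr hφK).2 hnt) hf
  obtain ⟨h4, h5, h6⟩ := integrable_fiber_of_integrable_bundleMeasure hφ'.continuous hP0 hf
  have hfib : ∀ᵐ x ∂(volume.restrict Ω), fiberMeasure φ' τ x = fiberMeasure φ τ x := by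
    filter_upwards [ae_restrict_mem hΩ.measurableSet] with x hx
    exact fiberMeasure_congr (hφK x (subset_closure hx))
  have hfint : (fun x ↦ ∫ θ, f (x, θ) ∂fiberMeasure φ' τ x) =ᵐ[volume.restrict Ω]
      fun x ↦ ∫ θ, f (x, θ) ∂fiberMeasure φ τ x := by
    filter_upwards [hfib] with x hx
    rw [hx]
  rw [hflow, hell, hxi] at h1 h2 h3
  have hPflow : ∀ q : Sp n × Sp n, q.1 ∈ closure Ω → ∀ s,
      P φ' τ (flow φ Y Ω q s).1 = P φ τ (flow φ Y Ω q s).1 := fun q hq s ↦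
    P_congr (hφK _ (flow_mem_closure hq s))
  have hint : (fun q ↦ P φ' τ q.1 ^ (-1 / 2 : ℝ) • ∫ s in (ellMinus φ Y Ω q)..0,
        P φ' τ (flow φ Y Ω q s).1 ^ (1 / 2 : ℝ) • f (flow φ Y Ω q s)) =ᵐ[xiMeasure φ τ Ω]
      fun q ↦ P φ τ q.1 ^ (-1 / 2 : ℝ) • ∫ s in (ellMinus φ Y Ω q)..0,
        P φ τ (flow φ Y Ω q s).1 ^ (1 / 2 : ℝ) • f (flow φ Y Ω q s) := by
    filter_upwards [hout] with q hq
    simp only [hPflow q hq, P_congr (hφK _ hq)]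
  refine ⟨?_, h5.congr hfint, ?_, h2.congr hint, ?_⟩
  · filter_upwards [h4, hfib] with x hx hx'
    rwa [← hx']
  · filter_upwards [h1, hout] with q hq hq'
    simpa only [hPflow q hq'] using hq
  · rw [← integral_congr_ae hfint, ← integral_congr_ae hint]
    exact h6.trans h3

end Santalo

end

theorem propositionA1 {𝕜 : Type*} [RCLike 𝕜] (n : ℕ) (hn : 2 ≤ n)
    (Ω : Set (Santalo.Sp n)) (hΩ : IsOpen Ω) (hΩb : Bornology.IsBounded Ω)
    (hΩs : Santalo.HasSmoothBoundary Ω)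
    (U : Set (Santalo.Sp n)) (hU : IsOpen U) (hΩU : closure Ω ⊆ U)
    (φ : Santalo.Sp n → ℝ) (hφ : ContDiffOn ℝ ∞ φ U)
    (Y : Santalo.Sp n → Matrix (Fin n) (Fin n) ℝ)
    (hY : ∀ i j, ContDiffOn ℝ ∞ (fun x ↦ Y x i j) U)
    (hYskew : ∀ x ∈ closure Ω, (Y x).transpose = -Y x)
    (τ : ℝ) (hτ : ∀ x ∈ closure Ω, φ x < τ)
    (hnt : Santalo.NonTrapping φ Y τ Ω)
    (f : Santalo.Sp n × Santalo.Sp n → 𝕜)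
    (hf : Integrable f (Santalo.phaseMeasure φ τ Ω)) :
    (∀ᵐ x ∂(volume.restrict Ω), Integrable (fun θ ↦ f (x, θ)) (Santalo.fiberMeasure φ τ x)) ∧
    Integrable (fun x ↦ ∫ θ, f (x, θ) ∂(Santalo.fiberMeasure φ τ x)) (volume.restrict Ω) ∧
    (∀ᵐ q ∂(Santalo.xiMeasure φ τ Ω), IntervalIntegrable
      (fun s ↦ Santalo.P φ τ (Santalo.flow φ Y Ω q s).1 ^ (1 / 2 : ℝ) • f (Santalo.flow φ Y Ω q s))
      volume (Santalo.ellMinus φ Y Ω q) 0) ∧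
    Integrable (fun q ↦ Santalo.P φ τ q.1 ^ (-1 / 2 : ℝ) •
      ∫ s in (Santalo.ellMinus φ Y Ω q)..0,
        Santalo.P φ τ (Santalo.flow φ Y Ω q s).1 ^ (1 / 2 : ℝ) • f (Santalo.flow φ Y Ω q s))
      (Santalo.xiMeasure φ τ Ω) ∧
    ∫ x in Ω, ∫ θ, f (x, θ) ∂(Santalo.fiberMeasure φ τ x) =
      ∫ q, Santalo.P φ τ q.1 ^ (-1 / 2 : ℝ) •
        (∫ s in (Santalo.ellMinus φ Y Ω q)..0,
          Santalo.P φ τ (Santalo.flow φ Y Ω q s).1 ^ (1 / 2 : ℝ) • f (Santalo.flow φ Y Ω q s))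
        ∂(Santalo.xiMeasure φ τ Ω) :=
  Santalo.santalo_formula hn Ω hΩ hΩb hΩs U hU hΩU φ hφ Y hY hYskew τ hτ hnt f hf
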